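/- **Setting.** Let $K$ be an algebraically closed field, $\Lambda$ a finite-dimensional $K$-algebra, and let $\mathcal K_\Lambda = \mathsf K^{\rm b}(\operatorname{proj}\Lambda)$ be the bounded homotopy category of finitely generated projective right $\Lambda$-modules. An object $T$ of $\mathcal K_\Lambda$ is *silting* if $\operatorname{Hom}(T,T[i])=0$ for all $i>0$ and $\mathcal K_\Lambda$ is the smallest thick subcategory containing $T$; it is *basic* if it is a finite direct sum of pairwise non-isomorphic indecomposable objects. Write $T\ge U$ if $\operatorname{Hom}(T,U[i])=0$ for all $i>0$. Let $\operatorname{\mathsf{2silt}}\Lambda$ be the set of isomorphism classes of basic silting objects $T$ with $\Lambda\ge T\ge\Lambda[1]$. Let $e$ be a primitive idempotent of $\Lambda$ and $P=e\Lambda$. Let $B$ be the basic version of $\Lambda$ (the basic object with $\operatorname{add}B=\operatorname{add}\Lambda$) and write $B= P\oplus M$. The left mutation is $\mu_P^-(\Lambda)=Y\oplus M$, where $P\xrightarrow{f}M'\to Y\to P[1]$ is a triangle and $f$ is a minimal left $\operatorname{add}M$-approximation of $P$. The right mutation is $\mu^+_{P[1]}(\Lambda[1])=Z\oplus M[1]$,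 where $Z\to M''\xrightarrow{g}P[1]\to Z[1]$ is a triangle and $g$ is a minimal right $\operatorname{add}M[1]$-approximation of $P[1]$. Put $$\mathcal T_P^-=\{T\in\operatorname{\mathsf{2silt}}\Lambda \mid \mu_P^-(\Lambda)\ge T\ge \Lambda[1]\},\qquad \mathcal T_P^+=\{T\in\operatorname{\mathsf{2silt}}\Lambda \mid \Lambda\ge T\ge \mu_{P[1]}^+(\Lambda[1])\}.$$ Let $\sigma:\Lambda^{\rm op}\to\Lambda$ be a $K$-algebra isomorphism. It induces, by transport of structure, an equivalence $\sigma:\mathcal K_{\Lambda^{\rm op}}\to\mathcal K_\Lambda$ (a left $\Lambda$-module $N$ becomes a right $\Lambda$-module through $n\cdot a=\sigma^{-1}(a)n$). Let $S_\sigma=[1]\circ\sigma\circ\operatorname{Hom}_\Lambda(-,\Lambda)$, a contravariant functor from $\mathcal K_\Lambda$ to itself. **Theorem.** Suppose $\sigma(e)=e$. Then: 1. $\operatorname{\mathsf{2silt}}\Lambda=\mathcal T_P^-\sqcup\mathcal T_P^+$ (disjoint union). 2. $S_\sigma$ induces a bijection $\mathcal T_P^-\to\mathcal T_P^+$ which reverses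 the order: for $T,U\in\mathcal T_P^-$ one has $T\ge U$ if and only if $S_\sigma(U)\ge S_\sigma(T)$. 3. $|\operatorname{\mathsf{2silt}}\Lambda|=2\cdot|\mathcal T_P^-|=2\cdot|\mathcal T_P^+|$ as cardinal numbers; in particular, if $\operatorname{\mathsf{2silt}}\Lambda$ is finite, then its number of elements is even. -/

import Mathlib

namespace Silt

open CategoryTheory Limits MulOpposite Opposite

universe v u

/-! ### Silting theory in a triangulated category -/

section Triangulated

variable {C : Type*} [Category C] [HasZeroObject C] [Preadditive C] [HasShift C ℤ]
  [∀ n : ℤ, (shiftFunctor C n).Additive] [Pretriangulated C]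

/-- `T ≥ U`, that is, `Hom(T, U[i]) = 0` for every integer `i > 0`. -/
def Geq (T U : C) : Prop := ∀ i : ℤ, 0 < i → ∀ f : T ⟶ U⟦i⟧, f = 0

/-- `T` is silting: `Hom(T, T[i]) = 0` for `i > 0`, and the thick closure of `T` (the smallest
triangulated subcategory closed under direct summands which contains `T`) is everything. -/
def IsSilting (T : C) : Prop :=
  Geq T T ∧ (ObjectProperty.singleton T).IsClassicalTriangulatedGenerator

/-- `T` is basic: it is a finite direct sum of pairwise non-isomorphic indecomposable objects. -/
def IsBasic (T : C) : Prop :=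
  ∃ (n : ℕ) (X : Fin n → C), (∀ i, Indecomposable (X i)) ∧
    (∀ i j, Nonempty (X i ≅ X j) → i = j) ∧ Nonempty (T ≅ ⨁ X)

/-- `add M`: the direct summands of finite direct sums of copies of `M`. -/
def addOf (M : C) : ObjectProperty C :=
  fun X => ∃ n : ℕ, Nonempty (Retract X (⨁ fun _ : Fin n => M))

/-- `B` is a basic version of `T`: it is basic, and `add B = add T`. -/
def IsBasicVersion (B T : C) : Prop := IsBasic B ∧ addOf B = addOf T

/-- `f : X ⟶ M'` is a minimal left `add M`-approximation of `X`. -/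
structure IsMinLeftApprox (M : C) {X M' : C} (f : X ⟶ M') : Prop where
  mem : addOf M M'
  factors : ∀ N : C, addOf M N → ∀ g : X ⟶ N, ∃ h : M' ⟶ N, f ≫ h = g
  minimal : ∀ φ : M' ⟶ M', f ≫ φ = f → IsIso φ

/-- `f : M' ⟶ X` is a minimal right `add M`-approximation of `X`. -/
structure IsMinRightApprox (M : C) {X M' : C} (f : M' ⟶ X) : Prop where
  mem : addOf M M'
  factors : ∀ N : C, addOf M N → ∀ g : N ⟶ X, ∃ h : N ⟶ M', h ≫ f = g
  minimal : ∀ φ : M' ⟶ M', φ ≫ f = f → IsIso φ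

/-- `U` is (isomorphic to) the left mutation of `T` with respect to its direct summand `X`:
if `T = X ⊕ M` and `X ⟶ M' ⟶ Y ⟶ X[1]` is a triangle on a minimal left `add M`-approximation
of `X`, then `U = Y ⊕ M`. -/
def IsLeftMutation (T X U : C) : Prop :=
  ∃ (M M' Y : C) (f : X ⟶ M') (g : M' ⟶ Y) (h : Y ⟶ X⟦(1 : ℤ)⟧),
    Nonempty (T ≅ X ⊞ M) ∧ IsMinLeftApprox M f ∧
    Pretriangulated.Triangle.mk f g h ∈ Pretriangulated.distinguishedTriangles ∧
    Nonempty (U ≅ Y ⊞ M)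

/-- `U` is (isomorphic to) the right mutation of `T` with respect to its direct summand `X`:
if `T = X ⊕ M` and `Y ⟶ M' ⟶ X ⟶ Y[1]` is a triangle on a minimal right `add M`-approximation
of `X`, then `U = Y ⊕ M`. -/
def IsRightMutation (T X U : C) : Prop :=
  ∃ (M M' Y : C) (g : Y ⟶ M') (f : M' ⟶ X) (h : X ⟶ Y⟦(1 : ℤ)⟧),
    Nonempty (T ≅ X ⊞ M) ∧ IsMinRightApprox M f ∧
    Pretriangulated.Triangle.mk g f h ∈ Pretriangulated.distinguishedTriangles ∧
    Nonempty (U ≅ Y ⊞ M)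

end Triangulated

lemma Geq.of_iso {C : Type*} [Category C] [Preadditive C] [HasShift C ℤ]
    {T T' U U' : C} (e : T ≅ T') (e' : U ≅ U') (h : Geq T U) : Geq T' U' := by
  intro i hi f
  have h1 := h i hi (e.hom ≫ f ≫ e'.inv⟦i⟧')
  have h2 : f = e.inv ≫ (e.hom ≫ f ≫ e'.inv⟦i⟧') ≫ e'.hom⟦i⟧' := by
    simp [← Functor.map_comp]
  rw [h2, h1]; simp

/-- Isomorphism classes of objects. -/
abbrev IsoClass (C : Type*) [Category C] := Quotient (isIsomorphicSetoid C)

/-- The isomorphism class of an object. -/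
abbrev cls {C : Type*} [Category C] (X : C) : IsoClass C := Quotient.mk _ X

/-- The map on isomorphism classes induced by a contravariant functor. -/
def isoClassMap {C D : Type*} [Category C] [Category D] (F : Cᵒᵖ ⥤ D) :
    IsoClass C → IsoClass D :=
  Quotient.map (fun X => F.obj (op X)) fun _ _ ⟨e⟩ => ⟨F.mapIso e.symm.op⟩

section Triangulated

variable {C : Type*} [Category C] [HasZeroObject C] [Preadditive C] [HasShift C ℤ]
  [∀ n : ℤ, (shiftFunctor C n).Additive] [Pretriangulated C]

/-- The relation `≥` on isomorphism classes. -/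
def clsGeq : IsoClass C → IsoClass C → Prop :=
  Quotient.lift₂ Geq fun _ _ _ _ ⟨e⟩ ⟨e'⟩ => propext
    ⟨Geq.of_iso e e', Geq.of_iso e.symm e'.symm⟩

variable (C) in
/-- `silt`: the isomorphism classes of basic silting objects. -/
def silt : Set (IsoClass C) := {t | ∃ T : C, t = cls T ∧ IsBasic T ∧ IsSilting T}

/-- The classes `t` of basic silting objects with `A ≥ t ≥ A[1]`. -/
def twoSilt (A : C) : Set (IsoClass C) :=
  {t | t ∈ silt C ∧ clsGeq (cls A) t ∧ clsGeq t (cls (A⟦(1 : ℤ)⟧))}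

/-- The `t` in `twoSilt A` with `μ ≥ t ≥ A[1]`, where `μ` is the left mutation
of (a basic version of) `A` with respect to `P`. -/
def minusPart (A P : C) : Set (IsoClass C) :=
  {t | t ∈ twoSilt A ∧ ∃ B U : C, IsBasicVersion B A ∧ IsLeftMutation B P U ∧
    clsGeq (cls U) t ∧ clsGeq t (cls (A⟦(1 : ℤ)⟧))}

/-- The `t` in `twoSilt A` with `A ≥ t ≥ μ`, where `μ` is the right mutation
of (a basic version of) `A[1]` with respect to `P[1]`. -/
def plusPart (A P : C) : Set (IsoClass C) :=
  {t | t ∈ twoSilt A ∧ ∃ B U : C, IsBasicVersion B (A⟦(1 : ℤ)⟧) ∧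
    IsRightMutation B (P⟦(1 : ℤ)⟧) U ∧ clsGeq (cls A) t ∧ clsGeq t (cls U)}

end Triangulated

/-! ### The bounded homotopy category of an additive category -/

section Bounded

variable (C : Type*) [Category C] [Preadditive C]

/-- Complexes with only finitely many nonzero terms, as objects of the homotopy category. -/
def bounded : ObjectProperty (HomotopyCategory C (ComplexShape.up ℤ)) :=
  fun K => ∃ a b : ℤ, ∀ i : ℤ, i < a ∨ b < i → IsZero (K.as.X i)

instance [HasZeroObject C] : (bounded C).ContainsZero where
  exists_zero := ⟨(HomotopyCategory.quotient _ _).obj HomologicalComplex.zero,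
    Functor.map_isZero _ HomologicalComplex.isZero_zero, 0, 0, fun _ _ => isZero_zero C⟩

instance : (bounded C).IsStableUnderShift ℤ where
  isStableUnderShiftBy n :=
    { le_shift := by
        intro K hK
        obtain ⟨K : CochainComplex C ℤ, rfl⟩ := K.quotient_obj_surjective
        obtain ⟨a, b, h⟩ := hK
        rw [ObjectProperty.prop_shift_iff, HomotopyCategory.shift_quotient_obj]
        exact ⟨a - n, b - n, fun i hi => h (i + n) (by omega)⟩ }

instance [HasZeroObject C] [HasBinaryBiproducts C] : (bounded C).IsTriangulatedClosed₃ where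
  ext₃' T hT h₁ h₂ := by
    obtain ⟨a₁, b₁, h₁⟩ := h₁
    obtain ⟨a₂, b₂, h₂⟩ := h₂
    obtain ⟨f : T.obj₁.as ⟶ T.obj₂.as, hf⟩ :=
      (HomotopyCategory.quotient _ _).map_surjective T.mor₁
    refine ⟨_, ?_, ⟨Pretriangulated.Triangle.π₃.mapIso (Pretriangulated.isoTriangleOfIso₁₂ T _ hT
        (HomotopyCategory.mappingCone_triangleh_distinguished f)
        (Iso.refl _) (Iso.refl _) ?_)⟩⟩
    · refine ⟨min (a₁ - 1) a₂, max b₁ b₂, fun i hi => ?_⟩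
      change IsZero ((CochainComplex.mappingCone f).X i)
      rw [CochainComplex.mappingCone.isZero_X_iff]
      exact ⟨h₁ _ (by omega), h₂ _ (by omega)⟩
    · exact (Category.comp_id _).trans (hf.symm.trans (Category.id_comp _).symm)

instance [HasZeroObject C] [HasBinaryBiproducts C] : (bounded C).IsTriangulated where
  toIsTriangulatedClosed₂ := .of_isTriangulatedClosed₃

/-- The bounded homotopy category of `C`. -/
abbrev Kb := (bounded C).FullSubcategory

variable {C} {D : Type*} [Category D] [Preadditive D]

/-- The functor on bounded homotopy categories induced by an additive functor. -/
def mapKb (F : C ⥤ D) [F.Additive] : Kb C ⥤ Kb D :=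
  (bounded D).lift ((bounded C).ι ⋙ F.mapHomotopyCategory (ComplexShape.up ℤ)) (by
    rintro ⟨K, a, b, h⟩
    exact ⟨a, b, fun i hi => F.map_isZero (h i hi)⟩)

variable (C) in
/-- A complex `X` in `C` viewed as a complex in `Cᵒᵖ`, with `X ^ (-i)` in degree `i`. -/
def opHomotopyCategory : (HomotopyCategory C (ComplexShape.up ℤ))ᵒᵖ ⥤
    HomotopyCategory Cᵒᵖ (ComplexShape.up ℤ) :=
  (CategoryTheory.Quotient.lift _
    ((CochainComplex.opEquivalence C).functor ⋙ HomotopyCategory.quotient Cᵒᵖ _).rightOp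
    (by
      rintro K L f g ⟨h⟩
      exact Quiver.Hom.unop_inj
        (HomotopyCategory.eq_of_homotopy _ _ (CochainComplex.homotopyOp h)))).leftOp

/-- The contravariant functor on bounded homotopy categories induced by a contravariant
additive functor `F`, which sends a complex `X` to the complex with `F (X ^ (-i))` in degree `i`. -/
def mapKbOp (F : Cᵒᵖ ⥤ D) [F.Additive] : (Kb C)ᵒᵖ ⥤ Kb D :=
  (bounded D).lift ((bounded C).ι.op ⋙ opHomotopyCategory C ⋙
    F.mapHomotopyCategory (ComplexShape.up ℤ)) (by
    intro K
    obtain ⟨⟨K, a, b, h⟩⟩ := K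
    exact ⟨-b, -a, fun i hi => F.map_isZero (h (-i) (by omega)).op⟩)

/-- An object of `C` as a complex concentrated in degree zero. -/
noncomputable def stalk [HasZeroObject C] (X : C) : Kb C where
  obj := (HomotopyCategory.quotient C (ComplexShape.up ℤ)).obj
    ((HomologicalComplex.single C (ComplexShape.up ℤ) 0).obj X)
  property := ⟨0, 0, fun i hi =>
    HomologicalComplex.isZero_single_obj_X (ComplexShape.up ℤ) 0 X i (by omega)⟩

end Bounded

/-! ### Finitely generated projective modules -/

section Modules

variable (R : Type u) [Ring R]

/-- Finitely generated projective left `R`-modules. -/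
def fgProj : ObjectProperty (ModuleCat.{u} R) :=
  fun M => Module.Finite R M ∧ Module.Projective R M

/-- The category of finitely generated projective left `R`-modules. Right `Λ`-modules are
modules over `Λᵐᵒᵖ`, so that the category of finitely generated projective right
`Λ`-modules is `Proj Λᵐᵒᵖ`. -/
abbrev Proj := (fgProj R).FullSubcategory

instance : (fgProj R).ContainsZero where
  exists_zero := ⟨ModuleCat.of R PUnit.{u + 1}, ModuleCat.isZero_of_subsingleton _,
    inferInstanceAs (Module.Finite R PUnit.{u + 1}),
    inferInstanceAs (Module.Projective R PUnit.{u + 1})⟩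

instance : (fgProj R).IsClosedUnderIsomorphisms where
  of_iso := by
    rintro M N e ⟨_, _⟩
    exact ⟨Module.Finite.equiv e.toLinearEquiv, Module.Projective.of_equiv' e.toLinearEquiv⟩

instance : HasBinaryBiproducts (Proj R) := by
  have : (fgProj R).IsClosedUnderBinaryProducts :=
    { limitsOfShape_le := by
        rintro X ⟨p⟩
        obtain ⟨_, _⟩ := p.prop_diag_obj (.mk .left)
        obtain ⟨_, _⟩ := p.prop_diag_obj (.mk .right)
        have h : fgProj R (ModuleCat.of R
            (p.diag.obj (.mk .left) × p.diag.obj (.mk .right))) :=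
          ⟨inferInstanceAs (Module.Finite R (_ × _)),
            inferInstanceAs (Module.Projective R (_ × _))⟩
        refine (fgProj R).prop_of_iso ?_ h
        exact IsLimit.conePointUniqueUpToIso
          (ModuleCat.binaryProductLimitCone (p.diag.obj (.mk .left))
            (p.diag.obj (.mk .right))).isLimit
          ((IsLimit.postcomposeHomEquiv (diagramIsoPair p.diag) _).2 p.isLimit) }
  have : HasBinaryProducts (Proj R) := inferInstance
  exact HasBinaryBiproducts.of_hasBinaryProducts

variable {R} (Λ : Type u) [Ring Λ]

/-- For a finitely generated projective right module `P`, the left module `Hom(P, Λ)` is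
finitely generated projective. -/
lemma fgProj_dual (P : Type u) [AddCommGroup P] [Module Λᵐᵒᵖ P] [Module.Finite Λᵐᵒᵖ P]
    [Module.Projective Λᵐᵒᵖ P] :
    Module.Finite Λ (P →ₗ[Λᵐᵒᵖ] Λ) ∧ Module.Projective Λ (P →ₗ[Λᵐᵒᵖ] Λ) := by
  obtain ⟨n, f, g, -, -, hfg⟩ := Module.Finite.exists_comp_eq_id_of_projective Λᵐᵒᵖ P
  let i : (P →ₗ[Λᵐᵒᵖ] Λ) →ₗ[Λ] (Fin n → Λ) :=
    { toFun := fun φ k => φ (f (Pi.single k 1))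
      map_add' := fun _ _ => rfl
      map_smul' := fun _ _ => rfl }
  let s : (Fin n → Λ) →ₗ[Λ] (P →ₗ[Λᵐᵒᵖ] Λ) :=
    { toFun := fun v =>
        { toFun := fun x => ∑ k, v k * unop (g x k)
          map_add' := fun x y => by simp [mul_add, Finset.sum_add_distrib]
          map_smul' := fun r x => by simp [Finset.sum_mul, mul_assoc] }
      map_add' := fun v w => by ext x; simp [add_mul, Finset.sum_add_distrib]
      map_smul' := fun r v => by ext x; simp [Finset.mul_sum, mul_assoc] }
  have h : s ∘ₗ i = LinearMap.id := by
    ext φ x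
    have h1 : x = f (g x) := (LinearMap.congr_fun hfg x).symm
    have h2 : g x = ∑ k, g x k • Pi.single k (1 : Λᵐᵒᵖ) := by
      simpa using pi_eq_sum_univ' (g x)
    conv_rhs => rw [LinearMap.id_apply, h1, h2, map_sum, map_sum]
    simp [s, i]
  exact ⟨Module.Finite.of_surjective s fun φ => ⟨i φ, LinearMap.congr_fun h φ⟩,
    Module.Projective.of_split i s h⟩

/-- The `Λ`-dual `Hom(-, Λ)`, from right modules to left modules. -/
def dual : (Proj Λᵐᵒᵖ)ᵒᵖ ⥤ Proj Λ where
  obj P := ⟨ModuleCat.of Λ (P.unop.obj →ₗ[Λᵐᵒᵖ] Λ), by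
    obtain ⟨_, _⟩ := P.unop.property
    exact fgProj_dual Λ P.unop.obj⟩
  map {P Q} f := ObjectProperty.homMk (ModuleCat.ofHom
    { toFun := fun φ => φ ∘ₗ f.unop.hom.hom
      map_add' := fun _ _ => rfl
      map_smul' := fun _ _ => rfl })

instance : (dual Λ).Additive where
  map_add {P Q f g} := by
    apply ObjectProperty.hom_ext
    apply ModuleCat.hom_ext
    refine LinearMap.ext fun φ => LinearMap.ext fun x => ?_
    exact (show P.unop.obj →ₗ[Λᵐᵒᵖ] Λ from φ).map_add _ _

variable {Λ}

/-- A ring isomorphism `τ : S → R` turns a left `R`-module into a left `S`-module. -/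
noncomputable def twist {S : Type u} [Ring S] (τ : S ≃+* R) : Proj R ⥤ Proj S :=
  (fgProj S).lift ((fgProj R).ι ⋙ ModuleCat.restrictScalars τ.toRingHom) (by
    rintro ⟨M, _, _⟩
    have : RingHomInvPair (τ : S →+* R) (τ.symm : R →+* S) := .of_ringEquiv τ
    have : RingHomInvPair (τ.symm : R →+* S) (τ : S →+* R) := .symm _ _
    let e : M ≃ₛₗ[(τ.symm : R →+* S)] (ModuleCat.restrictScalars τ.toRingHom).obj M :=
      { toFun := fun m => m
        invFun := fun m => m
        map_add' := fun _ _ => rfl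
        map_smul' := fun r m => by
          change r • m = τ (τ.symm r) • m
          rw [RingEquiv.apply_symm_apply]
        left_inv := fun _ => rfl
        right_inv := fun _ => rfl }
    exact ⟨Module.Finite.of_surjective e.toLinearMap e.surjective, Module.Projective.of_equiv e⟩)

instance {S : Type u} [Ring S] (τ : S ≃+* R) : (twist τ).Additive where
  map_add {P Q f g} := by
    ext; rfl

/-- The perfect derived category `K^b(proj Λ)`, where `proj Λ` consists of the finitely
generated projective right `Λ`-modules. -/
abbrev Perf (Λ : Type u) [Ring Λ] := Kb (Proj Λᵐᵒᵖ)

variable (Λ) in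
lemma fgProj_regular : fgProj Λᵐᵒᵖ (ModuleCat.of Λᵐᵒᵖ Λ) := by
  let e : Λᵐᵒᵖ ≃ₗ[Λᵐᵒᵖ] Λ :=
    { toFun := unop
      invFun := op
      map_add' := fun _ _ => rfl
      map_smul' := fun _ _ => rfl
      left_inv := fun _ => rfl
      right_inv := fun _ => rfl }
  exact ⟨Module.Finite.equiv e, Module.Projective.of_equiv' e⟩

variable (Λ) in
/-- `Λ` as an object of its perfect derived category. -/
noncomputable def regular : Perf Λ :=
  stalk ⟨ModuleCat.of Λᵐᵒᵖ Λ, fgProj_regular Λ⟩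

/-- A primitive idempotent: a nonzero idempotent which is not the sum of two nonzero orthogonal
idempotents. -/
structure IsPrimitiveIdempotent (e : Λ) : Prop where
  idem : IsIdempotentElem e
  ne_zero : e ≠ 0
  primitive : ∀ f g : Λ, IsIdempotentElem f → IsIdempotentElem g → f * g = 0 → g * f = 0 →
    e = f + g → f = 0 ∨ g = 0

/-- For an idempotent `e`, the right module `eΛ` is finitely generated projective. -/
lemma fgProj_span {e : Λ} (he : IsIdempotentElem e) :
    fgProj Λᵐᵒᵖ (ModuleCat.of Λᵐᵒᵖ (Submodule.span Λᵐᵒᵖ {e})) := by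
  obtain ⟨_, _⟩ := fgProj_regular Λ
  let i := (Submodule.span Λᵐᵒᵖ {e}).subtype
  let s : Λ →ₗ[Λᵐᵒᵖ] Submodule.span Λᵐᵒᵖ {e} :=
    { toFun := fun x => ⟨e * x, Submodule.mem_span_singleton.2 ⟨op x, rfl⟩⟩
      map_add' := fun x y => Subtype.ext (mul_add e x y)
      map_smul' := fun r x => Subtype.ext (mul_assoc e x (unop r)).symm }
  have h : s ∘ₗ i = LinearMap.id := by
    refine LinearMap.ext fun x => Subtype.ext ?_
    obtain ⟨a, ha⟩ := Submodule.mem_span_singleton.1 x.2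
    change e * (x : Λ) = x
    rw [← ha, show a • e = e * unop a from rfl, ← mul_assoc, he.eq]
  exact ⟨Module.Finite.of_surjective s fun x => ⟨i x, LinearMap.congr_fun h x⟩,
    Module.Projective.of_split i s h⟩

/-- `eΛ` as an object of the perfect derived category of `Λ`. -/
noncomputable def idemProj {e : Λ} (he : IsIdempotentElem e) : Perf Λ :=
  stalk ⟨ModuleCat.of Λᵐᵒᵖ (Submodule.span Λᵐᵒᵖ {e}), fgProj_span he⟩

variable {K : Type v} [Field K] [Algebra K Λ]

/-- The functor `K^b(proj Λᵒᵖ) ⥤ K^b(proj Λ)` given by transport along an isomorphism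
`σ : Λᵒᵖ → Λ`: right `Λᵒᵖ`-modules are left `Λ`-modules, and such a module `N` becomes a right
`Λ`-module through `n · a = σ⁻¹(a) n`. -/
noncomputable def transport (σ : Λᵐᵒᵖ ≃ₐ[K] Λ) : Kb (Proj Λ) ⥤ Perf Λ :=
  mapKb (twist (AlgEquiv.opComm σ.symm).toRingEquiv)

/-- The contravariant functor `S_σ = [1] ∘ σ ∘ (-)^*`. -/
noncomputable def sFunctor (σ : Λᵐᵒᵖ ≃ₐ[K] Λ) : (Perf Λ)ᵒᵖ ⥤ Perf Λ :=
  mapKbOp (dual Λ) ⋙ transport σ ⋙ shiftFunctor (Perf Λ) (1 : ℤ)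

end Modules

end Silt

namespace Silt

open CategoryTheory Limits MulOpposite Opposite

universe v u

/-! ### Local objects and morphisms factoring through an object -/

section Preadditive

variable {C : Type*} [Category C] [Preadditive C]

/-! Write `A` for the regular module in degree zero. A morphism `X ⟶ P` is radical if no composite
`P ⟶ X ⟶ P` is invertible. Since `P` is local, radical maps form a subgroup, and for `X` in `add A`
the quotient Hom(X, P)/rad records the multiplicity of `P` in `X`. A silting `T` with A ≥ T ≥ A[1]
is the cone of some d : A₁ ⟶ A₀ with both terms in `add A` (`exists_presentation`). Everything is
read off from the map d* : Hom(A₀, P)/rad → Hom(A₁, P)/rad induced by precomposition with d.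

The left mutation lies above `T` exactly when every P ⟶ T factors through `add M`, and this is
injectivity of d* (`RadInj`). Likewise `T` lies above the right mutation exactly when every T ⟶ P[1]
factors through `add M[1]`, and this is surjectivity of d* (`RadSurj`). See `geq_isLeftMutation_iff`
and `geq_isRightMutation_iff`. In each case one implication is a Nakayama argument over the local
ring End(P): `mem_through_of_rad_injective` and `exists_sub_mem_through`.

The two parts cover: Hom(T, T[1]) = 0 makes every A₁ ⟶ A₀ of the form dw + td, which fails for a
suitable map if d* is neither injective nor surjective (`rad_injective_or_surjective`). The two
parts are disjoint: if d* were bijective, the functor Hom(-, P)/rad, applied to complexes, would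
send `T` to zero; the objects it kills form a thick subcategory, which would then be everything, but
`P` is not killed (`not_radSurj_of_radInj`).

The functor S is a contravariant autoequivalence compatible with triangles, with S(A) ≅ A[1] and,
because σ(e) = e, S(P) ≅ P[1]. It therefore reverses ≥, preserves basic silting objects, and
exchanges left mutation of `A` at `P` with right mutation of A[1] at P[1], so it carries each part
into the other. With the partition this gives the bijection and the cardinalities
(`partition_of_duality`). Mutations exist by Fitting's lemma and Krull–Schmidt
(`exists_isLeftMutation`), and S supplies the right ones. -/

/-- The morphisms `X ⟶ Y` which are sums of morphisms that factor through `M`. -/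
def through (M X Y : C) : AddSubgroup (X ⟶ Y) :=
  AddSubgroup.closure {f | ∃ (p : X ⟶ M) (q : M ⟶ Y), p ≫ q = f}

lemma comp_mem_through {M X Y : C} (p : X ⟶ M) (q : M ⟶ Y) : p ≫ q ∈ through M X Y :=
  AddSubgroup.subset_closure ⟨p, q, rfl⟩

lemma through_le {M X Y : C} {H : AddSubgroup (X ⟶ Y)}
    (h : ∀ (p : X ⟶ M) (q : M ⟶ Y), p ≫ q ∈ H) : through M X Y ≤ H :=
  (AddSubgroup.closure_le _).2 (by rintro _ ⟨p, q, rfl⟩; exact h p q)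

lemma through_precomp {M X Y W : C} (w : W ⟶ X) {f : X ⟶ Y} (hf : f ∈ through M X Y) :
    w ≫ f ∈ through M W Y := by
  have : through M X Y ≤ (through M W Y).comap (Preadditive.leftComp Y w) :=
    through_le fun p q => by
      change w ≫ p ≫ q ∈ through M W Y
      rw [← Category.assoc]
      exact comp_mem_through _ _
  exact this hf

lemma through_postcomp {M X Y Z : C} {f : X ⟶ Y} (hf : f ∈ through M X Y) (w : Y ⟶ Z) :
    f ≫ w ∈ through M X Z := by
  have : through M X Y ≤ (through M X Z).comap (Preadditive.rightComp X w) :=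
    through_le fun p q => by
      change (p ≫ q) ≫ w ∈ through M X Z
      rw [Category.assoc]
      exact comp_mem_through _ _
  exact this hf

lemma exists_sum_of_mem_through {M X Y : C} {f : X ⟶ Y} (hf : f ∈ through M X Y) :
    ∃ (n : ℕ) (p : Fin n → (X ⟶ M)) (q : Fin n → (M ⟶ Y)), f = ∑ j, p j ≫ q j := by
  induction hf using AddSubgroup.closure_induction with
  | mem f hf => obtain ⟨p, q, rfl⟩ := hf; exact ⟨1, fun _ => p, fun _ => q, by simp⟩
  | zero => exact ⟨0, Fin.elim0, Fin.elim0, by simp⟩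
  | add f g _ _ hf hg =>
    obtain ⟨n, p, q, rfl⟩ := hf
    obtain ⟨m, p', q', rfl⟩ := hg
    exact ⟨n + m, Fin.append p p', Fin.append q q', by simp [Fin.sum_univ_add]⟩
  | neg f _ hf =>
    obtain ⟨n, p, q, rfl⟩ := hf
    exact ⟨n, fun j => - p j, q, by simp⟩

lemma sum_mem_through {M X Y : C} {ι : Type*} [Fintype ι] (p : ι → (X ⟶ M))
    (q : ι → (M ⟶ Y)) : ∑ j, p j ≫ q j ∈ through M X Y :=
  AddSubgroup.sum_mem _ fun _ _ => comp_mem_through _ _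

/-- The hypothesis expresses membership of `N` in `add M` without biproducts (see `addOf_iff`), so
factorisations through `N` refine to sums of factorisations through `M`. -/
lemma through_trans {M N X Y : C} (h : 𝟙 N ∈ through M N N) : through N X Y ≤ through M X Y :=
  through_le fun p q => by
    have := through_precomp p (through_postcomp h q)
    rwa [Category.id_comp] at this

lemma through_sup {M N P X Y : C} (h : 𝟙 N ∈ through P N N ⊔ through M N N) :
    through N X Y ≤ through P X Y ⊔ through M X Y :=
  through_le fun p q => by
    obtain ⟨a, ha, b, hb, hab⟩ := AddSubgroup.mem_sup.1 h
    refine AddSubgroup.mem_sup.2 ⟨_, through_precomp p (through_postcomp ha q),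
      _, through_precomp p (through_postcomp hb q), ?_⟩
    rw [← Preadditive.comp_add, ← Preadditive.add_comp, hab, Category.id_comp]

lemma through_map {D : Type*} [Category D] [Preadditive D] (F : C ⥤ D) [F.Additive]
    {M X Y : C} {f : X ⟶ Y} (hf : f ∈ through M X Y) :
    F.map f ∈ through (F.obj M) (F.obj X) (F.obj Y) := by
  have : through M X Y ≤ (through (F.obj M) (F.obj X) (F.obj Y)).comap F.mapAddHom :=
    through_le fun p q => by
      change F.map (p ≫ q) ∈ through (F.obj M) (F.obj X) (F.obj Y)
      rw [F.map_comp]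
      exact comp_mem_through _ _
  exact this hf

lemma mem_through_of_map {D : Type*} [Category D] [Preadditive D] (F : C ⥤ D) [F.Additive]
    [F.Full] [F.Faithful] {M X Y : C} {f : X ⟶ Y}
    (hf : F.map f ∈ through (F.obj M) (F.obj X) (F.obj Y)) : f ∈ through M X Y := by
  have : through (F.obj M) (F.obj X) (F.obj Y) ≤ (through M X Y).map F.mapAddHom :=
    through_le fun p q => by
      obtain ⟨p, rfl⟩ := F.map_surjective p
      obtain ⟨q, rfl⟩ := F.map_surjective q
      exact ⟨p ≫ q, comp_mem_through _ _, F.map_comp _ _⟩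
  obtain ⟨g, hg, h⟩ := this hf
  rwa [← F.map_injective h]

lemma through_map_op {D : Type*} [Category D] [Preadditive D] (F : Cᵒᵖ ⥤ D) [F.Additive]
    {M X Y : C} {f : X ⟶ Y} (hf : f ∈ through M X Y) :
    F.map f.op ∈ through (F.obj (op M)) (F.obj (op Y)) (F.obj (op X)) := by
  obtain ⟨n, p, q, rfl⟩ := exists_sum_of_mem_through hf
  rw [show (∑ j, p j ≫ q j).op = ∑ j, (q j).op ≫ (p j).op from op_sum _ _ _ _, F.map_sum]
  simp only [F.map_comp]
  exact sum_mem_through _ _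

lemma retract_mem_through {M X : C} (r : Retract X M) : 𝟙 X ∈ through M X X := by
  rw [← r.retract]
  exact comp_mem_through _ _

lemma biprod_mem_through [HasBinaryBiproducts C] (P M : C) :
    𝟙 (P ⊞ M) ∈ through P (P ⊞ M) (P ⊞ M) ⊔ through M (P ⊞ M) (P ⊞ M) :=
  AddSubgroup.mem_sup.2 ⟨_, comp_mem_through biprod.fst biprod.inl, _,
    comp_mem_through biprod.snd biprod.inr, biprod.total⟩

/-- An object is local if it is nonzero and its non-isomorphisms are closed under addition. -/
def LocalObj (P : C) : Prop :=
  ¬ IsZero P ∧ ∀ f g : P ⟶ P, IsIso (f + g) → IsIso f ∨ IsIso g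

namespace LocalObj

variable {P : C} (hP : LocalObj P)
include hP

lemma not_isIso_zero : ¬ IsIso (0 : P ⟶ P) := fun h => hP.1 ((IsZero.iff_id_eq_zero _).2 (by
  rw [← IsIso.hom_inv_id (0 : P ⟶ P), zero_comp]))

/-- One of f and 1 - f is invertible, and an invertible idempotent is the identity. -/
lemma eq_id_of_idem {f : P ⟶ P} (hf : f ≫ f = f) : f = 0 ∨ f = 𝟙 P := by
  rcases hP.2 f (𝟙 P - f) (by rw [add_sub_cancel]; infer_instance) with h | h
  · right
    rw [← cancel_epi f, hf, Category.comp_id]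
  · left
    rw [← cancel_epi (𝟙 P - f), Preadditive.sub_comp, hf]; simp

/-- The endomorphism g(fg)⁻¹f of `X` is idempotent, hence 0 or 1. The value 0 would force `P` to
vanish; the value 1 exhibits a two-sided inverse of f. -/
lemma isIso_of_comp {X : C} (hX : LocalObj X) {f : P ⟶ X} {g : X ⟶ P} (h : IsIso (f ≫ g)) :
    IsIso f := by
  rcases hX.eq_id_of_idem (f := g ≫ inv (f ≫ g) ≫ f) (by
    simp only [Category.assoc]
    rw [← Category.assoc f, IsIso.hom_inv_id_assoc]) with h0 | h1
  · exfalso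
    apply hP.1
    rw [IsZero.iff_id_eq_zero]
    have : f ≫ (g ≫ inv (f ≫ g) ≫ f) ≫ g ≫ inv (f ≫ g) = 𝟙 P := by
      simp only [Category.assoc]
      rw [← Category.assoc f, IsIso.hom_inv_id_assoc, ← Category.assoc f, IsIso.hom_inv_id]
    rw [← this, h0]; simp
  · exact ⟨g ≫ inv (f ≫ g), by rw [← Category.assoc, IsIso.hom_inv_id], by simpa using h1⟩

omit hP in
lemma not_isIso_neg {f : P ⟶ P} (h : ¬ IsIso f) : ¬ IsIso (-f) := fun h' =>
  h ⟨-inv (-f), by rw [Preadditive.comp_neg, ← Preadditive.neg_comp, IsIso.hom_inv_id],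
    by rw [Preadditive.neg_comp, ← Preadditive.comp_neg, IsIso.inv_hom_id]⟩

lemma not_isIso_sum {ι : Type*} (s : Finset ι) (f : ι → (P ⟶ P)) (h : ∀ i ∈ s, ¬ IsIso (f i)) :
    ¬ IsIso (∑ i ∈ s, f i) := by
  classical
  induction s using Finset.induction_on with
  | empty => simpa using hP.not_isIso_zero
  | insert a s ha ih =>
    rw [Finset.sum_insert ha]
    intro h'
    rcases hP.2 _ _ h' with h' | h'
    · exact h a (Finset.mem_insert_self _ _) h'
    · exact ih (fun i hi => h i (Finset.mem_insert_of_mem hi)) h'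

/-- The non-isomorphisms of a local object. -/
def nonIso : AddSubgroup (P ⟶ P) where
  carrier := {f | ¬ IsIso f}
  zero_mem' := hP.not_isIso_zero
  add_mem' {f g} hf hg h := by
    rcases hP.2 f g h with h | h
    exacts [hf h, hg h]
  neg_mem' h := not_isIso_neg h

lemma comp_nonIso_right {f g : P ⟶ P} (h : ¬ IsIso g) : ¬ IsIso (f ≫ g) := fun h' => by
  have := hP.isIso_of_comp hP h'
  exact h (IsIso.of_isIso_comp_left f g)

/-- The radical morphisms to a local object. -/
def rad (X : C) : AddSubgroup (X ⟶ P) where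
  carrier := {f | ∀ g : P ⟶ X, ¬ IsIso (g ≫ f)}
  zero_mem' g := by rw [comp_zero]; exact hP.not_isIso_zero
  add_mem' {f f'} hf hf' g h := by
    rw [Preadditive.comp_add] at h
    exact hP.nonIso.add_mem (hf g) (hf' g) h
  neg_mem' {f} hf g h := by
    rw [Preadditive.comp_neg] at h
    exact not_isIso_neg (hf g) h

lemma mem_rad {X : C} {f : X ⟶ P} : f ∈ hP.rad X ↔ ∀ g : P ⟶ X, ¬ IsIso (g ≫ f) := Iff.rfl

lemma rad_precomp {X Y : C} {f : X ⟶ P} (hf : f ∈ hP.rad X) (w : Y ⟶ X) : w ≫ f ∈ hP.rad Y := by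
  intro g h
  rw [← Category.assoc] at h
  exact hf _ h

lemma id_notMem_rad : 𝟙 P ∉ hP.rad P := fun h => h (𝟙 P) (by rw [Category.comp_id]; infer_instance)

/-- Non-isomorphisms form a subgroup, so a single composite P ⟶ M ⟶ P has to be checked; if it were
invertible, `P` would be a summand of `M`. -/
lemma through_not_isIso {M : C} (hM : ¬ Nonempty (Retract P M)) {f : P ⟶ P}
    (hf : f ∈ through M P P) : ¬ IsIso f := by
  have : through M P P ≤ hP.nonIso := through_le fun p q (h : IsIso (p ≫ q)) =>
    hM ⟨⟨p, q ≫ inv (p ≫ q), by rw [← Category.assoc, IsIso.hom_inv_id]⟩⟩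
  exact this hf

lemma through_le_rad {M X : C} (hM : ¬ Nonempty (Retract P M)) :
    through M X P ≤ hP.rad X := fun _ hf g =>
  hP.through_not_isIso hM (through_precomp g hf)

/-- A local object which is a summand of a finite sum of copies of `M` is a summand of `M`. -/
lemma retract_of_mem_through {M : C} (h : 𝟙 P ∈ through M P P) : Nonempty (Retract P M) := by
  by_contra hM
  exact hP.through_not_isIso hM h inferInstance

omit hP in
lemma of_iso {P Q : C} (hP : LocalObj P) (e : P ≅ Q) : LocalObj Q := by
  refine ⟨fun h => hP.1 (h.of_iso e), fun f g h => ?_⟩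
  have := hP.2 (e.hom ≫ f ≫ e.inv) (e.hom ≫ g ≫ e.inv) (by
    rw [← Preadditive.comp_add, ← Preadditive.add_comp]; infer_instance)
  rcases this with h | h
  · left
    rw [show f = e.inv ≫ (e.hom ≫ f ≫ e.inv) ≫ e.hom by simp]; infer_instance
  · right
    rw [show g = e.inv ≫ (e.hom ≫ g ≫ e.inv) ≫ e.hom by simp]; infer_instance

lemma map {D : Type*} [Category D] [Preadditive D] (F : C ⥤ D) [F.Additive] [F.Full] [F.Faithful] :
    LocalObj (F.obj P) := by
  refine ⟨fun h => hP.1 ?_, fun f g h => ?_⟩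
  · rw [IsZero.iff_id_eq_zero] at h ⊢
    exact F.map_injective (by rw [F.map_id, h, F.map_zero])
  · obtain ⟨f, rfl⟩ := F.map_surjective f
    obtain ⟨g, rfl⟩ := F.map_surjective g
    rw [← F.map_add] at h
    have := isIso_of_fully_faithful F (f + g)
    rcases hP.2 f g this with h | h
    exacts [Or.inl inferInstance, Or.inr inferInstance]

lemma indecomposable [HasBinaryBiproducts C] : Indecomposable P := by
  refine ⟨hP.1, fun Y Z e => ?_⟩
  rcases hP.eq_id_of_idem (f := e.hom ≫ (biprod.fst ≫ biprod.inl) ≫ e.inv) (by simp) with h | h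
  · left
    rw [IsZero.iff_id_eq_zero]
    have := congrArg (fun f => biprod.inl ≫ e.inv ≫ f ≫ e.hom ≫ biprod.fst) h
    simpa using this
  · right
    rw [IsZero.iff_id_eq_zero]
    have := congrArg (fun f => biprod.inr ≫ e.inv ≫ f ≫ e.hom ≫ biprod.snd) h
    simpa using this.symm

end LocalObj

/-- If `𝟙 X` is in `through P ⊔ through M`, every morphism from `X` is, modulo morphisms factoring
through `M`, a combination of finitely many morphisms from `P`. -/
lemma exists_sum_of_mem_sup {P M X : C} (h : 𝟙 X ∈ through P X X ⊔ through M X X) :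
    ∃ (n : ℕ) (p : Fin n → (X ⟶ P)) (q : Fin n → (P ⟶ X)),
      𝟙 X - ∑ j, p j ≫ q j ∈ through M X X := by
  obtain ⟨a, ha, b, hb, hab⟩ := AddSubgroup.mem_sup.1 h
  obtain ⟨n, p, q, rfl⟩ := exists_sum_of_mem_through ha
  exact ⟨n, p, q, by rwa [← hab, add_sub_cancel_left]⟩

/-- If every radical cocycle detects radical morphisms, then every morphism from `P` to the
cokernel object `T` factors through `add M`. -/
lemma mem_through_of_rad_injective {P M A₁ A₀ T : C} (hP : LocalObj P)
    (hA : 𝟙 A₀ ∈ through P A₀ A₀ ⊔ through M A₀ A₀)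
    (d : A₁ ⟶ A₀) (π : A₀ ⟶ T) (hd : d ≫ π = 0)
    (lift : ∀ x : P ⟶ T, ∃ y : P ⟶ A₀, y ≫ π = x)
    (hinj : ∀ α : A₀ ⟶ P, d ≫ α ∈ hP.rad A₁ → α ∈ hP.rad A₀) (x : P ⟶ T) :
    x ∈ through M P T := by
  classical
  -- Regard Hom(P, T) modulo maps through `M` as a module over End(P), and take the least number of
  -- generators. It is finite because `A₀` lies in `add (P ⊞ M)` and maps P ⟶ T lift to `A₀`. The
  -- claim is that it is zero.
  let Gen (n : ℕ) : Prop := ∃ x : Fin n → (P ⟶ T), ∀ g : P ⟶ T, ∃ c : Fin n → (P ⟶ P),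
    g - ∑ k, c k ≫ x k ∈ through M P T
  obtain ⟨N, p, q, hpq⟩ := exists_sum_of_mem_sup hA
  have hGen : ∃ n, Gen n := by
    refine ⟨N, fun j => q j ≫ π, fun g => ?_⟩
    obtain ⟨y, rfl⟩ := lift g
    refine ⟨fun j => y ≫ p j, ?_⟩
    convert through_precomp y (through_postcomp hpq π) using 1
    simp [Preadditive.comp_sum, Preadditive.sum_comp]
  obtain ⟨x', hx'⟩ := Nat.find_spec hGen
  have hmin := fun m => Nat.find_min hGen (m := m)
  generalize Nat.find hGen = n at x' hx' hmin
  cases n with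
  | zero =>
    obtain ⟨c, hc⟩ := hx' x
    simpa using hc
  | succ m =>
    exfalso
    -- the coefficient of the first generator is well defined up to non-isomorphisms
    have key : ∀ c : Fin (m + 1) → (P ⟶ P), ∑ k, c k ≫ x' k ∈ through M P T → ¬ IsIso (c 0) := by
      intro c hc hiso
      refine hmin m (Nat.lt_succ_self m) ⟨fun k => x' k.succ, fun g => ?_⟩
      obtain ⟨c', hc'⟩ := hx' g
      refine ⟨fun k => c' k.succ - c' 0 ≫ inv (c 0) ≫ c k.succ, ?_⟩
      have := AddSubgroup.add_mem _ hc' (through_precomp (c' 0 ≫ inv (c 0)) hc)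
      convert this using 1
      simp only [Fin.sum_univ_succ, Preadditive.comp_add, Preadditive.comp_sum,
        Preadditive.sub_comp, Category.assoc, IsIso.inv_hom_id_assoc, Finset.sum_sub_distrib]
      abel
    choose c hc using fun j => hx' (q j ≫ π)
    have hcoef : ∀ y : P ⟶ A₀, y ≫ π - ∑ k, (∑ j, (y ≫ p j) ≫ c j k) ≫ x' k ∈ through M P T := by
      intro y
      have h1 := through_precomp y (through_postcomp hpq π)
      have h2 : ∑ j, (y ≫ p j) ≫ (q j ≫ π - ∑ k, c j k ≫ x' k) ∈ through M P T :=
        AddSubgroup.sum_mem _ fun j _ => through_precomp _ (hc j)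
      convert AddSubgroup.add_mem _ h1 h2 using 1
      simp only [Preadditive.comp_sub, Preadditive.sub_comp, Category.id_comp,
        Preadditive.comp_sum, Preadditive.sum_comp, Category.assoc, Finset.sum_sub_distrib]
      rw [Finset.sum_comm]
      abel
    -- By `key`, the coefficient at the first generator depends only on the class in the module, up
    -- to non-isomorphisms. Composition with `α` computes such a coefficient for the image of any y
    -- : P ⟶ A₀.
    let α : A₀ ⟶ P := ∑ j, p j ≫ c j 0
    have hα (y : P ⟶ A₀) : y ≫ α = ∑ j, (y ≫ p j) ≫ c j 0 := by
      simp [α, Preadditive.comp_sum]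
    have h1 : d ≫ α ∈ hP.rad A₁ := fun g => by
      rw [← Category.assoc, hα]
      apply key (fun k => ∑ j, ((g ≫ d) ≫ p j) ≫ c j k)
      have := AddSubgroup.neg_mem _ (hcoef (g ≫ d))
      rwa [Category.assoc, hd, comp_zero, zero_sub, neg_neg] at this
    obtain ⟨y, hy⟩ := lift (x' 0)
    have h2 := hinj α h1 y
    rw [hα] at h2
    -- With y a lift of the first generator, this relation has first coefficient 1 - yα. It is
    -- invertible because yα is not, against `key`.
    refine key (fun k => (if k = 0 then 𝟙 P else 0) - ∑ j, (y ≫ p j) ≫ c j k) ?_ ?_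
    · have h3 := hcoef y
      rw [hy] at h3
      convert h3 using 1
      simp [Preadditive.sub_comp, Finset.sum_sub_distrib, ite_comp]
    · rcases hP.2 (𝟙 P - ∑ j, (y ≫ p j) ≫ c j 0) (∑ j, (y ≫ p j) ≫ c j 0)
        (by rw [sub_add_cancel]; infer_instance) with h | h
      · simpa using h
      · exact absurd h h2

/-- If every morphism `A₁ ⟶ P` extends along `d` up to radical morphisms, then it extends up to
morphisms factoring through `add M`. -/
lemma exists_sub_mem_through {P M A₁ A₀ : C} (hP : LocalObj P)
    (hA : 𝟙 A₁ ∈ through P A₁ A₁ ⊔ through M A₁ A₁) (d : A₁ ⟶ A₀)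
    (hsurj : ∀ β : A₁ ⟶ P, ∃ γ : A₀ ⟶ P, β - d ≫ γ ∈ hP.rad A₁) (y : A₁ ⟶ P) :
    ∃ γ : A₀ ⟶ P, y - d ≫ γ ∈ through M A₁ P := by
  classical
  -- Nakayama for the quotient of Hom(A₁, P) by maps extending along d and maps through `M`, now
  -- with End(P) acting by postcomposition.
  let Gen (n : ℕ) : Prop := ∃ x : Fin n → (A₁ ⟶ P), ∀ g : A₁ ⟶ P, ∃ (c : Fin n → (P ⟶ P))
    (γ : A₀ ⟶ P), g - ∑ k, x k ≫ c k - d ≫ γ ∈ through M A₁ P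
  obtain ⟨N, p, q, hpq⟩ := exists_sum_of_mem_sup hA
  have hGen : ∃ n, Gen n := by
    refine ⟨N, p, fun g => ⟨fun j => q j ≫ g, 0, ?_⟩⟩
    convert through_postcomp hpq g using 1
    simp [Preadditive.sum_comp]
  obtain ⟨x, hx⟩ := Nat.find_spec hGen
  have hmin := fun m => Nat.find_min hGen (m := m)
  generalize Nat.find hGen = n at x hx hmin
  cases n with
  | zero =>
    obtain ⟨c, γ, hc⟩ := hx y
    exact ⟨γ, by simpa using hc⟩
  | succ m =>
    exfalso
    obtain ⟨γ, hγ⟩ := hsurj (x 0)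
    choose c δ hc using fun j => hx (p j)
    -- A radical representative of the first generator. Expanding it through the maps p j and then
    -- in the generators makes every summand of the coefficient `c' 0` a non-isomorphism.
    let ρ := x 0 - d ≫ γ
    let c' : Fin (m + 1) → (P ⟶ P) := fun k => ∑ j, c j k ≫ q j ≫ ρ
    have h1 : ρ - ∑ k, x k ≫ c' k - d ≫ (∑ j, δ j ≫ q j ≫ ρ) ∈ through M A₁ P := by
      have h2 := through_postcomp hpq ρ
      have h3 : ∑ j, (p j - ∑ k, x k ≫ c j k - d ≫ δ j) ≫ q j ≫ ρ ∈ through M A₁ P :=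
        AddSubgroup.sum_mem _ fun j _ => through_postcomp (hc j) _
      convert AddSubgroup.add_mem _ h2 h3 using 1
      simp only [c', Preadditive.sub_comp, Category.id_comp, Preadditive.comp_sum,
        Preadditive.sum_comp, Category.assoc, Finset.sum_sub_distrib]
      rw [Finset.sum_comm (f := fun k j => x k ≫ c j k ≫ q j ≫ ρ)]
      abel
    have h2 : ¬ IsIso (c' 0) := hP.not_isIso_sum _ _ fun j _ =>
      hP.comp_nonIso_right (hγ (q j))
    have h3 : IsIso (𝟙 P - c' 0) := by
      rcases hP.2 (𝟙 P - c' 0) (c' 0) (by rw [sub_add_cancel]; infer_instance) with h | h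
      exacts [h, absurd h h2]
    refine hmin m (Nat.lt_succ_self m) ⟨fun k => x k.succ, fun g => ?_⟩
    obtain ⟨b, ε, hb⟩ := hx g
    -- Since 1 - c'₀ is invertible, the relation `h1` expresses the first generator by the others; w
    -- is the multiple of that relation which cancels the coefficient b₀.
    let w := inv (𝟙 P - c' 0) ≫ b 0
    have hw : b 0 = w - c' 0 ≫ w := by
      have : (𝟙 P - c' 0) ≫ w = b 0 := by simp [w]
      rw [← this, Preadditive.sub_comp, Category.id_comp]
    refine ⟨fun k => b k.succ + c' k.succ ≫ w, ε + γ ≫ w + (∑ j, δ j ≫ q j ≫ ρ) ≫ w, ?_⟩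
    convert AddSubgroup.add_mem _ hb (through_postcomp h1 w) using 1
    simp only [ρ, Fin.sum_univ_succ, hw, Preadditive.comp_add, Preadditive.sub_comp,
      Preadditive.add_comp, Preadditive.comp_sub, Preadditive.sum_comp, Category.assoc,
      Finset.sum_add_distrib]
    abel

/-- Not both of the two conditions fail for a two-term complex with
`Hom(T, T[1]) = 0`. -/
lemma rad_injective_or_surjective {P A₁ A₀ : C} (hP : LocalObj P) (d : A₁ ⟶ A₀)
    (hd : ∀ f : A₁ ⟶ A₀, ∃ (w : A₀ ⟶ A₀) (t : A₁ ⟶ A₁), f = d ≫ w + t ≫ d) :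
    (∀ α : A₀ ⟶ P, d ≫ α ∈ hP.rad A₁ → α ∈ hP.rad A₀) ∨
      ∀ β : A₁ ⟶ P, ∃ γ : A₀ ⟶ P, β - d ≫ γ ∈ hP.rad A₁ := by
  by_contra! h
  obtain ⟨⟨α, h1, h2⟩, β, h3⟩ := h
  rw [hP.mem_rad] at h2
  push Not at h2
  obtain ⟨g, hg⟩ := h2
  -- This map f satisfies fα = β. Writing f = dw + td gives β = d(wα) + t(dα) with the last term
  -- radical, so β would lie in the image.
  obtain ⟨w, t, hwt⟩ := hd (β ≫ inv (g ≫ α) ≫ g)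
  apply h3 (w ≫ α)
  have : β = (β ≫ inv (g ≫ α) ≫ g) ≫ α := by simp
  rw [this, hwt, Preadditive.add_comp, Category.assoc, Category.assoc, add_sub_cancel_left]
  exact hP.rad_precomp h1 t

end Preadditive

end Silt

namespace Silt

open CategoryTheory Limits MulOpposite Opposite

universe v u

/-! ### Vanishing of morphism groups in triangulated categories -/

section Triangulated

open Pretriangulated

variable {C : Type*} [Category C] [HasZeroObject C] [Preadditive C] [HasShift C ℤ]
  [∀ n : ℤ, (shiftFunctor C n).Additive]

/-- All morphisms `X ⟶ Y[i]` vanish. -/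
def HomZero (X Y : C) (i : ℤ) : Prop := ∀ f : X ⟶ Y⟦i⟧, f = 0

omit [HasZeroObject C] [∀ n : ℤ, (shiftFunctor C n).Additive] in
lemma HomZero.eq_zero {X Y : C} {i : ℤ} (h : HomZero X Y i) (f : X ⟶ Y⟦i⟧) : f = 0 := h f

omit [HasZeroObject C] [∀ n : ℤ, (shiftFunctor C n).Additive] in
lemma homZero_shift_right {X Y : C} {i j k : ℤ} (h : j + i = k) :
    HomZero X (Y⟦j⟧) i ↔ HomZero X Y k := by
  let e := (shiftFunctorAdd' C j i k h).app Y
  constructor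
  · intro H f
    rw [← cancel_mono e.hom, zero_comp]; exact H _
  · intro H f
    rw [← cancel_mono e.inv, zero_comp]; exact H _

omit [HasZeroObject C] in
lemma homZero_shift_left {X Y : C} {i j k : ℤ} (h : i + j = k) :
    HomZero (X⟦j⟧) Y k ↔ HomZero X Y i := by
  let e := (shiftFunctorAdd' C i j k h).app Y
  constructor
  · intro H f
    apply (shiftFunctor C j).map_injective
    rw [Functor.map_zero, ← cancel_mono e.inv, zero_comp]; exact H _
  · intro H f
    obtain ⟨g, hg⟩ := (shiftFunctor C j).map_surjective (f ≫ e.hom)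
    rw [← cancel_mono e.hom, ← hg, H g, Functor.map_zero, zero_comp]

omit [HasZeroObject C] [∀ n : ℤ, (shiftFunctor C n).Additive] in
lemma HomZero.of_through_left {M X Y : C} {i : ℤ} (h : HomZero M Y i)
    (hX : 𝟙 X ∈ through M X X) : HomZero X Y i := by
  intro f
  have h1 := through_postcomp hX f
  rw [Category.id_comp] at h1
  have : through M X (Y⟦i⟧) ≤ ⊥ := through_le fun p q => by rw [h q, comp_zero]; exact zero_mem _
  exact AddSubgroup.mem_bot.1 (this h1)

omit [HasZeroObject C] in
lemma HomZero.of_through_right {M X Y : C} {i : ℤ} (h : HomZero X M i)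
    (hY : 𝟙 Y ∈ through M Y Y) : HomZero X Y i := by
  intro f
  have h1 := through_precomp f (through_map (shiftFunctor C i) hY)
  rw [CategoryTheory.Functor.map_id, Category.comp_id] at h1
  have : through (M⟦i⟧) X (Y⟦i⟧) ≤ ⊥ := through_le fun p q => by
    rw [h p, zero_comp]; exact zero_mem _
  exact AddSubgroup.mem_bot.1 (this h1)

variable [Pretriangulated C]

lemma HomZero.triangle_left {T : Triangle C} (hT : T ∈ distTriang C) {Y : C} {i : ℤ}
    (h₁ : HomZero T.obj₁ Y i) (h₃ : HomZero T.obj₃ Y i) : HomZero T.obj₂ Y i := by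
  intro f
  obtain ⟨g, rfl⟩ := T.yoneda_exact₂ hT f (h₁ _)
  rw [h₃ g, comp_zero]

lemma HomZero.triangle_right {T : Triangle C} (hT : T ∈ distTriang C) {Y : C} {i : ℤ}
    (h₁ : HomZero Y T.obj₁ i) (h₃ : HomZero Y T.obj₃ i) : HomZero Y T.obj₂ i := by
  intro f
  obtain ⟨g, hg⟩ := Triangle.coyoneda_exact₂ _ (Triangle.shift_distinguished T hT i) f (h₃ _)
  rw [hg]
  exact (congrArg (· ≫ _) (h₁ g)).trans zero_comp

lemma HomZero.triangle_right₃ {T : Triangle C} (hT : T ∈ distTriang C) {Y : C} {i : ℤ}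
    (h₂ : HomZero Y T.obj₂ i) (h₁ : HomZero Y T.obj₁ (i + 1)) : HomZero Y T.obj₃ i :=
  HomZero.triangle_right (rot_of_distTriang T hT) (h₁ := h₂)
    (h₃ := (homZero_shift_right (add_comm 1 i)).2 h₁)

lemma HomZero.triangle_right₁ {T : Triangle C} (hT : T ∈ distTriang C) {Y : C} {i : ℤ}
    (h₂ : HomZero Y T.obj₂ i) (h₃ : HomZero Y T.obj₃ (i - 1)) : HomZero Y T.obj₁ i :=
  HomZero.triangle_right (inv_rot_of_distTriang T hT)
    (h₁ := (homZero_shift_right (show -1 + i = i - 1 by omega)).2 h₃) (h₃ := h₂)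

lemma HomZero.triangle_left₃ {T : Triangle C} (hT : T ∈ distTriang C) {Y : C} {i : ℤ}
    (h₂ : HomZero T.obj₂ Y i) (h₁ : HomZero T.obj₁ Y (i - 1)) : HomZero T.obj₃ Y i :=
  HomZero.triangle_left (rot_of_distTriang T hT) (h₁ := h₂)
    (h₃ := (homZero_shift_left (show i - 1 + 1 = i by omega)).2 h₁)

lemma HomZero.triangle_left₁ {T : Triangle C} (hT : T ∈ distTriang C) {Y : C} {i : ℤ}
    (h₂ : HomZero T.obj₂ Y i) (h₃ : HomZero T.obj₃ Y (i + 1)) : HomZero T.obj₁ Y i :=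
  HomZero.triangle_left (inv_rot_of_distTriang T hT)
    (h₁ := (homZero_shift_left (show i + 1 + -1 = i by omega)).2 h₃) (h₃ := h₂)

/-- A retraction onto `X` from n copies of `M` is the same as an expression of the identity as a sum
of n composites through `M`. In this form membership in `add M` is preserved by any additive
functor, of either variance. -/
lemma addOf_iff {M X : C} : addOf M X ↔ 𝟙 X ∈ through M X X := by
  constructor
  · rintro ⟨n, ⟨r⟩⟩
    have h : 𝟙 (⨁ fun _ : Fin n => M) ∈ through M _ _ := by
      rw [← biproduct.total]
      exact sum_mem_through _ _
    have := through_precomp r.i (through_postcomp h r.r)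
    rwa [Category.id_comp, r.retract] at this
  · intro h
    obtain ⟨n, p, q, hpq⟩ := exists_sum_of_mem_through h
    refine ⟨n, ⟨⟨biproduct.lift p, biproduct.desc q, ?_⟩⟩⟩
    rw [biproduct.lift_desc, hpq]

lemma addOf_self (M : C) : addOf M M := addOf_iff.2 (by
  simpa using comp_mem_through (𝟙 M) (𝟙 M))

lemma addOf_le_iff {M N : C} : addOf M ≤ addOf N ↔ addOf N M := by
  refine ⟨fun h => h _ (addOf_self M), fun h X hX => ?_⟩
  rw [addOf_iff] at h hX ⊢
  exact through_trans h hX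

lemma addOf_eq_iff {M N : C} : addOf M = addOf N ↔ addOf N M ∧ addOf M N := by
  rw [le_antisymm_iff, addOf_le_iff, addOf_le_iff]

lemma addOf_map {D : Type*} [Category D] [HasZeroObject D] [Preadditive D] [HasShift D ℤ]
    [∀ n : ℤ, (shiftFunctor D n).Additive] [Pretriangulated D] (F : C ⥤ D) [F.Additive] {M N : C}
    (h : addOf M N) : addOf (F.obj M) (F.obj N) := by
  rw [addOf_iff] at h ⊢
  simpa using through_map F h

lemma addOf_map_op {D : Type*} [Category D] [HasZeroObject D] [Preadditive D] [HasShift D ℤ]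
    [∀ n : ℤ, (shiftFunctor D n).Additive] [Pretriangulated D] (F : Cᵒᵖ ⥤ D) [F.Additive] {M N : C}
    (h : addOf M N) : addOf (F.obj (op M)) (F.obj (op N)) := by
  rw [addOf_iff] at h ⊢
  simpa using through_map_op F h

lemma addOf_iff_of_full {D : Type*} [Category D] [HasZeroObject D] [Preadditive D] [HasShift D ℤ]
    [∀ n : ℤ, (shiftFunctor D n).Additive] [Pretriangulated D] (F : C ⥤ D) [F.Additive] [F.Full]
    [F.Faithful] {M N : C} : addOf (F.obj M) (F.obj N) ↔ addOf M N := by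
  refine ⟨fun h => ?_, addOf_map F⟩
  rw [addOf_iff] at h ⊢
  exact mem_through_of_map F (by rwa [F.map_id])

lemma Geq.of_addOf_left {M X Y : C} (h : Geq M Y) (hX : addOf M X) : Geq X Y := fun i hi =>
  HomZero.of_through_left (h i hi) (addOf_iff.1 hX)

lemma Geq.of_addOf_right {M X Y : C} (h : Geq X M) (hY : addOf M Y) : Geq X Y := fun i hi =>
  HomZero.of_through_right (h i hi) (addOf_iff.1 hY)

lemma addOf_of_iso {M X Y : C} (h : addOf M X) (e : X ≅ Y) : addOf M Y := by
  obtain ⟨n, ⟨r⟩⟩ := h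
  exact ⟨n, ⟨(Retract.ofIso e.symm).trans r⟩⟩

lemma addOf_trans {L M N : C} (h : addOf L M) (h' : addOf M N) : addOf L N :=
  addOf_le_iff.2 h _ h'

lemma addOf_biprod_left (X Y : C) : addOf (X ⊞ Y) X :=
  addOf_iff.2 (retract_mem_through ⟨biprod.inl, biprod.fst, by simp⟩)

lemma addOf_biprod_right (X Y : C) : addOf (X ⊞ Y) Y :=
  addOf_iff.2 (retract_mem_through ⟨biprod.inr, biprod.snd, by simp⟩)

lemma addOf_biprod {M X Y : C} (hX : addOf M X) (hY : addOf M Y) : addOf M (X ⊞ Y) := by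
  rw [addOf_iff] at *
  rw [← biprod.total]
  have h1 := through_precomp (biprod.fst : X ⊞ Y ⟶ X) (through_postcomp hX (biprod.inl : X ⟶ X ⊞ Y))
  have h2 := through_precomp (biprod.snd : X ⊞ Y ⟶ Y) (through_postcomp hY (biprod.inr : Y ⟶ X ⊞ Y))
  rw [Category.id_comp] at h1 h2
  exact add_mem h1 h2

/-! ### Two-term presentations -/

/-- The objects `Y` with such a bound, uniform in `X`, form a thick subcategory containing `A` with
bound 0, so all objects have one. -/
lemma exists_homZero_bound {A : C}
    (hA : (ObjectProperty.singleton A).IsClassicalTriangulatedGenerator) (Y : C) :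
    ∃ N : ℤ, ∀ X : C, Geq A X → ∀ i : ℤ, N < i → HomZero Y X i := by
  let Q : ObjectProperty C := fun Y =>
    ∃ N : ℤ, ∀ X : C, Geq A X → ∀ i : ℤ, N < i → HomZero Y X i
  have h1 : Q.IsStableUnderRetracts := ⟨by
    rintro X Y r ⟨N, h⟩
    exact ⟨N, fun Z hZ i hi => (h Z hZ i hi).of_through_left (retract_mem_through r)⟩⟩
  have h2 : Q.ContainsZero := ⟨_, isZero_zero C, 0, fun X _ i _ f => (isZero_zero C).eq_of_src _ _⟩
  have h3 : Q.IsStableUnderShift ℤ := ⟨fun n => ⟨by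
    rintro X ⟨N, h⟩
    exact ⟨N + n, fun Z hZ i hi => (homZero_shift_left (show i - n + n = i by omega)).2
      (h Z hZ _ (by omega))⟩⟩⟩
  have h4 : Q.IsTriangulatedClosed₂ := .mk' (by
    rintro T hT ⟨N, h⟩ ⟨N', h'⟩
    exact ⟨max N N', fun Z hZ i hi => (h Z hZ i (by omega)).triangle_left hT
      (h' Z hZ i (by omega))⟩)
  have h5 : Q.IsTriangulated := {}
  have h6 := (ObjectProperty.triangEnvelope_le_iff (P := ObjectProperty.singleton A) (Q := Q)).2 (by
    rw [ObjectProperty.singleton_le_iff]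
    exact ⟨0, fun X hX i hi => hX i hi⟩)
  rw [(ObjectProperty.isClassicalTriangulatedGenerator_iff _).1 hA] at h6
  exact h6 Y trivial

/-- If `A ≥ T` and `add A`-approximations exist, there is a triangle `T' ⟶ A₀ ⟶ T ⟶ T'[1]` with
`A₀` in `add A` and `A ≥ T'`. -/
lemma exists_approx_triangle {A T : C} (hA : Geq A A)
    (happ : ∃ (A₀ : C) (π : A₀ ⟶ T), addOf A A₀ ∧ ∀ x : A ⟶ T, ∃ y : A ⟶ A₀, y ≫ π = x)
    (hT : Geq A T) :
    ∃ (T' A₀ : C) (d : T' ⟶ A₀) (π : A₀ ⟶ T) (δ : T ⟶ T'⟦(1 : ℤ)⟧),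
      Triangle.mk d π δ ∈ distTriang C ∧ addOf A A₀ ∧ Geq A T' := by
  obtain ⟨A₀, π, h0, hπ⟩ := happ
  obtain ⟨T', d, δ, h⟩ := distinguished_cocone_triangle₁ π
  refine ⟨T', A₀, d, π, δ, h, h0, fun i hi => ?_⟩
  have h0' : Geq A A₀ := hA.of_addOf_right h0
  -- Degree one is where the approximation property enters: maps A ⟶ T'[1] come from maps A ⟶ T, and
  -- those lift to `A₀`. Higher degrees follow from the long exact sequence.
  by_cases hi1 : i = 1
  · subst hi1
    change HomZero A T' 1
    intro f
    obtain ⟨g, rfl⟩ := Triangle.coyoneda_exact₁ _ h f (h0' 1 one_pos _)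
    change A ⟶ T at g
    obtain ⟨y, rfl⟩ := hπ g
    have := comp_distTriang_mor_zero₂₃ _ h
    change π ≫ δ = 0 at this
    change (y ≫ π) ≫ δ = 0
    rw [Category.assoc, this, comp_zero]
  · exact HomZero.triangle_right₁ h (h0' i hi) (hT (i - 1) (by omega))

/-- An object `T` with `A ≥ T ≥ A[1]` has a two-term presentation by objects of `add A`. -/
lemma exists_presentation {A : C} (hA : Geq A A)
    (hgen : (ObjectProperty.singleton A).IsClassicalTriangulatedGenerator)
    (happ : ∀ T : C, ∃ (A₀ : C) (π : A₀ ⟶ T), addOf A A₀ ∧ ∀ x : A ⟶ T, ∃ y : A ⟶ A₀, y ≫ π = x)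
    {T : C} (hT : Geq A T) (hT' : Geq T (A⟦(1 : ℤ)⟧)) :
    ∃ (A₁ A₀ : C) (d : A₁ ⟶ A₀) (π : A₀ ⟶ T) (δ : T ⟶ A₁⟦(1 : ℤ)⟧),
      Triangle.mk d π δ ∈ distTriang C ∧ addOf A A₁ ∧ addOf A A₀ := by
  obtain ⟨A₁, A₀, d, π, δ, h, h0, h1⟩ := exists_approx_triangle hA (happ T) hT
  refine ⟨A₁, A₀, d, π, δ, h, ?_, h0⟩
  have h1A : Geq A₁ A := fun i hi => HomZero.triangle_left₁ h
    ((hA.of_addOf_left h0) i hi) ((homZero_shift_right (add_comm 1 i)).1 (hT' i hi))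
  -- Dimension shifting: an approximation triangle X' ⟶ B ⟶ X embeds Hom(A₁, X[i]) in Hom(A₁,
  -- X'[i+1]), with A ≥ X' again. After finitely many steps the degree exceeds the bound for `A₁`.
  have key : ∀ X : C, Geq A X → HomZero A₁ X 1 := by
    obtain ⟨N, hN⟩ := exists_homZero_bound hgen A₁
    have : ∀ (n : ℕ) (i : ℤ), 0 < i → N < i + n → ∀ X : C, Geq A X → HomZero A₁ X i := by
      intro n
      induction n with
      | zero => intro i hi hN' X hX; exact hN X hX i (by simpa using hN')
      | succ n ih =>
        intro i hi hN' X hX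
        obtain ⟨X', B, _, _, _, hX', hB, hAX'⟩ := exists_approx_triangle hA (happ X) hX
        exact HomZero.triangle_right₃ hX' ((h1A.of_addOf_right hB) i hi)
          (ih (i + 1) (by omega) (by push_cast at hN' ⊢; omega) X' hAX')
    exact fun X hX => this (N.toNat) 1 one_pos (by omega) X hX
  -- The obstruction to splitting the approximation B ⟶ A₁ lies in Hom(A₁, A₂[1]), which vanishes by
  -- `key`; so `A₁` is a summand of `B`.
  obtain ⟨A₂, B, _, p, q, hB, hBA, hA₂⟩ := exists_approx_triangle hA (happ A₁) h1
  obtain ⟨s, hs⟩ := Triangle.coyoneda_exact₃ _ hB (𝟙 A₁) (key A₂ hA₂ _)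
  exact addOf_trans hBA (addOf_iff.2 (retract_mem_through ⟨s, p, hs.symm⟩))

end Triangulated

end Silt

namespace Silt

open CategoryTheory Limits MulOpposite Opposite

universe v u

section Triangulated

open Pretriangulated

variable {C : Type*} [Category C] [HasZeroObject C] [Preadditive C] [HasShift C ℤ]
  [∀ n : ℤ, (shiftFunctor C n).Additive] [Pretriangulated C]

/-! ### Summands of basic objects -/

/-- In the triangle on a split monomorphism the connecting map vanishes, so Y ≅ X ⊞ Z for the cone
Z. No splitting of idempotents is needed. -/
lemma isIso_of_indecomposable {X Y : C} (hX : ¬ IsZero X) (hY : Indecomposable Y) (r : Retract X Y) :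
    IsIso r.i := by
  obtain ⟨Z, g, h, hT⟩ := distinguished_cocone_triangle r.i
  have h0 : h = 0 := by
    have h1 : h ≫ r.i⟦(1 : ℤ)⟧' = 0 := comp_distTriang_mor_zero₃₁ _ hT
    rw [← cancel_mono (r.i⟦(1 : ℤ)⟧'), h1, zero_comp]
  obtain ⟨e, -, -⟩ := exists_iso_binaryBiproduct_of_distTriang _ hT h0
  rcases hY.2 _ _ e with h | h
  · exact absurd h hX
  · exact (Triangle.isZero₃_iff_isIso₁ _ hT).1 h

/-- If `P` were also a summand of `M`, then `P ⊞ M` would contain two copies of `P` with the first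
inclusion orthogonal to the second projection. By locality each copy is detected on an
indecomposable summand isomorphic to `P`, and there is only one such index i. On that summand the
first inclusion and the second projection are both invertible, and the other summands contribute a
non-isomorphism, so their composite cannot vanish. -/
lemma not_retract_of_isBasic {B P M : C} (hB : IsBasic B) (hP : LocalObj P) (e : B ≅ P ⊞ M) :
    ¬ Nonempty (Retract P M) := by
  classical
  rintro ⟨r⟩
  obtain ⟨n, X, hX, hne, ⟨e'⟩⟩ := hB
  let E : P ⊞ M ≅ ⨁ X := e.symm ≪≫ e'
  let a (x : P ⟶ P ⊞ M) (i : Fin n) : P ⟶ X i := x ≫ E.hom ≫ biproduct.π X i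
  let b (y : P ⊞ M ⟶ P) (i : Fin n) : X i ⟶ P := biproduct.ι X i ≫ E.inv ≫ y
  have hab (x : P ⟶ P ⊞ M) (y : P ⊞ M ⟶ P) : x ≫ y = ∑ i, a x i ≫ b y i := by
    have : x ≫ y = x ≫ E.hom ≫ 𝟙 _ ≫ E.inv ≫ y := by simp
    rw [this, ← biproduct.total]
    simp only [a, b, Preadditive.comp_sum, Preadditive.sum_comp, Category.assoc]
  have hiso (x y i) (h : IsIso (a x i ≫ b y i)) : IsIso (a x i) := by
    exact isIso_of_indecomposable hP.1 (hX i) ⟨a x i, b y i ≫ inv (a x i ≫ b y i), by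
      rw [← Category.assoc, IsIso.hom_inv_id]⟩
  let x₁ : P ⟶ P ⊞ M := biprod.inl
  let x₂ : P ⟶ P ⊞ M := r.i ≫ biprod.inr
  let y₁ : P ⊞ M ⟶ P := biprod.fst
  let y₂ : P ⊞ M ⟶ P := biprod.snd ≫ r.r
  have h11 : x₁ ≫ y₁ = 𝟙 P := by simp [x₁, y₁]
  have h22 : x₂ ≫ y₂ = 𝟙 P := by simp [x₂, y₂]
  have h12 : x₁ ≫ y₂ = 0 := by simp [x₁, y₂]
  obtain ⟨i, hi⟩ : ∃ i, IsIso (a x₁ i ≫ b y₁ i) := by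
    by_contra! h
    refine hP.not_isIso_sum Finset.univ _ (fun i _ => h i) ?_
    rw [← hab, h11]; infer_instance
  have := hiso _ _ _ hi
  have hXi : LocalObj (X i) := hP.of_iso (asIso (a x₁ i))
  have hother (x y) (j) (hj : j ≠ i) : ¬ IsIso (a x j ≫ b y j) := fun h => by
    have := hiso _ _ _ h
    exact hj (hne j i ⟨(asIso (a x j)).symm ≪≫ asIso (a x₁ i)⟩)
  have hsum (x y) : x ≫ y = a x i ≫ b y i + ∑ j ∈ Finset.univ.erase i, a x j ≫ b y j := by
    rw [hab, Finset.add_sum_erase _ (fun j => a x j ≫ b y j) (Finset.mem_univ i)]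
  have hrest (x y) : ¬ IsIso (∑ j ∈ Finset.univ.erase i, a x j ≫ b y j) :=
    hP.not_isIso_sum _ _ fun j hj => hother x y j (Finset.ne_of_mem_erase hj)
  have h2 : IsIso (a x₂ i ≫ b y₂ i) := by
    rcases hP.2 _ _ (by rw [← hsum x₂ y₂, h22]; infer_instance) with h | h
    exacts [h, absurd h (hrest _ _)]
  have := hiso _ _ _ h2
  have h3 : IsIso (b y₂ i) := IsIso.of_isIso_comp_left (a x₂ i) _
  have h4 : IsIso (a x₁ i ≫ b y₂ i) := inferInstance
  have h5 := hsum x₁ y₂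
  rw [h12] at h5
  exact hrest x₁ y₂ (by
    rw [← neg_eq_of_add_eq_zero_right h5.symm]
    by_contra h6
    exact LocalObj.not_isIso_neg h6 (by rwa [neg_neg]))

/-! ### The two conditions on a two-term presentation -/

/-- `Λ ≃ P ⊕ M` up to multiplicities, with `P` local and not a summand of `M`. -/
structure SplitOff (A P M : C) : Prop where
  isLocal : LocalObj P
  not_retract : ¬ Nonempty (Retract P M)
  addOf_eq : addOf (P ⊞ M) = addOf A

variable {A P M : C}

lemma SplitOff.addOf_left (h : SplitOff A P M) : addOf A P :=
  addOf_trans (addOf_eq_iff.1 h.addOf_eq).1 (addOf_biprod_left _ _)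

lemma SplitOff.addOf_right (h : SplitOff A P M) : addOf A M :=
  addOf_trans (addOf_eq_iff.1 h.addOf_eq).1 (addOf_biprod_right _ _)

lemma SplitOff.mem_sup (h : SplitOff A P M) {X : C} (hX : addOf A X) :
    𝟙 X ∈ through P X X ⊔ through M X X := by
  have h1 := addOf_iff.1 (addOf_trans (addOf_eq_iff.1 h.addOf_eq).2 hX)
  exact through_sup (biprod_mem_through P M) h1

/-- Morphisms `A₀ ⟶ P` whose restriction to `A₁` is radical are radical. -/
def RadInj (hP : LocalObj P) {A₁ A₀ : C} (d : A₁ ⟶ A₀) : Prop :=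
  ∀ α : A₀ ⟶ P, d ≫ α ∈ hP.rad A₁ → α ∈ hP.rad A₀

/-- Morphisms `A₁ ⟶ P` extend to `A₀` up to radical morphisms. -/
def RadSurj (hP : LocalObj P) {A₁ A₀ : C} (d : A₁ ⟶ A₀) : Prop :=
  ∀ β : A₁ ⟶ P, ∃ γ : A₀ ⟶ P, β - d ≫ γ ∈ hP.rad A₁

section

variable {A₁ A₀ T : C} {d : A₁ ⟶ A₀} {π : A₀ ⟶ T} {δ : T ⟶ A₁⟦(1 : ℤ)⟧}
  (hT : Triangle.mk d π δ ∈ distTriang C) (hA : Geq A A) (h₁ : addOf A A₁) (h₀ : addOf A A₀)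

include hT hA h₁ in
lemma exists_lift_of_addOf {X : C} (hX : addOf A X) (x : X ⟶ T) : ∃ y : X ⟶ A₀, y ≫ π = x := by
  obtain ⟨y, hy⟩ := Triangle.coyoneda_exact₃ _ hT x
    (((hA.of_addOf_left hX).of_addOf_right h₁) 1 one_pos (x ≫ δ))
  exact ⟨y, hy.symm⟩

include hT hA h₁ h₀ in
-- Forward: g : P ⟶ A₀ agrees, modulo maps through `add M`, with a map factoring through d. So if dα
-- is radical then gα is a sum of two non-isomorphisms. The converse is the Nakayama argument above.
lemma forall_mem_through_iff_radInj (h : SplitOff A P M) :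
    (∀ x : P ⟶ T, x ∈ through M P T) ↔ RadInj h.isLocal d := by
  constructor
  · intro hx α hα
    rw [LocalObj.mem_rad]
    intro g
    obtain ⟨n, p, q, hpq⟩ := exists_sum_of_mem_through (hx (g ≫ π))
    choose q' hq' using fun j => exists_lift_of_addOf hT hA h₁ h.addOf_right (q j)
    obtain ⟨s, hs⟩ := Triangle.coyoneda_exact₂ _ hT (g - ∑ j, p j ≫ q' j) (by
      change (g - ∑ j, p j ≫ q' j) ≫ π = 0
      simp [Preadditive.sub_comp, Preadditive.sum_comp, hq', hpq])
    change P ⟶ A₁ at s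
    change g - ∑ j, p j ≫ q' j = s ≫ d at hs
    have h2 : g ≫ α = s ≫ d ≫ α + (∑ j, p j ≫ q' j) ≫ α := by
      rw [← Category.assoc, ← hs, ← Preadditive.add_comp, sub_add_cancel]
    rw [h2]
    intro h3
    rcases h.isLocal.2 _ _ h3 with h3 | h3
    · exact hα s h3
    · exact h.isLocal.through_not_isIso h.not_retract
        (through_postcomp (sum_mem_through p q') α) h3
  · intro hd x
    exact mem_through_of_rad_injective h.isLocal (h.mem_sup h₀) d π
      (comp_distTriang_mor_zero₁₂ _ hT)
      (fun x => exists_lift_of_addOf hT hA h₁ h.addOf_left x) hd x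

include hT hA h₁ h₀ in
-- Maps T ⟶ X[1] with `X` in `add A` are maps A₁ ⟶ X modulo those extending along d (`hfac`,
-- `hker`). This turns the statement on T ⟶ P[1] into one on A₁ ⟶ P.
lemma forall_mem_through_iff_radSurj (h : SplitOff A P M) :
    (∀ y : T ⟶ P⟦(1 : ℤ)⟧, y ∈ through (M⟦(1 : ℤ)⟧) T (P⟦(1 : ℤ)⟧)) ↔
      RadSurj h.isLocal d := by
  have hfac {X : C} (hX : addOf A X) (y : T ⟶ X⟦(1 : ℤ)⟧) :
      ∃ z : A₁ ⟶ X, δ ≫ z⟦(1 : ℤ)⟧' = y := by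
    obtain ⟨z, hz⟩ := Triangle.yoneda_exact₃ _ hT y
      (((hA.of_addOf_left h₀).of_addOf_right hX) 1 one_pos (π ≫ y))
    obtain ⟨z, rfl⟩ := (shiftFunctor C (1 : ℤ)).map_surjective z
    exact ⟨z, hz.symm⟩
  have hker {X : C} (z : A₁ ⟶ X) (hz : δ ≫ z⟦(1 : ℤ)⟧' = 0) : ∃ γ : A₀ ⟶ X, z = d ≫ γ := by
    obtain ⟨γ, hγ⟩ := Triangle.yoneda_exact₃ _ (rot_of_distTriang _ hT) (z⟦(1 : ℤ)⟧') hz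
    change A₀⟦(1 : ℤ)⟧ ⟶ X⟦(1 : ℤ)⟧ at γ
    change z⟦(1 : ℤ)⟧' = (-d⟦(1 : ℤ)⟧') ≫ γ at hγ
    obtain ⟨γ, rfl⟩ := (shiftFunctor C (1 : ℤ)).map_surjective γ
    refine ⟨-γ, (shiftFunctor C (1 : ℤ)).map_injective ?_⟩
    rw [hγ, Preadditive.neg_comp, Preadditive.comp_neg, Functor.map_neg, Functor.map_comp]
  constructor
  · intro hy β
    obtain ⟨n, p, q, hpq⟩ := exists_sum_of_mem_through (hy (δ ≫ β⟦(1 : ℤ)⟧'))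
    choose p' hp' using fun j => hfac h.addOf_right (p j)
    choose q' hq' using fun j => (shiftFunctor C (1 : ℤ)).map_surjective (q j)
    obtain ⟨γ, hγ⟩ := hker (β - ∑ j, p' j ≫ q' j) (by
      rw [Functor.map_sub, Functor.map_sum, Preadditive.comp_sub, Preadditive.comp_sum, hpq,
        sub_eq_zero]
      refine Finset.sum_congr rfl fun j _ => ?_
      rw [Functor.map_comp, hq', ← Category.assoc, hp'])
    refine ⟨γ, ?_⟩
    rw [← hγ, sub_sub_cancel]
    exact h.isLocal.through_le_rad h.not_retract (sum_mem_through p' q')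
  · intro hd y
    obtain ⟨z, rfl⟩ := hfac h.addOf_left y
    obtain ⟨γ, hγ⟩ := exists_sub_mem_through h.isLocal (h.mem_sup h₁) d hd z
    have h2 := through_precomp δ (through_map (shiftFunctor C (1 : ℤ)) hγ)
    have h3 : δ ≫ d⟦(1 : ℤ)⟧' = 0 := comp_distTriang_mor_zero₃₁ _ hT
    rwa [Functor.map_sub, Preadditive.comp_sub, Functor.map_comp, ← Category.assoc, h3, zero_comp,
      sub_zero] at h2

include hT hA h₁ h₀ in
-- For f : A₁ ⟶ A₀, the composite T ⟶ A₁[1] ⟶ T[1] built from δ and fπ is zero by rigidity. Hence fπ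
-- extends along d to A₀ ⟶ T and then lifts to an endomorphism of `A₀`; the remaining difference is
-- killed by π and so factors through d. This is the decomposition f = dw + td.
lemma radInj_or_radSurj (hP : LocalObj P) (hTT : Geq T T) : RadInj hP d ∨ RadSurj hP d := by
  refine rad_injective_or_surjective hP d fun f => ?_
  obtain ⟨γ, hγ⟩ := Triangle.yoneda_exact₃ _ (rot_of_distTriang _ hT) ((f ≫ π)⟦(1 : ℤ)⟧')
    (hTT 1 one_pos _)
  change A₀⟦(1 : ℤ)⟧ ⟶ T⟦(1 : ℤ)⟧ at γ
  change (f ≫ π)⟦(1 : ℤ)⟧' = (-d⟦(1 : ℤ)⟧') ≫ γ at hγ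
  obtain ⟨γ, rfl⟩ := (shiftFunctor C (1 : ℤ)).map_surjective γ
  obtain ⟨w, rfl⟩ := exists_lift_of_addOf hT hA h₁ h₀ γ
  have h2 : (f + d ≫ w) ≫ π = 0 := by
    apply (shiftFunctor C (1 : ℤ)).map_injective
    rw [Preadditive.add_comp, Functor.map_add, hγ]
    simp
  obtain ⟨t, ht⟩ := Triangle.coyoneda_exact₂ _ hT (f + d ≫ w) h2
  change A₁ ⟶ A₁ at t
  change f + d ≫ w = t ≫ d at ht
  exact ⟨-w, t, by rw [← ht, Preadditive.comp_neg]; abel⟩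

end

/-! ### Mutations -/

/-- Above degree one, Hom(Y, T[i]) lies between the vanishing groups Hom(P, T[i-1]) and Hom(M',
T[i]). In degree one it is the cokernel of Hom(M', T) ⟶ Hom(P, T), whose image consists of the maps
factoring through `add M`. -/
lemma geq_left_mutation_iff {T M' Y : C} {f : P ⟶ M'} {g : M' ⟶ Y} {h : Y ⟶ P⟦(1 : ℤ)⟧}
    (hf : IsMinLeftApprox M f) (hT : Triangle.mk f g h ∈ distTriang C) (hPT : Geq P T)
    (hMT : Geq M T) : Geq Y T ↔ ∀ x : P ⟶ T, x ∈ through M P T := by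
  have hM' : Geq M' T := hMT.of_addOf_left hf.mem
  have hx : (∀ x : P ⟶ T, x ∈ through M P T) ↔ ∀ x : P ⟶ T, ∃ z : M' ⟶ T, x = f ≫ z := by
    constructor
    · intro H x
      have : through M P T ≤ (Preadditive.leftComp T f).range := through_le fun p q => by
        obtain ⟨h, rfl⟩ := hf.factors M (addOf_self M) p
        exact ⟨h ≫ q, (Category.assoc _ _ _).symm⟩
      obtain ⟨z, hz⟩ := this (H x)
      exact ⟨z, hz.symm⟩
    · intro H x
      obtain ⟨z, rfl⟩ := H x
      have := through_precomp f (through_postcomp (addOf_iff.1 hf.mem) z)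
      rwa [Category.id_comp] at this
  rw [hx]
  constructor
  · intro hY x
    have h1 := hY 1 one_pos (h ≫ x⟦(1 : ℤ)⟧')
    obtain ⟨z, hz⟩ := Triangle.yoneda_exact₃ _ (rot_of_distTriang _ hT) (x⟦(1 : ℤ)⟧') h1
    change M'⟦(1 : ℤ)⟧ ⟶ T⟦(1 : ℤ)⟧ at z
    change x⟦(1 : ℤ)⟧' = (-f⟦(1 : ℤ)⟧') ≫ z at hz
    obtain ⟨z, rfl⟩ := (shiftFunctor C (1 : ℤ)).map_surjective z
    exact ⟨-z, (shiftFunctor C (1 : ℤ)).map_injective (by rw [hz]; simp)⟩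
  · intro H i hi
    by_cases hi1 : i = 1
    · subst hi1
      intro y
      obtain ⟨x, hx⟩ := Triangle.yoneda_exact₃ _ hT y (hM' 1 one_pos _)
      change P⟦(1 : ℤ)⟧ ⟶ T⟦(1 : ℤ)⟧ at x
      obtain ⟨x, rfl⟩ := (shiftFunctor C (1 : ℤ)).map_surjective x
      obtain ⟨z, rfl⟩ := H x
      have h3 : h ≫ f⟦(1 : ℤ)⟧' = 0 := comp_distTriang_mor_zero₃₁ _ hT
      rw [hx]
      change h ≫ (f ≫ z)⟦(1 : ℤ)⟧' = 0
      rw [Functor.map_comp, ← Category.assoc, h3, zero_comp]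
    · exact HomZero.triangle_left₃ hT (hM' i hi) (hPT (i - 1) (by omega))

lemma geq_right_mutation_iff {T M' Q Z : C} {g : Z ⟶ M'} {f : M' ⟶ Q} {h : Q ⟶ Z⟦(1 : ℤ)⟧}
    (hf : IsMinRightApprox M f) (hT : Triangle.mk g f h ∈ distTriang C) (hTQ : Geq T Q)
    (hTM : Geq T M) : Geq T Z ↔ ∀ x : T ⟶ Q, x ∈ through M T Q := by
  have hM' : Geq T M' := hTM.of_addOf_right hf.mem
  have hx : (∀ x : T ⟶ Q, x ∈ through M T Q) ↔ ∀ x : T ⟶ Q, ∃ z : T ⟶ M', x = z ≫ f := by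
    constructor
    · intro H x
      have : through M T Q ≤ (Preadditive.rightComp T f).range := through_le fun p q => by
        obtain ⟨h, rfl⟩ := hf.factors M (addOf_self M) q
        exact ⟨p ≫ h, Category.assoc _ _ _⟩
      obtain ⟨z, hz⟩ := this (H x)
      exact ⟨z, hz.symm⟩
    · intro H x
      obtain ⟨z, rfl⟩ := H x
      have := through_precomp z (through_postcomp (addOf_iff.1 hf.mem) f)
      rwa [Category.id_comp] at this
  rw [hx]
  constructor
  · intro hZ x
    obtain ⟨z, hz⟩ := Triangle.coyoneda_exact₃ _ hT x (hZ 1 one_pos _)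
    exact ⟨z, hz⟩
  · intro H i hi
    by_cases hi1 : i = 1
    · subst hi1
      intro y
      obtain ⟨x, hx⟩ := Triangle.coyoneda_exact₁ _ hT y (hM' 1 one_pos _)
      change T ⟶ Q at x
      obtain ⟨z, rfl⟩ := H x
      have h3 : f ≫ h = 0 := comp_distTriang_mor_zero₂₃ _ hT
      rw [hx]
      change (z ≫ f) ≫ h = 0
      rw [Category.assoc, h3, comp_zero]
    · exact HomZero.triangle_right₁ hT (hM' i hi) (hTQ (i - 1) (by omega))

lemma geq_biprod_left_iff {X Y T : C} : Geq (X ⊞ Y) T ↔ Geq X T ∧ Geq Y T := by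
  refine ⟨fun h => ⟨h.of_addOf_left (addOf_biprod_left _ _),
    h.of_addOf_left (addOf_biprod_right _ _)⟩, fun h i hi f => ?_⟩
  apply biprod.hom_ext'
  · rw [comp_zero]; exact h.1 i hi _
  · rw [comp_zero]; exact h.2 i hi _

lemma geq_biprod_right_iff {X Y T : C} : Geq T (X ⊞ Y) ↔ Geq T X ∧ Geq T Y := by
  refine ⟨fun h => ⟨h.of_addOf_right (addOf_biprod_left _ _),
    h.of_addOf_right (addOf_biprod_right _ _)⟩, fun h i hi => ?_⟩
  have := HomZero.triangle_right (binaryBiproductTriangle_distinguished X Y) (Y := T)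
    (h.1 i hi) (h.2 i hi)
  exact this

omit [HasZeroObject C] [∀ n : ℤ, (shiftFunctor C n).Additive] [Pretriangulated C] in
lemma Geq.iso_left_iff {X Y T : C} (e : X ≅ Y) : Geq X T ↔ Geq Y T :=
  ⟨Geq.of_iso e (Iso.refl _), Geq.of_iso e.symm (Iso.refl _)⟩

omit [HasZeroObject C] [∀ n : ℤ, (shiftFunctor C n).Additive] [Pretriangulated C] in
lemma Geq.iso_right_iff {X Y T : C} (e : X ≅ Y) : Geq T X ↔ Geq T Y :=
  ⟨Geq.of_iso (Iso.refl _) e, Geq.of_iso (Iso.refl _) e.symm⟩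

lemma SplitOff.of_isBasicVersion {B : C} (hB : IsBasicVersion B A) (hP : LocalObj P)
    (e : B ≅ P ⊞ M) : SplitOff A P M where
  isLocal := hP
  not_retract := not_retract_of_isBasic hB.1 hP e
  addOf_eq := by
    rw [← hB.2, addOf_eq_iff]
    exact ⟨addOf_of_iso (addOf_self B) e, addOf_of_iso (addOf_self _) e.symm⟩

/-- The right mutation takes place in A[1], whereas the presentation of `T` uses `A`; this brings
the complement back down by one shift. -/
lemma SplitOff.of_shift {M' : C} (h : SplitOff (A⟦(1 : ℤ)⟧) (P⟦(1 : ℤ)⟧) M') (hP : LocalObj P)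
    (e : M⟦(1 : ℤ)⟧ ≅ M') : SplitOff A P M where
  isLocal := hP
  not_retract := fun ⟨r⟩ => h.not_retract
    ⟨(r.map (shiftFunctor C (1 : ℤ))).trans (Retract.ofIso e)⟩
  addOf_eq := by
    rw [addOf_eq_iff]
    refine ⟨addOf_biprod ?_ ?_, ?_⟩
    · exact (addOf_iff_of_full (shiftFunctor C (1 : ℤ))).1 h.addOf_left
    · exact (addOf_iff_of_full (shiftFunctor C (1 : ℤ))).1 (addOf_of_iso h.addOf_right e.symm)
    · rw [← addOf_iff_of_full (shiftFunctor C (1 : ℤ))]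
      refine addOf_trans (addOf_biprod ?_ ?_) (addOf_eq_iff.1 h.addOf_eq).2
      · exact addOf_map _ (addOf_biprod_left _ _)
      · exact addOf_of_iso (addOf_map _ (addOf_biprod_right _ _)) e

section

variable {A₁ A₀ T : C} {d : A₁ ⟶ A₀} {π : A₀ ⟶ T} {δ : T ⟶ A₁⟦(1 : ℤ)⟧}
  (hT : Triangle.mk d π δ ∈ distTriang C) (hA : Geq A A) (h₁ : addOf A A₁) (h₀ : addOf A A₀)
  (hP : LocalObj P) (hAT : cls T ∈ twoSilt A)

include hT hA h₁ h₀ hP hAT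

lemma geq_isLeftMutation_iff {B U : C} (hB : IsBasicVersion B A) (hU : IsLeftMutation B P U) :
    Geq U T ↔ RadInj hP d := by
  obtain ⟨M, M', Y, f, g, h, ⟨e⟩, hf, htri, ⟨e'⟩⟩ := hU
  have hs := SplitOff.of_isBasicVersion hB hP e
  have h2 : Geq A T := hAT.2.1
  have hM := h2.of_addOf_left hs.addOf_right
  rw [← forall_mem_through_iff_radInj hT hA h₁ h₀ hs,
    ← geq_left_mutation_iff hf htri (h2.of_addOf_left hs.addOf_left) hM,
    Geq.iso_left_iff e', geq_biprod_left_iff, and_iff_left hM]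

lemma geq_isRightMutation_iff {B U : C} (hB : IsBasicVersion B (A⟦(1 : ℤ)⟧))
    (hU : IsRightMutation B (P⟦(1 : ℤ)⟧) U) :
    Geq T U ↔ RadSurj hP d := by
  obtain ⟨M, M', Y, f, g, h, ⟨e⟩, hf, htri, ⟨e'⟩⟩ := hU
  have hs := SplitOff.of_isBasicVersion hB (hP.map (shiftFunctor C (1 : ℤ))) e
  obtain ⟨M₀, ⟨e₀⟩⟩ : ∃ M₀ : C, Nonempty (M₀⟦(1 : ℤ)⟧ ≅ M) :=
    ⟨_, ⟨(shiftFunctor C (1 : ℤ)).objObjPreimageIso M⟩⟩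
  have hs₀ := hs.of_shift hP e₀
  have h2 : Geq T (A⟦(1 : ℤ)⟧) := hAT.2.2
  have hM := h2.of_addOf_right hs.addOf_right
  have h3 (X Y : C) : through (M₀⟦(1 : ℤ)⟧) X Y = through M X Y := le_antisymm
    (through_trans (addOf_iff.1 (addOf_of_iso (addOf_self M) e₀.symm)))
    (through_trans (addOf_iff.1 (addOf_of_iso (addOf_self _) e₀)))
  rw [← forall_mem_through_iff_radSurj hT hA h₁ h₀ hs₀, h3,
    ← geq_right_mutation_iff hf htri (h2.of_addOf_right hs.addOf_left) hM,
    Geq.iso_right_iff e', geq_biprod_right_iff, and_iff_left hM]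

/-- The condition on d does not involve the basic version or the mutation, so the existential choice
in `minusPart` is harmless once one choice exists. -/
lemma mem_minusPart_iff
    (hex : ∃ B U : C, IsBasicVersion B A ∧ IsLeftMutation B P U) :
    cls T ∈ minusPart A P ↔ RadInj hP d := by
  constructor
  · rintro ⟨-, B, U, hB, hU, h, -⟩
    exact (geq_isLeftMutation_iff hT hA h₁ h₀ hP hAT hB hU).1 h
  · intro hd
    obtain ⟨B, U, hB, hU⟩ := hex
    exact ⟨hAT, B, U, hB, hU, (geq_isLeftMutation_iff hT hA h₁ h₀ hP hAT hB hU).2 hd, hAT.2.2⟩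

lemma mem_plusPart_iff
    (hex : ∃ B U : C, IsBasicVersion B (A⟦(1 : ℤ)⟧) ∧ IsRightMutation B (P⟦(1 : ℤ)⟧) U) :
    cls T ∈ plusPart A P ↔ RadSurj hP d := by
  constructor
  · rintro ⟨-, B, U, hB, hU, -, h⟩
    exact (geq_isRightMutation_iff hT hA h₁ h₀ hP hAT hB hU).1 h
  · intro hd
    obtain ⟨B, U, hB, hU⟩ := hex
    exact ⟨hAT, B, U, hB, hU, hAT.2.1, (geq_isRightMutation_iff hT hA h₁ h₀ hP hAT hB hU).2 hd⟩

end

end Triangulated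

end Silt

namespace Silt

open CategoryTheory Limits MulOpposite Opposite

universe v u

/-! ### Additive contravariant functors: biproducts and indecomposables -/

section Preadditive

variable {C : Type*} [Category C] [Preadditive C]

lemma iso_biproduct_of_total {n : ℕ} {T : C} {X : Fin n → C} [HasFiniteBiproducts C]
    (p : ∀ i, X i ⟶ T) (q : ∀ i, T ⟶ X i)
    (h : ∀ i, p i ≫ q i = 𝟙 _) (h' : ∀ i j, i ≠ j → p i ≫ q j = 0) (ht : ∑ i, q i ≫ p i = 𝟙 T) :
    Nonempty (T ≅ ⨁ X) := by
  classical
  refine ⟨⟨biproduct.lift q, biproduct.desc p, by rw [biproduct.lift_desc, ht], ?_⟩⟩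
  ext i j
  by_cases hij : i = j
  · subst hij; simp [h]
  · simp [h' j i (Ne.symm hij), biproduct.ι_π_ne _ (Ne.symm hij)]

variable (S : Cᵒᵖ ⥤ C)

lemma nonempty_obj_biproduct_iso [S.Additive] [HasFiniteBiproducts C] {n : ℕ} (X : Fin n → C) :
    Nonempty (S.obj (op (⨁ X)) ≅ ⨁ fun i => S.obj (op (X i))) := by
  classical
  refine iso_biproduct_of_total (fun i => S.map (biproduct.π X i).op)
    (fun i => S.map (biproduct.ι X i).op) (fun i => ?_) (fun i j hij => ?_) ?_
  · rw [← S.map_comp, ← op_comp, biproduct.ι_π_self, op_id, S.map_id]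
  · rw [← S.map_comp, ← op_comp, biproduct.ι_π_ne _ hij.symm, Limits.op_zero, S.map_zero]
  · simp only [← S.map_comp, ← op_comp]
    rw [← S.map_sum, ← op_sum, biproduct.total, op_id, S.map_id]

lemma nonempty_obj_biprod_iso [S.Additive] [HasBinaryBiproducts C] (X Y : C) :
    Nonempty (S.obj (op (X ⊞ Y)) ≅ S.obj (op X) ⊞ S.obj (op Y)) := by
  refine ⟨⟨biprod.lift (S.map biprod.inl.op) (S.map biprod.inr.op),
    biprod.desc (S.map biprod.fst.op) (S.map biprod.snd.op), ?_, ?_⟩⟩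
  · rw [biprod.lift_desc]
    simp only [← S.map_comp, ← op_comp]
    rw [← S.map_add, ← op_add, biprod.total, op_id, S.map_id]
  · ext <;> simp [← S.map_comp, ← op_comp, S.map_zero]

omit [Preadditive C] in
lemma exists_obj_op_iso [S.EssSurj] (Y : C) : ∃ X : C, Nonempty (S.obj (op X) ≅ Y) :=
  ⟨(S.objPreimage Y).unop, ⟨S.objObjPreimageIso Y⟩⟩

variable [S.Full] [S.Faithful] [S.Additive]

omit [Preadditive C] [S.Additive] in
lemma nonempty_iso_of_obj {X Y : C} (e : S.obj (op X) ≅ S.obj (op Y)) : Nonempty (X ≅ Y) :=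
  ⟨(S.preimageIso e).unop.symm⟩

omit [S.Full] in
lemma isZero_obj_op_iff {X : C} : IsZero (S.obj (op X)) ↔ IsZero X := by
  rw [IsZero.iff_id_eq_zero, IsZero.iff_id_eq_zero, ← S.map_id]
  constructor
  · intro h
    exact Quiver.Hom.op_inj (S.map_injective (h.trans (S.map_zero _ _).symm))
  · intro h
    rw [← op_id, h, Limits.op_zero, S.map_zero]

lemma indecomposable_obj_iff [S.EssSurj] [HasBinaryBiproducts C] {X : C} : Indecomposable (S.obj (op X)) ↔ Indecomposable X := by
  unfold Indecomposable
  rw [isZero_obj_op_iff]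
  refine and_congr_right fun _ => ⟨fun h Y Z e => ?_, fun h Y Z e => ?_⟩
  · obtain ⟨e'⟩ := nonempty_obj_biprod_iso S Y Z
    have := h _ _ (S.mapIso e.symm.op ≪≫ e')
    rwa [isZero_obj_op_iff, isZero_obj_op_iff] at this
  · obtain ⟨Y', ⟨eY⟩⟩ := exists_obj_op_iso S Y
    obtain ⟨Z', ⟨eZ⟩⟩ := exists_obj_op_iso S Z
    obtain ⟨e'⟩ := nonempty_obj_biprod_iso S Y' Z'
    obtain ⟨i⟩ := nonempty_iso_of_obj S (e ≪≫ (biprod.mapIso eY eZ).symm ≪≫ e'.symm)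
    have := h _ _ i
    rw [← isZero_obj_op_iff S, ← isZero_obj_op_iff S (X := Z')] at this
    exact this.imp (fun h => h.of_iso eY.symm) fun h => h.of_iso eZ.symm

end Preadditive

section Duality

open Pretriangulated

variable {C : Type*} [Category C] [HasZeroObject C] [Preadditive C] [HasShift C ℤ]
  [∀ n : ℤ, (shiftFunctor C n).Additive] [Pretriangulated C]

/-! ### Isomorphism invariance -/

lemma IsBasic.of_iso {X Y : C} (h : IsBasic X) (e : X ≅ Y) : IsBasic Y := by
  obtain ⟨n, Z, h1, h2, ⟨e'⟩⟩ := h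
  exact ⟨n, Z, h1, h2, ⟨e.symm ≪≫ e'⟩⟩

lemma isClassicalTriangulatedGenerator_of_iso [IsTriangulated C] {X Y : C}
    (h : (ObjectProperty.singleton X).IsClassicalTriangulatedGenerator) (e : X ≅ Y) :
    (ObjectProperty.singleton Y).IsClassicalTriangulatedGenerator := by
  rw [ObjectProperty.isClassicalTriangulatedGenerator_iff, eq_top_iff] at *
  refine h.trans ((ObjectProperty.triangEnvelope_le_iff _).2 ?_)
  rw [ObjectProperty.singleton_le_iff]
  exact (ObjectProperty.prop_iff_of_iso _ e).2
    (ObjectProperty.le_triangEnvelope _ _ (by simp))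

lemma cls_mem_silt_iff [IsTriangulated C] {X : C} : cls X ∈ silt C ↔ IsBasic X ∧ IsSilting X := by
  constructor
  · rintro ⟨T, h, hb, hs⟩
    obtain ⟨e⟩ := Quotient.exact h
    exact ⟨hb.of_iso e.symm, Geq.of_iso e.symm e.symm hs.1,
      isClassicalTriangulatedGenerator_of_iso hs.2 e.symm⟩
  · rintro ⟨hb, hs⟩
    exact ⟨X, rfl, hb, hs⟩

lemma cls_mem_twoSilt_iff [IsTriangulated C] {A X : C} :
    cls X ∈ twoSilt A ↔ (IsBasic X ∧ IsSilting X) ∧ Geq A X ∧ Geq X (A⟦(1 : ℤ)⟧) := by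
  rw [← cls_mem_silt_iff]; rfl

lemma distinguished_of_iso {X Y Z X' Y' Z' : C} {f : X ⟶ Y} {g : Y ⟶ Z} {h : Z ⟶ X⟦(1 : ℤ)⟧}
    (H : Triangle.mk f g h ∈ distTriang C) {f' : X' ⟶ Y'} {g' : Y' ⟶ Z'} {h' : Z' ⟶ X'⟦(1 : ℤ)⟧}
    (e₁ : X' ≅ X) (e₂ : Y' ≅ Y) (e₃ : Z' ≅ Z) (h₁ : f' ≫ e₂.hom = e₁.hom ≫ f)
    (h₂ : g' ≫ e₃.hom = e₂.hom ≫ g) (h₃ : h' ≫ e₁.hom⟦(1 : ℤ)⟧' = e₃.hom ≫ h) :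
    Triangle.mk f' g' h' ∈ distTriang C :=
  isomorphic_distinguished _ H _ (Triangle.isoMk _ _ e₁ e₂ e₃ h₁ h₂ h₃)

/-! ### Contravariant autoequivalences -/

variable (S : Cᵒᵖ ⥤ C) [S.Additive] [S.Full] [S.Faithful] [S.EssSurj]

lemma isBasic_obj_iff {X : C} : IsBasic (S.obj (op X)) ↔ IsBasic X := by
  constructor
  · rintro ⟨n, Y, h1, h2, ⟨e⟩⟩
    choose Z hZ using fun i => exists_obj_op_iso S (Y i)
    let eZ := fun i => (hZ i).some
    refine ⟨n, Z, fun i => ?_, fun i j ⟨e⟩ => h2 i j ⟨(eZ i).symm ≪≫ S.mapIso e.symm.op ≪≫ eZ j⟩, ?_⟩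
    · rw [← indecomposable_obj_iff S]
      exact ⟨fun h => (h1 i).1 (h.of_iso (eZ i).symm), fun _ _ e' => (h1 i).2 _ _
        ((eZ i).symm ≪≫ e')⟩
    · obtain ⟨e'⟩ := nonempty_obj_biproduct_iso S Z
      exact nonempty_iso_of_obj S (e ≪≫ (biproduct.mapIso eZ).symm ≪≫ e'.symm)
  · rintro ⟨n, Y, h1, h2, ⟨e⟩⟩
    obtain ⟨e'⟩ := nonempty_obj_biproduct_iso S Y
    exact ⟨n, _, fun i => (indecomposable_obj_iff S).2 (h1 i),
      fun i j ⟨e⟩ => h2 i j (nonempty_iso_of_obj S e), ⟨S.mapIso e.symm.op ≪≫ e'⟩⟩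



variable (hS : ∀ {X Y Z : C} (f : X ⟶ Y) (g : Y ⟶ Z) (h : Z ⟶ X⟦(1 : ℤ)⟧),
  Triangle.mk f g h ∈ distTriang C →
    ∃ h', Triangle.mk (S.map g.op) (S.map f.op) h' ∈ distTriang C)

include hS

omit [S.Full] [S.EssSurj] in
-- The triangle X ⟶ 0 ⟶ X[1] ⟶ X[1] is sent to one with zero second term, so its third map is
-- invertible. Thus `hS`, which only asks for some third map, already controls `S` on shifts of
-- objects.
lemma nonempty_obj_shift_one_iso (X : C) :
    Nonempty (S.obj (op X) ≅ (S.obj (op (X⟦(1 : ℤ)⟧)))⟦(1 : ℤ)⟧) := by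
  have h := rot_of_distTriang _ (contractible_distinguished X)
  obtain ⟨h', H⟩ := hS _ _ _ h
  have hi : IsIso h' :=
    (Triangle.isZero₂_iff_isIso₃ _ H).1 ((isZero_obj_op_iff S).2 (isZero_zero C))
  exact ⟨@asIso _ _ _ _ h' hi⟩

omit [S.Full] [S.EssSurj] in
lemma nonempty_obj_shift_iso (X : C) (i : ℤ) :
    Nonempty (S.obj (op X) ≅ (S.obj (op (X⟦i⟧)))⟦i⟧) := by
  have hnat : ∀ (n : ℕ) (X : C), Nonempty (S.obj (op X) ≅ (S.obj (op (X⟦(n : ℤ)⟧)))⟦(n : ℤ)⟧) := by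
    intro n
    induction n with
    | zero => exact fun X => ⟨S.mapIso ((shiftFunctorZero C ℤ).app X).op ≪≫
        ((shiftFunctorZero C ℤ).app _).symm⟩
    | succ n ih =>
      intro X
      obtain ⟨e⟩ := ih X
      obtain ⟨e'⟩ := nonempty_obj_shift_one_iso S hS (X⟦(n : ℤ)⟧)
      exact ⟨e ≪≫ (shiftFunctor C (n : ℤ)).mapIso (e' ≪≫ (shiftFunctor C (1 : ℤ)).mapIso
        (S.mapIso ((shiftFunctorAdd' C (n : ℤ) 1 (n + 1 : ℕ) rfl).app X).op)) ≪≫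
        ((shiftFunctorAdd' C (1 : ℤ) n (n + 1 : ℕ) (by push_cast; ring)).app _).symm⟩
  obtain ⟨n, rfl | rfl⟩ := i.eq_nat_or_neg
  · exact hnat n X
  · obtain ⟨e⟩ := hnat n (X⟦(-n : ℤ)⟧)
    exact ⟨((shiftFunctorCompIsoId C (n : ℤ) (-n) (by ring)).app _).symm ≪≫
      (shiftFunctor C (-n : ℤ)).mapIso ((shiftFunctor C (n : ℤ)).mapIso
        (S.mapIso ((shiftFunctorCompIsoId C (-n : ℤ) n (by ring)).app X).op) ≪≫ e.symm)⟩

/-- Since S(Y) ≅ S(Y[i])[i], maps S(Y) ⟶ S(X)[i] are i-fold shifts of maps S(Y[i]) ⟶ S(X), that is,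
of images of maps X ⟶ Y[i]. -/
lemma homZero_obj_iff {X Y : C} (i : ℤ) :
    HomZero (S.obj (op Y)) (S.obj (op X)) i ↔ HomZero X Y i := by
  obtain ⟨e⟩ := nonempty_obj_shift_iso S hS Y i
  constructor
  · intro h f
    apply Quiver.Hom.op_inj
    apply S.map_injective
    rw [Limits.op_zero, S.map_zero]
    apply (shiftFunctor C i).map_injective
    rw [Functor.map_zero, ← cancel_epi e.hom, comp_zero]
    exact h _
  · intro h f
    obtain ⟨g, hg⟩ := (shiftFunctor C i).map_surjective (e.inv ≫ f)
    obtain ⟨k, rfl⟩ := S.map_surjective g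
    rw [← cancel_epi e.inv, ← hg, ← Quiver.Hom.op_unop k, h.eq_zero k.unop, Limits.op_zero, S.map_zero,
      Functor.map_zero, comp_zero]

lemma geq_obj_iff {X Y : C} : Geq (S.obj (op Y)) (S.obj (op X)) ↔ Geq X Y :=
  forall₂_congr fun i _ => homZero_obj_iff S hS i

/-- Thick subcategories can be transported both ways: the essential image under `S` of the thick
closure of `X` is thick, and so is the preimage under `S` of the thick closure of S(X). -/
lemma generator_obj_iff [IsTriangulated C] {X : C} :
    (ObjectProperty.singleton (S.obj (op X))).IsClassicalTriangulatedGenerator ↔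
      (ObjectProperty.singleton X).IsClassicalTriangulatedGenerator := by
  constructor
  · intro h
    let E := (ObjectProperty.singleton X).triangEnvelope
    let Q : ObjectProperty C := fun Y => ∃ Z : C, E Z ∧ Nonempty (S.obj (op Z) ≅ Y)
    have h0 : Q.IsClosedUnderIsomorphisms := ⟨by
      rintro Y Y' e ⟨Z, hZ, ⟨e'⟩⟩
      exact ⟨Z, hZ, ⟨e' ≪≫ e⟩⟩⟩
    have h1 : Q.IsStableUnderRetracts := ⟨by
      rintro Y Y' r ⟨Z, hZ, ⟨e⟩⟩
      obtain ⟨W, ⟨e'⟩⟩ := exists_obj_op_iso S Y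
      obtain ⟨a, ha⟩ := S.map_surjective (e'.hom ≫ r.i ≫ e.inv)
      obtain ⟨b, hb⟩ := S.map_surjective (e.hom ≫ r.r ≫ e'.inv)
      refine ⟨W, E.prop_of_retract ⟨b.unop, a.unop, ?_⟩ hZ, ⟨e'⟩⟩
      apply Quiver.Hom.op_inj
      apply S.map_injective
      rw [op_comp, Quiver.Hom.op_unop, Quiver.Hom.op_unop, S.map_comp, ha, hb]
      simp⟩
    have h2 : Q.ContainsZero := by
      have : E.ContainsZero := inferInstance
      obtain ⟨Z, hZ, hZ'⟩ := this.exists_zero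
      exact ⟨_, (isZero_obj_op_iff S).2 hZ, Z, hZ', ⟨Iso.refl _⟩⟩
    have h3 : Q.IsStableUnderShift ℤ := ⟨fun n => ⟨by
      rintro Y ⟨Z, hZ, ⟨e⟩⟩
      obtain ⟨e'⟩ := nonempty_obj_shift_iso S hS Z (-n)
      refine ⟨Z⟦-n⟧, E.le_shift _ _ hZ, ⟨((shiftFunctorCompIsoId C (-n) n (by ring)).app _).symm ≪≫
        (shiftFunctor C n).mapIso (e'.symm ≪≫ e)⟩⟩⟩⟩
    have h4 : Q.IsTriangulatedClosed₃ := .mk' (by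
      rintro T hT ⟨Z₁, hZ₁, ⟨e₁⟩⟩ ⟨Z₂, hZ₂, ⟨e₂⟩⟩
      obtain ⟨φ, hφ⟩ := S.map_surjective (e₁.hom ≫ T.mor₁ ≫ e₂.inv)
      obtain ⟨W, a, b, hW⟩ := distinguished_cocone_triangle₁ φ.unop
      obtain ⟨c, hc⟩ := hS _ _ _ hW
      refine ⟨W, E.ext_of_isTriangulatedClosed₁ _ hW hZ₂ hZ₁,
        ⟨Triangle.π₃.mapIso (isoTriangleOfIso₁₂ _ _ hc hT e₁ e₂ ?_)⟩⟩
      change S.map φ.unop.op ≫ e₂.hom = e₁.hom ≫ T.mor₁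
      rw [Quiver.Hom.op_unop, hφ]
      simp)
    have h5 : Q.IsTriangulated := { toIsTriangulatedClosed₂ := .of_isTriangulatedClosed₃ }
    have h6 : (ObjectProperty.singleton (S.obj (op X))).triangEnvelope ≤ Q := by
      rw [ObjectProperty.triangEnvelope_le_iff, ObjectProperty.singleton_le_iff]
      exact ⟨X, ObjectProperty.le_triangEnvelope _ _ (by simp), ⟨Iso.refl _⟩⟩
    rw [(ObjectProperty.isClassicalTriangulatedGenerator_iff _).1 h] at h6
    rw [ObjectProperty.isClassicalTriangulatedGenerator_iff, eq_top_iff]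
    intro Y _
    obtain ⟨Z, hZ, ⟨e⟩⟩ := h6 (S.obj (op Y)) trivial
    obtain ⟨i⟩ := nonempty_iso_of_obj S e
    exact (ObjectProperty.prop_iff_of_iso _ i).1 hZ
  · intro h
    let E := (ObjectProperty.singleton (S.obj (op X))).triangEnvelope
    let Q : ObjectProperty C := fun Y => E (S.obj (op Y))
    have h0 : Q.IsClosedUnderIsomorphisms := ⟨fun e h =>
      (E.prop_iff_of_iso (S.mapIso e.symm.op)).1 h⟩
    have h1 : Q.IsStableUnderRetracts := ⟨by
      intro Y Y' r h
      refine E.prop_of_retract ⟨S.map r.r.op, S.map r.i.op, ?_⟩ h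
      rw [← S.map_comp, ← op_comp, r.retract, op_id, S.map_id]⟩
    have h2 : Q.ContainsZero := ⟨_, isZero_zero C,
      E.prop_of_isZero ((isZero_obj_op_iff S).2 (isZero_zero C))⟩
    have h3 : Q.IsStableUnderShift ℤ := ⟨fun n => ⟨by
      intro Y hY
      obtain ⟨e⟩ := nonempty_obj_shift_iso S hS Y n
      exact (E.prop_iff_of_iso ((shiftFunctor C (-n)).mapIso e ≪≫
        (shiftFunctorCompIsoId C n (-n) (by ring)).app _)).1 (E.le_shift _ _ hY)⟩⟩
    have h4 : Q.IsTriangulatedClosed₂ := .mk' (by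
      intro T hT h₁ h₃
      obtain ⟨c, hc⟩ := hS _ _ _ hT
      exact E.ext_of_isTriangulatedClosed₂ _ hc h₃ h₁)
    have h5 : Q.IsTriangulated := {}
    have h6 : (ObjectProperty.singleton X).triangEnvelope ≤ Q := by
      rw [ObjectProperty.triangEnvelope_le_iff, ObjectProperty.singleton_le_iff]
      exact ObjectProperty.le_triangEnvelope _ _ (by simp)
    rw [(ObjectProperty.isClassicalTriangulatedGenerator_iff _).1 h] at h6
    rw [ObjectProperty.isClassicalTriangulatedGenerator_iff, eq_top_iff]
    intro Y _
    obtain ⟨Z, ⟨e⟩⟩ := exists_obj_op_iso S Y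
    exact (E.prop_iff_of_iso e).1 (h6 Z trivial)

lemma isSilting_obj_iff [IsTriangulated C] {X : C} : IsSilting (S.obj (op X)) ↔ IsSilting X :=
  and_congr (geq_obj_iff S hS) (generator_obj_iff S hS)

variable {A P : C} (eA : S.obj (op A) ≅ A⟦(1 : ℤ)⟧) (eP : S.obj (op P) ≅ P⟦(1 : ℤ)⟧)

omit [S.Full] [S.EssSurj] in
lemma nonempty_obj_shift_iso_self (eA : S.obj (op A) ≅ A⟦(1 : ℤ)⟧) :
    Nonempty (S.obj (op (A⟦(1 : ℤ)⟧)) ≅ A) := by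
  obtain ⟨e⟩ := nonempty_obj_shift_one_iso S hS A
  exact ⟨(shiftFunctor C (1 : ℤ)).preimageIso (e.symm ≪≫ eA)⟩

include eA in
lemma cls_obj_mem_twoSilt_iff [IsTriangulated C] {X : C} :
    cls (S.obj (op X)) ∈ twoSilt A ↔ cls X ∈ twoSilt A := by
  obtain ⟨eA'⟩ := nonempty_obj_shift_iso_self S hS eA
  rw [cls_mem_twoSilt_iff, cls_mem_twoSilt_iff, isBasic_obj_iff, isSilting_obj_iff S hS,
    ← Geq.iso_left_iff eA', ← Geq.iso_right_iff eA, geq_obj_iff S hS, geq_obj_iff S hS]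
  tauto

omit hS [S.Additive] [S.Full] [S.Faithful] [S.EssSurj]

lemma isBasicVersion_obj [S.Additive] [S.Full] [S.Faithful] [S.EssSurj] {A A' B : C}
    (e : S.obj (op A) ≅ A') (h : IsBasicVersion B A) :
    IsBasicVersion (S.obj (op B)) A' := by
  refine ⟨(isBasic_obj_iff S).2 h.1, ?_⟩
  rw [addOf_eq_iff]
  obtain ⟨h1, h2⟩ := addOf_eq_iff.1 h.2
  exact ⟨addOf_trans (addOf_of_iso (addOf_self _) e.symm) (addOf_map_op S h1),
    addOf_of_iso (addOf_map_op S h2) e⟩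

lemma isMinRightApprox_obj [S.Additive] [S.Full] [S.Faithful] {M M' X X' : C}
    {f : X ⟶ M'} (h : IsMinLeftApprox M f) (e : S.obj (op X) ≅ X') :
    IsMinRightApprox (S.obj (op M)) (S.map f.op ≫ e.hom) where
  mem := addOf_map_op S h.mem
  factors := by
    rintro N ⟨n, ⟨r⟩⟩ g
    -- A map from a sum of copies of S(M) comes from a map into a sum of copies of `M`, where the
    -- left approximation factors it.
    obtain ⟨E⟩ := nonempty_obj_biproduct_iso S (fun _ : Fin n => M)
    obtain ⟨k, hk⟩ := S.map_surjective (E.hom ≫ r.r ≫ g ≫ e.inv)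
    obtain ⟨l, hl⟩ := h.factors _ ⟨n, ⟨Retract.refl _⟩⟩ k.unop
    refine ⟨r.i ≫ E.inv ≫ S.map l.op, ?_⟩
    simp only [Category.assoc]
    rw [← S.map_comp_assoc, ← op_comp, hl, Quiver.Hom.op_unop, hk]
    simp
  minimal := by
    intro φ hφ
    obtain ⟨ψ, rfl⟩ := S.map_surjective φ
    have h1 : f ≫ ψ.unop = f := by
      apply Quiver.Hom.op_inj
      apply S.map_injective
      rw [op_comp, Quiver.Hom.op_unop, S.map_comp, ← cancel_mono e.hom, Category.assoc, hφ]
    have := h.minimal _ h1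
    have : IsIso ψ := by
      rw [← Quiver.Hom.op_unop ψ]; infer_instance
    infer_instance

lemma isMinLeftApprox_obj [S.Additive] [S.Full] [S.Faithful] {M M' X X' : C}
    {f : M' ⟶ X} (h : IsMinRightApprox M f) (e : X' ≅ S.obj (op X)) :
    IsMinLeftApprox (S.obj (op M)) (e.hom ≫ S.map f.op) where
  mem := addOf_map_op S h.mem
  factors := by
    rintro N ⟨n, ⟨r⟩⟩ g
    obtain ⟨E⟩ := nonempty_obj_biproduct_iso S (fun _ : Fin n => M)
    obtain ⟨k, hk⟩ := S.map_surjective (e.inv ≫ g ≫ r.i ≫ E.inv)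
    obtain ⟨l, hl⟩ := h.factors _ ⟨n, ⟨Retract.refl _⟩⟩ k.unop
    refine ⟨S.map l.op ≫ E.hom ≫ r.r, ?_⟩
    simp only [Category.assoc]
    rw [← S.map_comp_assoc, ← op_comp, hl, Quiver.Hom.op_unop, hk]
    simp
  minimal := by
    intro φ hφ
    obtain ⟨ψ, rfl⟩ := S.map_surjective φ
    have h1 : ψ.unop ≫ f = f := by
      apply Quiver.Hom.op_inj
      apply S.map_injective
      rw [op_comp, Quiver.Hom.op_unop, S.map_comp, ← cancel_epi e.hom, ← Category.assoc, hφ]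
    have := h.minimal _ h1
    have : IsIso ψ := by
      rw [← Quiver.Hom.op_unop ψ]; infer_instance
    infer_instance

include hS

lemma isRightMutation_obj [S.Additive] [S.Full] [S.Faithful] {T X X' U : C}
    (h : IsLeftMutation T X U) (e : S.obj (op X) ≅ X') :
    IsRightMutation (S.obj (op T)) X' (S.obj (op U)) := by
  obtain ⟨M, M', Y, f, g, h, ⟨eT⟩, hf, htri, ⟨eU⟩⟩ := h
  obtain ⟨h', hh'⟩ := hS _ _ _ htri
  obtain ⟨e1⟩ := nonempty_obj_biprod_iso S X M
  obtain ⟨e2⟩ := nonempty_obj_biprod_iso S Y M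
  refine ⟨_, _, _, S.map g.op, S.map f.op ≫ e.hom, e.inv ≫ h',
    ⟨S.mapIso eT.symm.op ≪≫ e1 ≪≫ biprod.mapIso e (Iso.refl _)⟩, isMinRightApprox_obj S hf e,
    distinguished_of_iso hh' (Iso.refl _) (Iso.refl _) e.symm ?_ ?_ ?_,
    ⟨S.mapIso eU.symm.op ≪≫ e2⟩⟩
  · simp
  · simp
  · simp

lemma isLeftMutation_obj [S.Additive] [S.Full] [S.Faithful] {T X X' U : C}
    (h : IsRightMutation T X U) (e : X' ≅ S.obj (op X)) :
    IsLeftMutation (S.obj (op T)) X' (S.obj (op U)) := by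
  obtain ⟨M, M', Y, g, f, h, ⟨eT⟩, hf, htri, ⟨eU⟩⟩ := h
  obtain ⟨h', hh'⟩ := hS _ _ _ htri
  obtain ⟨e1⟩ := nonempty_obj_biprod_iso S X M
  obtain ⟨e2⟩ := nonempty_obj_biprod_iso S Y M
  refine ⟨_, _, _, e.hom ≫ S.map f.op, S.map g.op, h' ≫ e.inv⟦(1 : ℤ)⟧',
    ⟨S.mapIso eT.symm.op ≪≫ e1 ≪≫ biprod.mapIso e.symm (Iso.refl _)⟩, isMinLeftApprox_obj S hf e,
    distinguished_of_iso hh' e (Iso.refl _) (Iso.refl _) ?_ ?_ ?_,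
    ⟨S.mapIso eU.symm.op ≪≫ e2⟩⟩
  · simp
  · simp
  · simp [← CategoryTheory.Functor.map_comp]

variable [S.Additive] [S.Full] [S.Faithful] [S.EssSurj]
include eA eP

lemma cls_obj_mem_plusPart [IsTriangulated C] {X : C} (h : cls X ∈ minusPart A P) :
    cls (S.obj (op X)) ∈ plusPart A P := by
  obtain ⟨h1, B, U, hB, hU, h2, h3⟩ := h
  obtain ⟨eA'⟩ := nonempty_obj_shift_iso_self S hS eA
  exact ⟨(cls_obj_mem_twoSilt_iff S hS eA).2 h1, S.obj (op B), S.obj (op U),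
    isBasicVersion_obj S eA hB, isRightMutation_obj S hS hU eP,
    (Geq.iso_left_iff eA').1 ((geq_obj_iff S hS).2 h3), (geq_obj_iff S hS).2 h2⟩

lemma cls_obj_mem_minusPart [IsTriangulated C] {X : C} (h : cls X ∈ plusPart A P) :
    cls (S.obj (op X)) ∈ minusPart A P := by
  obtain ⟨h1, B, U, hB, hU, h2, h3⟩ := h
  obtain ⟨eA'⟩ := nonempty_obj_shift_iso_self S hS eA
  obtain ⟨eP'⟩ := nonempty_obj_shift_iso_self S hS eP
  exact ⟨(cls_obj_mem_twoSilt_iff S hS eA).2 h1, S.obj (op B), S.obj (op U),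
    isBasicVersion_obj S eA' hB, isLeftMutation_obj S hS hU eP'.symm,
    (geq_obj_iff S hS).2 h3, (Geq.iso_right_iff eA).1 ((geq_obj_iff S hS).2 h2)⟩

/-- The formal part of the theorem, for any triangulated category with a suitable duality. The
assumption `hno` provides disjointness; its proof needs a functor defined on complexes rather than
on an abstract triangulated category. -/
theorem partition_of_duality [IsTriangulated C] (hA : Geq A A)
    (hgen : (ObjectProperty.singleton A).IsClassicalTriangulatedGenerator)
    (happ : ∀ T : C, ∃ (A₀ : C) (π : A₀ ⟶ T), addOf A A₀ ∧ ∀ x : A ⟶ T, ∃ y : A ⟶ A₀, y ≫ π = x)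
    (hP : LocalObj P) (hex : ∃ B U : C, IsBasicVersion B A ∧ IsLeftMutation B P U)
    (hno : ∀ {A₁ A₀ T : C} (d : A₁ ⟶ A₀) (π : A₀ ⟶ T) (δ : T ⟶ A₁⟦(1 : ℤ)⟧),
      Triangle.mk d π δ ∈ distTriang C → addOf A A₁ → addOf A A₀ → IsSilting T →
        RadInj hP d → ¬ RadSurj hP d) :
    minusPart A P ∪ plusPart A P = twoSilt A ∧
    Disjoint (minusPart A P) (plusPart A P) ∧
    Set.BijOn (isoClassMap S) (minusPart A P) (plusPart A P) ∧
    (∀ t ∈ minusPart A P, ∀ u ∈ minusPart A P,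
      clsGeq t u ↔ clsGeq (isoClassMap S u) (isoClassMap S t)) ∧
    Cardinal.mk (twoSilt A) = 2 * Cardinal.mk (minusPart A P) ∧
    Cardinal.mk (twoSilt A) = 2 * Cardinal.mk (plusPart A P) ∧
    ((twoSilt A).Finite → Even (twoSilt A).ncard) := by
  -- A right mutation of A[1] is obtained as the image under `S` of a left mutation of `A`.
  have hex' : ∃ B U : C, IsBasicVersion B (A⟦(1 : ℤ)⟧) ∧ IsRightMutation B (P⟦(1 : ℤ)⟧) U := by
    obtain ⟨B, U, hB, hU⟩ := hex
    exact ⟨_, _, isBasicVersion_obj S eA hB, isRightMutation_obj S hS hU eP⟩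
  have key {T : C} (hT : cls T ∈ twoSilt A) :
      (cls T ∈ minusPart A P ∨ cls T ∈ plusPart A P) ∧
        ¬ (cls T ∈ minusPart A P ∧ cls T ∈ plusPart A P) := by
    obtain ⟨⟨-, hsilt⟩, h1, h2⟩ := cls_mem_twoSilt_iff.1 hT
    obtain ⟨A₁, A₀, d, π, δ, htri, hA₁, hA₀⟩ := exists_presentation hA hgen happ h1 h2
    rw [mem_minusPart_iff htri hA hA₁ hA₀ hP hT hex, mem_plusPart_iff htri hA hA₁ hA₀ hP hT hex']
    exact ⟨radInj_or_radSurj htri hA hA₁ hA₀ hP hsilt.1,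
      fun h => hno d π δ htri hA₁ hA₀ hsilt h.1 h.2⟩
  have hunion : minusPart A P ∪ plusPart A P = twoSilt A := by
    apply Set.Subset.antisymm
    · rintro t (h | h)
      exacts [h.1, h.1]
    · intro t
      induction t using Quotient.inductionOn with | _ T => exact fun hT => (key hT).1
  have hdisj : Disjoint (minusPart A P) (plusPart A P) := by
    rw [Set.disjoint_left]
    intro t
    induction t using Quotient.inductionOn with
    | _ T => exact fun h h' => (key h.1).2 ⟨h, h'⟩
  have hinj : Function.Injective (isoClassMap S) := by
    intro t u
    induction t, u using Quotient.inductionOn₂ with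
    | _ T U =>
      intro h
      obtain ⟨e⟩ := Quotient.exact h
      exact Quotient.sound (nonempty_iso_of_obj S e)
  have hbij : Set.BijOn (isoClassMap S) (minusPart A P) (plusPart A P) := by
    refine ⟨fun t => ?_, hinj.injOn, fun t => ?_⟩
    · induction t using Quotient.inductionOn with
      | _ T => exact fun h => cls_obj_mem_plusPart S hS eA eP h
    · induction t using Quotient.inductionOn with
      | _ T =>
        intro h
        obtain ⟨X, ⟨e⟩⟩ := exists_obj_op_iso S T
        have hX : cls (S.obj (op X)) = cls T := Quotient.sound ⟨e⟩
        refine ⟨cls X, ?_, hX⟩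
        change cls T ∈ plusPart A P at h
        rw [← hX] at h
        -- Surjectivity without computing the square of `S`: if the preimage `X` were in the plus
        -- part, S(X) would lie in the minus part as well as in the plus part.
        refine (key ((cls_obj_mem_twoSilt_iff S hS eA).1 h.1)).1.resolve_right fun h' => ?_
        exact (key h.1).2 ⟨cls_obj_mem_minusPart S hS eA eP h', h⟩
  have hcard : Cardinal.mk (minusPart A P) = Cardinal.mk (plusPart A P) :=
    Cardinal.mk_congr (Set.BijOn.equiv _ hbij)
  have hsum : Cardinal.mk (twoSilt A) = Cardinal.mk (minusPart A P) + Cardinal.mk (plusPart A P) := by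
    rw [← hunion, Cardinal.mk_union_of_disjoint hdisj]
  refine ⟨hunion, hdisj, hbij, fun t _ u _ => ?_, ?_, ?_, fun hfin => ?_⟩
  · induction t, u using Quotient.inductionOn₂ with
    | _ T U => exact (geq_obj_iff S hS).symm
  · rw [hsum, ← hcard, two_mul]
  · rw [hsum, hcard, two_mul]
  · rw [← hunion] at hfin ⊢
    rw [Set.ncard_union_eq hdisj (hfin.subset Set.subset_union_left)
      (hfin.subset Set.subset_union_right), ← hbij.image_eq, Set.ncard_image_of_injective _ hinj]
    exact ⟨_, rfl⟩

end Duality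

end Silt

namespace Silt
open CategoryTheory Limits MulOpposite Opposite Pretriangulated
universe v u

/-! ### Stalk complexes and dévissage of bounded complexes -/

section Stalk

open scoped ZeroObject

variable (C : Type*) [Category C] [Preadditive C] [HasZeroObject C]

/-- The functor which sends an object to the complex concentrated in degree zero. -/
noncomputable def stalkFunctor : C ⥤ Kb C :=
  (bounded C).lift (HomologicalComplex.single C (ComplexShape.up ℤ) 0 ⋙
    HomotopyCategory.quotient C (ComplexShape.up ℤ)) fun X => (stalk X).property

variable {C}

instance : (stalkFunctor C).Additive where
  map_add := by
    intro X Y f g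
    apply ObjectProperty.hom_ext
    exact (HomologicalComplex.single C (ComplexShape.up ℤ) 0 ⋙
      HomotopyCategory.quotient C (ComplexShape.up ℤ)).map_add

/-- All differentials of stalk complexes vanish, so homotopic maps between them agree in degree
zero. -/
instance : (HomologicalComplex.single C (ComplexShape.up ℤ) 0 ⋙
    HomotopyCategory.quotient C (ComplexShape.up ℤ)).Faithful where
  map_injective h := by
    apply (HomologicalComplex.single C (ComplexShape.up ℤ) 0).map_injective
    have h := HomotopyCategory.homotopyOfEq _ _ h
    apply HomologicalComplex.from_single_hom_ext
    rw [h.comm 0]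
    simp [dNext, prevD]

instance : (stalkFunctor C).Faithful where
  map_injective h :=
    (HomologicalComplex.single C (ComplexShape.up ℤ) 0 ⋙
      HomotopyCategory.quotient C (ComplexShape.up ℤ)).map_injective
        ((ObjectProperty.ι _).congr_map h)

instance : (stalkFunctor C).Full where
  map_surjective f := by
    obtain ⟨g, hg⟩ := (HomologicalComplex.single C (ComplexShape.up ℤ) 0 ⋙
      HomotopyCategory.quotient C (ComplexShape.up ℤ)).map_surjective f.hom
    exact ⟨g, ObjectProperty.hom_ext _ hg⟩

/-- The complex Y[i] is concentrated in degree -i ≠ 0, so every chain map from a stalk in degree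
zero vanishes already before passing to homotopy. -/
lemma geq_stalk [HasBinaryBiproducts C] (X Y : C) : Geq (stalk X) (stalk Y) := by
  intro i hi f
  apply ObjectProperty.hom_ext
  have e : (stalk Y)⟦i⟧.obj ≅ (HomotopyCategory.quotient C (ComplexShape.up ℤ)).obj
    (((HomologicalComplex.single C (ComplexShape.up ℤ) 0).obj Y)⟦i⟧) :=
    (((bounded C).ι.commShiftIso i).app (stalk Y)).trans
      (((HomotopyCategory.quotient C (ComplexShape.up ℤ)).commShiftIso i).symm.app _)
  obtain ⟨g, hg⟩ := (HomotopyCategory.quotient C (ComplexShape.up ℤ)).map_surjective (f.hom ≫ e.hom)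
  have : g = 0 := by
    apply HomologicalComplex.from_single_hom_ext
    apply IsZero.eq_of_tgt
    exact HomologicalComplex.isZero_single_obj_X (ComplexShape.up ℤ) 0 Y (0 + i) (by omega)
  rw [this, Functor.map_zero] at hg
  exact (cancel_mono e.hom).1 (hg.symm.trans zero_comp.symm)

variable [HasBinaryBiproducts C]

/-- A bounded complex as an object of the bounded homotopy category. -/
def Kb.mk (K : CochainComplex C ℤ)
    (h : bounded C ((HomotopyCategory.quotient C (ComplexShape.up ℤ)).obj K)) : Kb C := ⟨_, h⟩

lemma prop_of_single (Q : ObjectProperty (Kb C)) [Q.IsTriangulated] [Q.IsClosedUnderIsomorphisms]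
    (hQ : ∀ X, Q (stalk X)) (b : ℤ) (X : C)
    (h : bounded C ((HomotopyCategory.quotient C (ComplexShape.up ℤ)).obj
      ((HomologicalComplex.single C (ComplexShape.up ℤ) b).obj X))) : Q (Kb.mk _ h) := by
  let e₁ := ((HomotopyCategory.singleFunctors C).shiftIso (-b) b 0 (by omega)).app X
  let e₂ := ((bounded C).ι.commShiftIso (-b)).app (stalk X)
  exact Q.prop_of_iso ((bounded C).ι.preimageIso (e₂.trans e₁)) (Q.le_shift (-b) _ (hQ X))

/-- The inclusion of bounded complexes is full and commutes with shifts, so the ambient third map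
descends. -/
lemma exists_distinguished_of_hom {X Y Z : Kb C} (f : X ⟶ Y) (g : Y ⟶ Z)
    (h : Z.obj ⟶ X.obj⟦(1 : ℤ)⟧)
    (hT : Triangle.mk f.hom g.hom h ∈ distTriang (HomotopyCategory C (ComplexShape.up ℤ))) :
    ∃ h', Triangle.mk f g h' ∈ distTriang (Kb C) := by
  obtain ⟨h', hh'⟩ := (bounded C).ι.map_surjective
    (show (bounded C).ι.obj Z ⟶ (bounded C).ι.obj (X⟦(1 : ℤ)⟧) from
      h ≫ ((bounded C).ι.commShiftIso (1 : ℤ)).inv.app X)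
  have e : (bounded C).ι.map h' ≫ ((bounded C).ι.commShiftIso (1 : ℤ)).hom.app X = h := by
    refine (congrArg (· ≫ _) hh').trans ((Category.assoc _ _ _).trans ?_)
    refine (congrArg (h ≫ ·) 
      (Iso.inv_hom_id_app ((bounded C).ι.commShiftIso (1 : ℤ)) X)).trans (Category.comp_id _)
  exact ⟨h', isomorphic_distinguished _ hT _
    (Triangle.isoMk _ _ (Iso.refl _) (Iso.refl _) (Iso.refl _)
      ((Category.comp_id _).trans (Category.id_comp _).symm)
      ((Category.comp_id _).trans (Category.id_comp _).symm)
      ((congrArg (_ ≫ ·) (CategoryTheory.Functor.map_id _ _)).trans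
        ((Category.comp_id _).trans (e.trans (Category.id_comp _).symm))))⟩

lemma prop_of_splitting (Q : ObjectProperty (Kb C)) [Q.IsTriangulated]
    [Q.IsClosedUnderIsomorphisms] (S : ShortComplex (CochainComplex C ℤ))
    (σ : ∀ n, Nonempty (S.map (HomologicalComplex.eval C _ n)).Splitting)
    (h₁ : bounded C ((HomotopyCategory.quotient C (ComplexShape.up ℤ)).obj S.X₁))
    (h₂ : bounded C ((HomotopyCategory.quotient C (ComplexShape.up ℤ)).obj S.X₂))
    (h₃ : bounded C ((HomotopyCategory.quotient C (ComplexShape.up ℤ)).obj S.X₃))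
    (hQ₁ : Q (Kb.mk _ h₁)) (hQ₃ : Q (Kb.mk _ h₃)) : Q (Kb.mk _ h₂) := by
  have hT := (HomotopyCategory.distinguished_iff_iso_trianglehOfDegreewiseSplit
    (CochainComplex.trianglehOfDegreewiseSplit S fun n => (σ n).some)).2 ⟨_, _, ⟨Iso.refl _⟩⟩
  obtain ⟨h', hT'⟩ := exists_distinguished_of_hom (X := Kb.mk _ h₁) (Y := Kb.mk _ h₂)
    (Z := Kb.mk _ h₃) (ObjectProperty.homMk _) (ObjectProperty.homMk _) _ hT
  exact Q.ext_of_isTriangulatedClosed₂ _ hT' hQ₁ hQ₃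

/-- Induction on the number of degrees in the supporting interval. The top term is a subcomplex
because no nonzero differential leaves it; the quotient lives in one degree fewer, and the sequence
is split in each degree, hence gives a triangle. -/
lemma prop_of_stalk (Q : ObjectProperty (Kb C)) [Q.IsTriangulated] [Q.IsClosedUnderIsomorphisms]
    (hQ : ∀ X, Q (stalk X)) (n : ℕ) : ∀ (a : ℤ) (K : CochainComplex C ℤ)
    (_ : ∀ i, i < a ∨ a + n ≤ i → IsZero (K.X i))
    (h : bounded C ((HomotopyCategory.quotient C (ComplexShape.up ℤ)).obj K)), Q (Kb.mk K h) := by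
  induction n with
  | zero =>
    intro a K hK h
    have hK' : IsZero K := (IsZero.iff_id_eq_zero _).2 (by
      ext i
      exact (hK i (by simp; omega)).eq_of_src _ _)
    have hz : IsZero (Kb.mk K h) := (IsZero.iff_id_eq_zero _).2 (ObjectProperty.hom_ext _
      (((HomotopyCategory.quotient C (ComplexShape.up ℤ)).map_isZero hK').eq_of_src _ _))
    obtain ⟨Z, hZ, hQZ⟩ := Q.exists_prop_of_containsZero
    exact Q.prop_of_iso (hZ.iso hz) hQZ
  | succ n ih =>
    intro a K hK h
    obtain ⟨b, hb⟩ : ∃ b, b = a + n := ⟨_, rfl⟩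
    have hd : ∀ j, K.d b j = 0 := fun j => by
      by_cases hj : b + 1 = j
      · exact (hK j (Or.inr (by push_cast; omega))).eq_of_tgt _ _
      · exact K.shape _ _ hj
    -- These data model the quotient by the top term: zero in degree b, the original term elsewhere.
    -- Choosing `Z`, `s` and `r` from an existence statement avoids transport along equalities of
    -- objects defined by cases.
    have hex : ∀ i, ∃ (Z : C) (s : Z ⟶ K.X i) (r : K.X i ⟶ Z), s ≫ r = 𝟙 Z ∧
        (i = b → IsZero Z) ∧ (i ≠ b → r ≫ s = 𝟙 _) := fun i => by
      by_cases hi : i = b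
      · exact ⟨(0 : C), 0, 0, (isZero_zero C).eq_of_src _ _, fun _ => isZero_zero C, fun h => (h hi).elim⟩
      · exact ⟨K.X i, 𝟙 _, 𝟙 _, by simp, fun h => (hi h).elim, fun _ => by simp⟩
    choose Z s r hsr hZ hrs using hex
    let K' : CochainComplex C ℤ :=
      { X := Z
        d := fun i j => s i ≫ K.d i j ≫ r j
        shape := fun i j hij => by rw [K.shape i j hij]; simp
        d_comp_d' := fun i j k _ _ => by
          by_cases hj : j = b
          · subst hj; simp [hd]
          · have := hrs j hj
            simp [reassoc_of% this] }
    let π : K ⟶ K' :=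
      { f := r
        comm' := fun i j _ => by
          by_cases hi : i = b
          · subst hi; simp [K', hd]
          · have := hrs i hi
            simp [K', reassoc_of% this] }
    let ι : (HomologicalComplex.single C (ComplexShape.up ℤ) b).obj (K.X b) ⟶ K :=
      HomologicalComplex.mkHomFromSingle (𝟙 _) fun j _ => by simp [hd]
    let S : ShortComplex (CochainComplex C ℤ) := ShortComplex.mk ι π (by
      apply HomologicalComplex.from_single_hom_ext
      exact (hZ b rfl).eq_of_tgt _ _)
    have h₁ : bounded C ((HomotopyCategory.quotient C (ComplexShape.up ℤ)).obj S.X₁) :=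
      ⟨b, b, fun i hi => HomologicalComplex.isZero_single_obj_X _ _ _ _ (by omega)⟩
    have hK' : ∀ i, i < a ∨ a + n ≤ i → IsZero (K'.X i) := fun i hi => by
      by_cases hi' : i = b
      · exact hZ i hi'
      · have := mono_of_mono_fac (hsr i)
        exact IsZero.of_mono (s i) (hK i (by push_cast; omega))
    have h₃ : bounded C ((HomotopyCategory.quotient C (ComplexShape.up ℤ)).obj S.X₃) :=
      ⟨a, a + n, fun i hi => hK' i (by omega)⟩
    refine prop_of_splitting Q S (fun i => ?_) h₁ h h₃ (prop_of_single Q hQ b _ h₁)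
      (ih a K' hK' h₃)
    by_cases hi : i = b
    · subst hi
      have h₄ : ι.f i = (HomologicalComplex.singleObjXSelf (ComplexShape.up ℤ) i _).hom := by
        simp [ι]
      have h₅ : r i = 0 := (hZ i rfl).eq_of_tgt _ _
      have h₆ : (HomologicalComplex.singleObjXSelf (ComplexShape.up ℤ) i _).inv ≫ ι.f i +
          r i ≫ s i = 𝟙 _ := by
        rw [h₄, h₅, zero_comp, add_zero, Iso.inv_hom_id]
      exact ⟨{ r := (HomologicalComplex.singleObjXSelf (ComplexShape.up ℤ) i _).inv
               s := s i
               f_r := (congrArg (· ≫ _) h₄).trans (Iso.hom_inv_id _)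
               s_g := hsr i
               id := h₆ }⟩
    · have hz := HomologicalComplex.isZero_single_obj_X (ComplexShape.up ℤ) b (K.X b) i hi
      exact ⟨{ r := 0
               s := s i
               f_r := hz.eq_of_src _ _
               s_g := hsr i
               id := (congrArg (· + _) zero_comp).trans ((zero_add _).trans (hrs i hi)) }⟩

lemma forall_prop_of_stalk (Q : ObjectProperty (Kb C)) [Q.IsTriangulated]
    [Q.IsClosedUnderIsomorphisms] (hQ : ∀ X, Q (stalk X)) (K : Kb C) : Q K := by
  obtain ⟨K, hK⟩ := K
  obtain ⟨L, rfl⟩ := K.quotient_obj_surjective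
  obtain ⟨a, b, h⟩ := hK
  -- The interval from a to b has b + 1 - a degrees; if it is empty, truncation to 0 is right, as
  -- the complex is then zero.
  exact prop_of_stalk Q hQ (b + 1 - a).toNat a L (fun i hi => h i (by omega)) ⟨a, b, h⟩

end Stalk

section Generator

variable {C : Type*} [Category C] [HasZeroObject C] [Preadditive C] [HasShift C ℤ]
  [∀ n : ℤ, (shiftFunctor C n).Additive] [Pretriangulated C]

lemma prop_of_addOf (Q : ObjectProperty C) [Q.IsTriangulated] [Q.IsStableUnderRetracts]
    {M X : C} (hM : Q M) (h : addOf M X) : Q X := by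
  obtain ⟨n, ⟨r⟩⟩ := h
  have : Q.IsClosedUnderFiniteProducts := .mk'
  exact Q.prop_of_retract r
    (Q.prop_of_isLimit_fan (biproduct.isLimit (fun _ : Fin n => M)) fun _ => hM)

end Generator

lemma isClassicalTriangulatedGenerator_of_addOf {C : Type*} [Category C] [Preadditive C]
    [HasZeroObject C] [HasBinaryBiproducts C] {M : Kb C} (h : ∀ X : C, addOf M (stalk X)) :
    (ObjectProperty.singleton M).IsClassicalTriangulatedGenerator := by
  rw [ObjectProperty.isClassicalTriangulatedGenerator_iff, eq_top_iff]
  exact fun K _ => forall_prop_of_stalk _ (fun X => prop_of_addOf _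
    (ObjectProperty.le_triangEnvelope _ _ (by simp)) (h X)) K

end Silt

namespace Silt
open CategoryTheory Limits MulOpposite Opposite Pretriangulated
universe v u

lemma exists_distinguished_of_iso {C : Type*} [Category C] [HasZeroObject C] [Preadditive C]
    [HasShift C ℤ] [∀ n : ℤ, (shiftFunctor C n).Additive] [Pretriangulated C]
    {X Y Z X' Y' Z' : C} {f : X ⟶ Y} {g : Y ⟶ Z} {h : Z ⟶ X⟦(1 : ℤ)⟧}
    (H : Triangle.mk f g h ∈ distTriang C) {f' : X' ⟶ Y'} {g' : Y' ⟶ Z'}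
    (e₁ : X' ≅ X) (e₂ : Y' ≅ Y) (e₃ : Z' ≅ Z) (h₁ : f' ≫ e₂.hom = e₁.hom ≫ f)
    (h₂ : g' ≫ e₃.hom = e₂.hom ≫ g) : ∃ h', Triangle.mk f' g' h' ∈ distTriang C :=
  ⟨e₃.hom ≫ h ≫ e₁.inv⟦(1 : ℤ)⟧', distinguished_of_iso H e₁ e₂ e₃ h₁ h₂ (by
    rw [Category.assoc, Category.assoc, ← Functor.map_comp, Iso.inv_hom_id,
      CategoryTheory.Functor.map_id, Category.comp_id])⟩

/-! ### Passage to the opposite category -/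

section Op

variable (C : Type*) [Category C] [Preadditive C]

instance : (opHomotopyCategory C).Additive where
  map_add := by
    intro K L f g
    obtain ⟨f, rfl⟩ : ∃ f', f = f'.op := ⟨f.unop, rfl⟩
    obtain ⟨g, rfl⟩ : ∃ g', g = g'.op := ⟨g.unop, rfl⟩
    obtain ⟨f, rfl⟩ := (HomotopyCategory.quotient C (ComplexShape.up ℤ)).map_surjective
      (X := L.unop.as) (Y := K.unop.as) f
    obtain ⟨g, rfl⟩ := (HomotopyCategory.quotient C (ComplexShape.up ℤ)).map_surjective
      (X := L.unop.as) (Y := K.unop.as) g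
    have h : (CochainComplex.opEquivalence C).functor.map (f + g).op =
        (CochainComplex.opEquivalence C).functor.map f.op +
          (CochainComplex.opEquivalence C).functor.map g.op := rfl
    exact (congrArg (HomotopyCategory.quotient Cᵒᵖ (ComplexShape.up ℤ)).map h).trans
      (Functor.map_add _)

instance : (opHomotopyCategory C).Full where
  map_surjective {K L} f := by
    obtain ⟨f', rfl⟩ := (HomotopyCategory.quotient Cᵒᵖ (ComplexShape.up ℤ)).map_surjective
      (X := (CochainComplex.opEquivalence C).functor.obj (op K.unop.as))
      (Y := (CochainComplex.opEquivalence C).functor.obj (op L.unop.as)) f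
    obtain ⟨g, rfl⟩ := (CochainComplex.opEquivalence C).functor.map_surjective f'
    exact ⟨((HomotopyCategory.quotient C (ComplexShape.up ℤ)).map g.unop).op, rfl⟩

instance : (opHomotopyCategory C).Faithful where
  map_injective {K L} f g h := by
    obtain ⟨f, rfl⟩ : ∃ f', f = f'.op := ⟨f.unop, rfl⟩
    obtain ⟨g, rfl⟩ : ∃ g', g = g'.op := ⟨g.unop, rfl⟩
    obtain ⟨f, rfl⟩ := (HomotopyCategory.quotient C (ComplexShape.up ℤ)).map_surjective
      (X := L.unop.as) (Y := K.unop.as) f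
    obtain ⟨g, rfl⟩ := (HomotopyCategory.quotient C (ComplexShape.up ℤ)).map_surjective
      (X := L.unop.as) (Y := K.unop.as) g
    exact congrArg Quiver.Hom.op (HomotopyCategory.eq_of_homotopy _ _
      (CochainComplex.homotopyUnop (HomotopyCategory.homotopyOfEq _ _ h)))

/-- The passage to the opposite category on bounded homotopy categories. -/
def opKb : (Kb C)ᵒᵖ ⥤ Kb Cᵒᵖ :=
  (bounded Cᵒᵖ).lift ((bounded C).ι.op ⋙ opHomotopyCategory C) (by
    intro K
    obtain ⟨⟨K, a, b, h⟩⟩ := K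
    exact ⟨-b, -a, fun i hi => (h (-i) (by omega)).op⟩)

instance : (opKb C).Full := inferInstanceAs ((bounded Cᵒᵖ).lift _ _).Full
instance : (opKb C).Faithful := inferInstanceAs ((bounded Cᵒᵖ).lift _ _).Faithful
instance : (opKb C).Additive where
  map_add := by
    intro K L f g
    apply ObjectProperty.hom_ext
    exact ((bounded C).ι.op ⋙ opHomotopyCategory C).map_add

instance : (opKb C).EssSurj where
  mem_essImage := by
    rintro ⟨K, hK⟩
    obtain ⟨K, rfl⟩ := K.quotient_obj_surjective
    obtain ⟨a, b, h⟩ := hK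
    let L := (CochainComplex.opEquivalence C).inverse.obj K
    let e := (CochainComplex.opEquivalence C).counitIso.app K
    exact ⟨op ⟨(HomotopyCategory.quotient C (ComplexShape.up ℤ)).obj L.unop, -b, -a,
      fun i hi => (h (-i) (by omega)).unop⟩,
      ⟨(bounded Cᵒᵖ).ι.preimageIso ((HomotopyCategory.quotient Cᵒᵖ (ComplexShape.up ℤ)).mapIso e)⟩⟩

variable {C} [HasZeroObject C] [HasBinaryBiproducts C]

/-- Up to isomorphism, distinguished triangles come from degreewise split sequences. The opposite of
such a sequence is again degreewise split, with sections and retractions interchanged, so no mapping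
cone has to be dualised. -/
lemma exists_distinguished_op {X Y Z : HomotopyCategory C (ComplexShape.up ℤ)} (f : X ⟶ Y)
    (g : Y ⟶ Z) (h : Z ⟶ X⟦(1 : ℤ)⟧)
    (hT : Triangle.mk f g h ∈ distTriang (HomotopyCategory C (ComplexShape.up ℤ))) :
    ∃ h', Triangle.mk ((opHomotopyCategory C).map g.op) ((opHomotopyCategory C).map f.op) h' ∈
      distTriang (HomotopyCategory Cᵒᵖ (ComplexShape.up ℤ)) := by
  obtain ⟨S, σ, ⟨e⟩⟩ := (HomotopyCategory.distinguished_iff_iso_trianglehOfDegreewiseSplit _).1 hT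
  let S' : ShortComplex (CochainComplex Cᵒᵖ ℤ) := ShortComplex.mk
    ((CochainComplex.opEquivalence C).functor.map S.g.op)
    ((CochainComplex.opEquivalence C).functor.map S.f.op) (by
      rw [← Functor.map_comp, ← op_comp, S.zero]
      rfl)
  let σ' : ∀ n, (S'.map (HomologicalComplex.eval Cᵒᵖ _ n)).Splitting := fun n =>
    { r := (σ (-n)).s.op
      s := (σ (-n)).r.op
      f_r := Quiver.Hom.unop_inj (σ (-n)).s_g
      s_g := Quiver.Hom.unop_inj (σ (-n)).f_r
      id := Quiver.Hom.unop_inj ((add_comm _ _).trans (σ (-n)).id) }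
  have hT' := (HomotopyCategory.distinguished_iff_iso_trianglehOfDegreewiseSplit
    (CochainComplex.trianglehOfDegreewiseSplit S' σ')).2 ⟨_, _, ⟨Iso.refl _⟩⟩
  have hh : (CochainComplex.trianglehOfDegreewiseSplit S' σ') = Triangle.mk
    ((opHomotopyCategory C).map ((HomotopyCategory.quotient C (ComplexShape.up ℤ)).map S.g).op)
    ((opHomotopyCategory C).map ((HomotopyCategory.quotient C (ComplexShape.up ℤ)).map S.f).op)
    (CochainComplex.trianglehOfDegreewiseSplit S' σ').mor₃ := rfl
  rw [hh] at hT'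
  let e₁ : X ≅ _ := Triangle.π₁.mapIso e
  let e₂ : Y ≅ _ := Triangle.π₂.mapIso e
  let e₃ : Z ≅ _ := Triangle.π₃.mapIso e
  have c₁ : f ≫ e₂.hom = e₁.hom ≫ (HomotopyCategory.quotient C (ComplexShape.up ℤ)).map S.f :=
    e.hom.comm₁
  have c₂ : g ≫ e₃.hom = e₂.hom ≫ (HomotopyCategory.quotient C (ComplexShape.up ℤ)).map S.g :=
    e.hom.comm₂
  have key : ∀ {A B A' B' : HomotopyCategory C (ComplexShape.up ℤ)} (f : A ⟶ B) (f' : A' ⟶ B')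
      (a : A ≅ A') (b : B ≅ B'), f ≫ b.hom = a.hom ≫ f' →
      (opHomotopyCategory C).map f.op ≫ ((opHomotopyCategory C).mapIso a.symm.op).hom =
        ((opHomotopyCategory C).mapIso b.symm.op).hom ≫ (opHomotopyCategory C).map f'.op := by
    intro A B A' B' f f' a b h
    have h' : a.inv ≫ f = f' ≫ b.inv := by
      rw [Iso.inv_comp_eq, ← Category.assoc, ← h]; simp
    rw [Functor.mapIso_hom, Functor.mapIso_hom, ← Functor.map_comp, ← Functor.map_comp]
    exact congrArg (fun k => (opHomotopyCategory C).map (Quiver.Hom.op k)) h'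
  exact exists_distinguished_of_iso hT' ((opHomotopyCategory C).mapIso e₃.symm.op)
    ((opHomotopyCategory C).mapIso e₂.symm.op) ((opHomotopyCategory C).mapIso e₁.symm.op)
    (key _ _ _ _ c₂) (key _ _ _ _ c₁)

lemma exists_distinguished_opKb {X Y Z : Kb C} (f : X ⟶ Y)
    (g : Y ⟶ Z) (h : Z ⟶ X⟦(1 : ℤ)⟧) (hT : Triangle.mk f g h ∈ distTriang (Kb C)) :
    ∃ h', Triangle.mk ((opKb C).map g.op) ((opKb C).map f.op) h' ∈ distTriang (Kb Cᵒᵖ) := by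
  obtain ⟨h', hT'⟩ := exists_distinguished_op f.hom g.hom _ ((bounded C).ι.map_distinguished _ hT)
  exact exists_distinguished_of_hom _ _ _ hT'

end Op

/-! ### Functors induced on bounded homotopy categories -/

section Map

variable {C D : Type*} [Category C] [Preadditive C] [Category D] [Preadditive D]
  (F : C ⥤ D) [F.Additive]

instance : (mapKb F).Additive where
  map_add := by
    intro K L f g
    apply ObjectProperty.hom_ext
    exact ((bounded C).ι ⋙ F.mapHomotopyCategory (ComplexShape.up ℤ)).map_add

instance [F.Full] [F.Faithful] : (mapKb F).Full := inferInstanceAs ((bounded D).lift _ _).Full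

instance [F.Full] [F.Faithful] : (mapKb F).Faithful :=
  inferInstanceAs ((bounded D).lift _ _).Faithful

instance [F.Full] [F.Faithful] [F.EssSurj] : (mapKb F).EssSurj where
  mem_essImage := by
    rintro ⟨K, hK⟩
    obtain ⟨K, rfl⟩ := K.quotient_obj_surjective
    obtain ⟨a, b, h⟩ := hK
    let L : CochainComplex C ℤ :=
      { X := fun i => F.objPreimage (K.X i)
        d := fun i j => F.preimage ((F.objObjPreimageIso (K.X i)).hom ≫ K.d i j ≫
          (F.objObjPreimageIso (K.X j)).inv)
        shape := fun i j hij => by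
          apply F.map_injective
          rw [F.map_preimage, K.shape i j hij, zero_comp, comp_zero, F.map_zero]
        d_comp_d' := fun i j k _ _ => by
          apply F.map_injective
          simp }
    have e : (F.mapHomologicalComplex (ComplexShape.up ℤ)).obj L ≅ K :=
      HomologicalComplex.Hom.isoOfComponents (fun i => F.objObjPreimageIso (K.X i)) (by
        intro i j _
        have : F.map (L.d i j) = _ := F.map_preimage _
        change _ = F.map (L.d i j) ≫ _
        rw [this]
        simp
        rfl)
    have hL : ∀ i, IsZero (K.X i) → IsZero (L.X i) := fun i hi => by
      rw [IsZero.iff_id_eq_zero]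
      apply F.map_injective
      exact (hi.of_iso (F.objObjPreimageIso (K.X i))).eq_of_src _ _
    exact ⟨⟨(HomotopyCategory.quotient C (ComplexShape.up ℤ)).obj L, a, b,
      fun i hi => hL i (h i hi)⟩,
      ⟨(bounded D).ι.preimageIso ((HomotopyCategory.quotient D (ComplexShape.up ℤ)).mapIso e)⟩⟩

variable [HasZeroObject C] [HasZeroObject D]

lemma nonempty_mapKb_stalk_iso (X : C) :
    Nonempty ((mapKb F).obj (stalk X) ≅ stalk (F.obj X)) :=
  ⟨(bounded D).ι.preimageIso ((HomotopyCategory.quotient D (ComplexShape.up ℤ)).mapIso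
    ((HomologicalComplex.singleMapHomologicalComplex F (ComplexShape.up ℤ) 0).app X))⟩

lemma nonempty_single_iso {K : CochainComplex C ℤ} {X : C} (e : X ≅ K.X 0)
    (h : ∀ i, i ≠ 0 → IsZero (K.X i)) :
    Nonempty ((HomologicalComplex.single C (ComplexShape.up ℤ) 0).obj X ≅ K) := by
  let φ : (HomologicalComplex.single C (ComplexShape.up ℤ) 0).obj X ⟶ K :=
    HomologicalComplex.mkHomFromSingle e.hom fun j hj =>
      (h j (by rw [← hj]; simp)).eq_of_tgt _ _
  have : ∀ i, IsIso (φ.f i) := fun i => by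
    by_cases hi : i = 0
    · subst hi
      simp only [φ, HomologicalComplex.mkHomFromSingle_f]
      infer_instance
    · rw [(h i hi).eq_of_tgt (φ.f i)
        (IsZero.iso (HomologicalComplex.isZero_single_obj_X _ _ _ _ hi) (h i hi)).hom]
      infer_instance
  have := HomologicalComplex.Hom.isIso_of_components φ
  exact ⟨asIso φ⟩

lemma nonempty_opKb_stalk_iso (X : C) : Nonempty ((opKb C).obj (op (stalk X)) ≅ stalk (op X)) := by
  obtain ⟨e⟩ := nonempty_single_iso (K := (CochainComplex.opEquivalence C).functor.obj
    (op ((HomologicalComplex.single C (ComplexShape.up ℤ) 0).obj X)))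
    (HomologicalComplex.singleObjXSelf (ComplexShape.up ℤ) 0 X).op
    fun i hi => (HomologicalComplex.isZero_single_obj_X _ _ _ (-i) (by omega)).op
  exact ⟨((bounded Cᵒᵖ).ι.preimageIso
    ((HomotopyCategory.quotient Cᵒᵖ (ComplexShape.up ℤ)).mapIso e)).symm⟩

variable [HasBinaryBiproducts C] [HasBinaryBiproducts D]

lemma exists_distinguished_mapKb {X Y Z : Kb C} (f : X ⟶ Y)
    (g : Y ⟶ Z) (h : Z ⟶ X⟦(1 : ℤ)⟧) (hT : Triangle.mk f g h ∈ distTriang (Kb C)) :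
    ∃ h', Triangle.mk ((mapKb F).map f) ((mapKb F).map g) h' ∈ distTriang (Kb D) :=
  exists_distinguished_of_hom _ _ _ ((F.mapHomotopyCategory (ComplexShape.up ℤ)).map_distinguished
    _ ((bounded C).ι.map_distinguished _ hT))

end Map
end Silt

namespace Silt
open CategoryTheory Limits MulOpposite Opposite Pretriangulated
universe v u

/-! ### Disjointness via the functor Hom(-, P)/rad -/

section Rad

variable {C : Type u} [Category.{v} C] [Preadditive C] {P : C}

lemma LocalObj.map_mem_rad_iff {D : Type*} [Category D] [Preadditive D] (F : C ⥤ D) [F.Additive]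
    [F.Full] [F.Faithful] (hP : LocalObj P) (hP' : LocalObj (F.obj P)) {X : C} (f : X ⟶ P) :
    F.map f ∈ hP'.rad (F.obj X) ↔ f ∈ hP.rad X := by
  rw [LocalObj.mem_rad, LocalObj.mem_rad]
  constructor
  · intro h g hg
    exact h (F.map g) (by rw [← F.map_comp]; infer_instance)
  · intro h g hg
    obtain ⟨g, rfl⟩ := F.map_surjective g
    rw [← F.map_comp] at hg
    exact h g (isIso_of_reflects_iso _ F)

/-- The functor which sends `X` to the quotient of `Hom(X, P)` by the radical maps. -/
def LocalObj.topFunctor (hP : LocalObj P) : C ⥤ AddCommGrpCat.{v}ᵒᵖ where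
  obj X := op (AddCommGrpCat.of ((X ⟶ P) ⧸ hP.rad X))
  map {X Y} f := (AddCommGrpCat.ofHom (QuotientAddGroup.map (hP.rad Y) (hP.rad X)
    (Preadditive.leftComp P f) fun _ h => hP.rad_precomp h f)).op
  map_id X := by
    apply Quiver.Hom.unop_inj
    ext x
    exact congrArg QuotientAddGroup.mk (Category.id_comp x)
  map_comp f g := by
    apply Quiver.Hom.unop_inj
    ext x
    exact congrArg QuotientAddGroup.mk (Category.assoc f g x)

instance (hP : LocalObj P) : hP.topFunctor.Additive where
  map_add {X Y f g} := by
    apply Quiver.Hom.unop_inj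
    ext x
    obtain ⟨x, rfl⟩ := QuotientAddGroup.mk_surjective x
    exact congrArg QuotientAddGroup.mk (Preadditive.add_comp _ _ _ f g x)

lemma LocalObj.isIso_topFunctor_map (hP : LocalObj P) {X Y : C} (d : X ⟶ Y)
    (h₁ : ∀ α : Y ⟶ P, d ≫ α ∈ hP.rad X → α ∈ hP.rad Y)
    (h₂ : ∀ β : X ⟶ P, ∃ γ : Y ⟶ P, β - d ≫ γ ∈ hP.rad X) : IsIso (hP.topFunctor.map d) := by
  have : IsIso (hP.topFunctor.map d).unop := by
    rw [ConcreteCategory.isIso_iff_bijective]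
    constructor
    · refine (injective_iff_map_eq_zero (hP.topFunctor.map d).unop.hom).2 fun x hx => ?_
      obtain ⟨x, rfl⟩ := QuotientAddGroup.mk_surjective x
      exact (QuotientAddGroup.eq_zero_iff _).2 (h₁ x ((QuotientAddGroup.eq_zero_iff _).1 hx))
    · intro y
      obtain ⟨y, rfl⟩ := QuotientAddGroup.mk_surjective y
      obtain ⟨γ, hγ⟩ := h₂ y
      refine ⟨QuotientAddGroup.mk γ, ?_⟩
      refine (QuotientAddGroup.eq.2 ?_ : QuotientAddGroup.mk (d ≫ γ) = QuotientAddGroup.mk y)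
      rwa [neg_add_eq_sub]
  exact (isIso_unop_iff _).1 this

lemma LocalObj.not_isZero_topFunctor_obj (hP : LocalObj P) : ¬ IsZero (hP.topFunctor.obj P) := by
  intro h
  have h : IsZero (AddCommGrpCat.of ((P ⟶ P) ⧸ hP.rad P)) := h.unop
  have := AddCommGrpCat.subsingleton_of_isZero h
  exact hP.id_notMem_rad ((QuotientAddGroup.eq_zero_iff _).1
    (Subsingleton.elim (QuotientAddGroup.mk (𝟙 P)) (0 : (P ⟶ P) ⧸ hP.rad P)))

variable [HasZeroObject C]

lemma isIso_mapHomotopyCategory_stalk {D : Type*} [Category D] [Preadditive D] [HasZeroObject D]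
    (G : C ⥤ D) [G.Additive] {X Y : C} (d : X ⟶ Y) (hd : IsIso (G.map d)) :
    IsIso ((G.mapHomotopyCategory (ComplexShape.up ℤ)).map ((stalkFunctor C).map d).hom) := by
  have h : IsIso ((G ⋙ HomologicalComplex.single D (ComplexShape.up ℤ) 0).map d) := by
    exact inferInstanceAs (IsIso ((HomologicalComplex.single D (ComplexShape.up ℤ) 0).map (G.map d)))
  rw [NatIso.isIso_map_iff
    (HomologicalComplex.singleMapHomologicalComplex G (ComplexShape.up ℤ) 0).symm] at h
  have h : IsIso ((G.mapHomologicalComplex (ComplexShape.up ℤ)).map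
    ((HomologicalComplex.single C (ComplexShape.up ℤ) 0).map d)) := h
  exact Functor.map_isIso (HomotopyCategory.quotient D (ComplexShape.up ℤ))
    ((G.mapHomologicalComplex (ComplexShape.up ℤ)).map
      ((HomologicalComplex.single C (ComplexShape.up ℤ) 0).map d))

variable [HasBinaryBiproducts C]

/-- If d* is bijective, Hom(-, P)/rad turns the presentation of `T` into an isomorphism, so the
induced functor on complexes kills `T`. Its kernel is thick, so it kills the thick closure of `T`,
that is, everything, including `P`. But Hom(P, P)/rad contains the nonzero class of the identity. -/
lemma not_radSurj_of_radInj (hP : LocalObj P) (hP' : LocalObj ((stalkFunctor C).obj P)) {A A₁ A₀ T : Kb C}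
    (hA : ∀ X, addOf A X → ∃ X₀, Nonempty (X ≅ (stalkFunctor C).obj X₀))
    (d : A₁ ⟶ A₀) (π : A₀ ⟶ T) (δ : T ⟶ A₁⟦(1 : ℤ)⟧)
    (hT : Triangle.mk d π δ ∈ distTriang (Kb C)) (h₁ : addOf A A₁) (h₀ : addOf A A₀)
    (hS : IsSilting T) (hi : RadInj hP' d) : ¬ RadSurj hP' d := by
  intro hs
  obtain ⟨X₁, ⟨e₁⟩⟩ := hA _ h₁
  obtain ⟨X₀, ⟨e₀⟩⟩ := hA _ h₀
  obtain ⟨d₀, hd₀⟩ := (stalkFunctor C).map_surjective (X := X₁) (Y := X₀) (e₁.inv ≫ d ≫ e₀.hom)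
  have hd : d = e₁.hom ≫ (stalkFunctor C).map d₀ ≫ e₀.inv := by rw [hd₀]; simp
  have mem : ∀ {X : C} (f : X ⟶ P), (stalkFunctor C).map f ∈ hP'.rad ((stalkFunctor C).obj X) ↔ f ∈ hP.rad X :=
    fun f => LocalObj.map_mem_rad_iff (stalkFunctor C) hP hP' f
  have hiso : IsIso (hP.topFunctor.map d₀) := by
    apply hP.isIso_topFunctor_map
    · intro α hα
      rw [← mem] at hα ⊢
      have := hi (e₀.hom ≫ (stalkFunctor C).map α) (by
        rw [hd]
        simp only [Category.assoc, Iso.inv_hom_id_assoc]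
        rw [← Functor.map_comp]
        exact hP'.rad_precomp hα _)
      have := hP'.rad_precomp this e₀.inv
      rwa [Iso.inv_hom_id_assoc] at this
    · intro β
      obtain ⟨γ, hγ⟩ := hs (e₁.hom ≫ (stalkFunctor C).map β)
      obtain ⟨γ', hγ'⟩ := (stalkFunctor C).map_surjective (X := X₀) (Y := P) (e₀.inv ≫ γ)
      refine ⟨γ', ?_⟩
      rw [← mem, Functor.map_sub, Functor.map_comp, hγ']
      have := hP'.rad_precomp hγ e₁.inv
      rw [hd] at this
      simpa [Preadditive.comp_sub] using this
  -- With values in the opposite of abelian groups, Hom(-, P)/rad is covariant and additive, hence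
  -- induces a triangulated functor on homotopy categories.
  let F := (bounded C).ι ⋙ hP.topFunctor.mapHomotopyCategory (ComplexShape.up ℤ)
  let Q : ObjectProperty (Kb C) := fun X => IsZero (F.obj X)
  have q1 : Q.IsStableUnderRetracts := ⟨fun r h => by
    change IsZero _
    have h : 𝟙 (F.obj _) = 0 := (IsZero.iff_id_eq_zero _).1 h
    rw [IsZero.iff_id_eq_zero]
    have h2 := congrArg (fun k => F.map r.i ≫ k ≫ F.map r.r) h
    simpa [← Functor.map_comp] using h2⟩
  have q2 : Q.ContainsZero := ⟨_, isZero_zero _, F.map_isZero (isZero_zero _)⟩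
  have q3 : Q.IsStableUnderShift ℤ := ⟨fun n => ⟨fun X hX =>
    ((shiftFunctor _ n).map_isZero hX).of_iso ((F.commShiftIso n).app X)⟩⟩
  have q4 : Q.IsTriangulatedClosed₂ := .mk' (fun T hT h₁ h₃ => by
    exact Triangle.isZero₂_of_isZero₁₃ _ (F.map_distinguished T hT) h₁ h₃)
  have q5 : Q.IsTriangulated := {}
  have hQT : Q T := by
    refine (Triangle.isZero₃_iff_isIso₁ _ (F.map_distinguished _ hT)).2 ?_
    have := isIso_mapHomotopyCategory_stalk _ d₀ hiso
    change IsIso (F.map d)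
    rw [hd, F.map_comp, F.map_comp]
    have : IsIso (F.map ((stalkFunctor C).map d₀)) := this
    infer_instance
  have h6 := (ObjectProperty.triangEnvelope_le_iff (P := ObjectProperty.singleton T) (Q := Q)).2 (by
    rw [ObjectProperty.singleton_le_iff]
    exact hQT)
  rw [(ObjectProperty.isClassicalTriangulatedGenerator_iff _).1 hS.2] at h6
  have h7 : Q ((stalkFunctor C).obj P) := h6 _ trivial
  apply hP.not_isZero_topFunctor_obj
  have h8 : IsZero ((HomotopyCategory.quotient _ (ComplexShape.up ℤ)).obj
      ((HomologicalComplex.single _ (ComplexShape.up ℤ) 0).obj (hP.topFunctor.obj P))) :=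
    h7.of_iso ((HomotopyCategory.quotient _ (ComplexShape.up ℤ)).mapIso
      ((HomologicalComplex.singleMapHomologicalComplex hP.topFunctor (ComplexShape.up ℤ) 0).symm.app P))
  rw [IsZero.iff_id_eq_zero]
  exact (HomologicalComplex.single _ (ComplexShape.up ℤ) 0 ⋙
      HomotopyCategory.quotient _ (ComplexShape.up ℤ)).map_injective (h8.eq_of_src _ _)

end Rad
end Silt

namespace Silt
open CategoryTheory Limits MulOpposite Opposite Pretriangulated
universe v u

/-! ### Fitting's lemma, basic versions and minimal approximations -/

section KrullSchmidt

variable {C : Type*} [Category C] [Preadditive C]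

/-- The morphisms which are sums of morphisms that factor through a member of `l`. -/
def throughList (l : List C) (X Y : C) : AddSubgroup (X ⟶ Y) :=
  AddSubgroup.closure {f | ∃ M ∈ l, ∃ (p : X ⟶ M) (q : M ⟶ Y), p ≫ q = f}

lemma comp_mem_throughList {l : List C} {M X Y : C} (hM : M ∈ l) (p : X ⟶ M) (q : M ⟶ Y) :
    p ≫ q ∈ throughList l X Y :=
  AddSubgroup.subset_closure ⟨M, hM, p, q, rfl⟩

lemma throughList_le_iff {l : List C} {X Y : C} {H : AddSubgroup (X ⟶ Y)} :
    throughList l X Y ≤ H ↔ ∀ M ∈ l, ∀ (p : X ⟶ M) (q : M ⟶ Y), p ≫ q ∈ H :=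
  ⟨fun h _ hM p q => h (comp_mem_throughList hM p q), fun h =>
    (AddSubgroup.closure_le _).2 (by rintro _ ⟨M, hM, p, q, rfl⟩; exact h M hM p q)⟩

lemma throughList_comp {l : List C} {W X Y Z : C} (w : W ⟶ X) {f : X ⟶ Y}
    (hf : f ∈ throughList l X Y) (z : Y ⟶ Z) : w ≫ f ≫ z ∈ throughList l W Z := by
  have : throughList l X Y ≤ (throughList l W Z).comap
      ((Preadditive.leftComp Z w).comp (Preadditive.rightComp X z)) :=
    throughList_le_iff.2 fun M hM p q => by
      change w ≫ (p ≫ q) ≫ z ∈ throughList l W Z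
      rw [Category.assoc, ← Category.assoc]
      exact comp_mem_throughList hM _ _
  exact this hf

omit [Preadditive C] in
lemma exists_sublist_pairwise (l : List C) : ∃ m : List C, (∀ X ∈ m, X ∈ l) ∧
    (∀ X ∈ l, ∃ Y ∈ m, Nonempty (X ≅ Y)) ∧ m.Pairwise fun X Y => ¬ Nonempty (X ≅ Y) := by
  induction l with
  | nil => exact ⟨[], by simp, by simp, List.Pairwise.nil⟩
  | cons X l ih =>
    obtain ⟨m, hm, hlm, hmm⟩ := ih
    by_cases h : ∃ Y ∈ m, Nonempty (X ≅ Y)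
    · refine ⟨m, fun Y hY => List.mem_cons_of_mem _ (hm Y hY), fun Y hY => ?_, hmm⟩
      rcases List.mem_cons.1 hY with rfl | hY
      exacts [h, hlm Y hY]
    · push Not at h
      refine ⟨X :: m, fun Y hY => ?_, fun Y hY => ?_, List.Pairwise.cons ?_ hmm⟩
      · rcases List.mem_cons.1 hY with rfl | hY
        exacts [List.mem_cons_self, List.mem_cons_of_mem _ (hm Y hY)]
      · rcases List.mem_cons.1 hY with rfl | hY
        · exact ⟨Y, List.mem_cons_self, ⟨Iso.refl _⟩⟩
        · obtain ⟨Z, hZ, e⟩ := hlm Y hY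
          exact ⟨Z, List.mem_cons_of_mem _ hZ, e⟩
      · intro Y hY
        exact fun e => (h Y hY).elim e.some

/-- A length function on the objects of `C` together with Fitting's lemma. -/
structure FittingLength (C : Type*) [Category C] [Preadditive C] where
  /-- The length of an object. -/
  len : C → ℕ
  len_lt : ∀ {X Y : C} (r : Retract X Y), r.r ≫ r.i ≠ 𝟙 Y → len X < len Y
  -- Here p plays the projection onto the image of φⁿ along its kernel. Products in `End` are in the
  -- order of composition of functions, so p * φⁿ applies p last.
  fitting : ∀ {X : C} (φ : End X), ∃ (n : ℕ) (p : End X), p * p = p ∧ p * φ ^ n = φ ^ n ∧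
    (p = 1 → IsIso φ)

namespace FittingLength

variable (L : FittingLength C)

include L in
-- Normalise f + g to the identity by u = (f + g)⁻¹ and apply Fitting to fu. If the idempotent is 0,
-- then fu is nilpotent and gu = 1 - fu is invertible; if it is 1, then fu is invertible.
lemma localObj {X : C} (h0 : ¬ IsZero X) (h : ∀ p : X ⟶ X, p ≫ p = p → p = 0 ∨ p = 𝟙 X) :
    LocalObj X := by
  refine ⟨h0, fun f g hfg => ?_⟩
  let u : X ⟶ X := inv (f + g)
  obtain ⟨n, p, hp, hn, hi⟩ := L.fitting (X := X) (f ≫ u)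
  rcases h p hp with h1 | h1
  · right
    have h2 : IsNilpotent (show End X from f ≫ u) := ⟨n, by rw [← hn, h1]; exact comp_zero⟩
    have h3 : IsUnit (1 - (show End X from f ≫ u)) := h2.isUnit_one_sub
    have h4 : 1 - (show End X from f ≫ u) = g ≫ u := by
      have : (f + g) ≫ u = 𝟙 X := IsIso.hom_inv_id _
      rw [Preadditive.add_comp] at this
      exact sub_eq_of_eq_add' this.symm
    rw [h4, isUnit_iff_isIso] at h3
    have h5 : IsIso (g ≫ u) := h3
    exact IsIso.of_isIso_comp_right g u
  · left
    have h5 : IsIso (f ≫ u) := hi h1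
    exact IsIso.of_isIso_comp_right f u

variable [IsIdempotentComplete C]

include L in
-- A nontrivial idempotent splits `X` into two strictly shorter summands; if there is none, a
-- nonzero `X` is local by Fitting.
lemma exists_local_list (X : C) : ∃ l : List C, (∀ Y ∈ l, LocalObj Y ∧ Nonempty (Retract Y X)) ∧
    𝟙 X ∈ throughList l X X := by
  induction hk : L.len X using Nat.strong_induction_on generalizing X with
  | _ k ih =>
  by_cases h0 : IsZero X
  · refine ⟨[], by simp, ?_⟩
    rw [(IsZero.iff_id_eq_zero _).1 h0]
    exact zero_mem _
  by_cases h : ∀ p : X ⟶ X, p ≫ p = p → p = 0 ∨ p = 𝟙 X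
  · refine ⟨[X], ?_, ?_⟩
    · simpa using ⟨L.localObj h0 h, ⟨Retract.refl X⟩⟩
    · simpa using comp_mem_throughList (l := [X]) (by simp) (𝟙 X) (𝟙 X)
  · push Not at h
    obtain ⟨p, hp, hp0, hp1⟩ := h
    obtain ⟨Y, i, r, hir, hri⟩ := IsIdempotentComplete.idempotents_split X p hp
    obtain ⟨Z, i', r', hir', hri'⟩ := IsIdempotentComplete.idempotents_split X (𝟙 X - p) (by
      simp [Preadditive.sub_comp, Preadditive.comp_sub, hp])
    obtain ⟨l, hl, hl'⟩ := ih _ (hk ▸ L.len_lt ⟨i, r, hir⟩ (by rwa [hri])) Y rfl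
    obtain ⟨m, hm, hm'⟩ := ih _ (hk ▸ L.len_lt ⟨i', r', hir'⟩ (by rw [hri']; simpa using hp0)) Z rfl
    refine ⟨l ++ m, fun W hW => ?_, ?_⟩
    · rcases List.mem_append.1 hW with hW | hW
      · exact ⟨(hl W hW).1, (hl W hW).2.map fun s => s.trans ⟨i, r, hir⟩⟩
      · exact ⟨(hm W hW).1, (hm W hW).2.map fun s => s.trans ⟨i', r', hir'⟩⟩
    · have h1 := throughList_comp r hl' i
      have h2 := throughList_comp r' hm' i'
      rw [Category.id_comp] at h1 h2
      rw [hri] at h1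
      rw [hri'] at h2
      rw [show 𝟙 X = p + (𝟙 X - p) by abel]
      exact add_mem (throughList_le_iff.2 (fun M hM p q => comp_mem_throughList (by simp [hM]) p q) h1)
        (throughList_le_iff.2 (fun M hM p q => comp_mem_throughList (by simp [hM]) p q) h2)

include L in
/-- An object `X` and the biproduct of the pairwise non-isomorphic local summands of `X` are
summands of finite sums of copies of each other. -/
lemma exists_basic_version [HasFiniteBiproducts C] (X : C) :
    ∃ (n : ℕ) (Y : Fin n → C), (∀ i, LocalObj (Y i)) ∧ (∀ i j, Nonempty (Y i ≅ Y j) → i = j) ∧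
      𝟙 X ∈ through (⨁ Y) X X ∧ 𝟙 (⨁ Y) ∈ through X (⨁ Y) (⨁ Y) := by
  obtain ⟨l, hl, hX⟩ := L.exists_local_list X
  obtain ⟨m, hm, hlm, hmm⟩ := exists_sublist_pairwise l
  refine ⟨m.length, fun i => m[i], fun i => (hl _ (hm _ (List.getElem_mem _))).1, ?_, ?_, ?_⟩
  · intro i j ⟨e⟩
    rcases lt_trichotomy i j with h | h | h
    · exact (List.pairwise_iff_getElem.1 hmm i j i.2 j.2 h ⟨e⟩).elim
    · exact h
    · exact (List.pairwise_iff_getElem.1 hmm j i j.2 i.2 h ⟨e.symm⟩).elim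
  · refine throughList_le_iff.2 (fun M hM p q => ?_) hX
    obtain ⟨M', hM', ⟨e⟩⟩ := hlm M hM
    obtain ⟨i, hi, rfl⟩ := List.getElem_of_mem hM'
    have := comp_mem_through (p ≫ e.hom ≫ biproduct.ι (fun i : Fin m.length => m[i]) ⟨i, hi⟩)
      (biproduct.π (fun i : Fin m.length => m[i]) ⟨i, hi⟩ ≫ e.inv ≫ q)
    simpa using this
  · rw [← biproduct.total]
    refine sum_mem fun i _ => ?_
    obtain ⟨r⟩ := (hl _ (hm _ (List.getElem_mem i.2))).2
    have := comp_mem_through (biproduct.π (fun i : Fin m.length => m[i]) i ≫ r.i)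
      (r.r ≫ biproduct.ι (fun i : Fin m.length => m[i]) i)
    simpa using this

include L in
/-- If `g` is a left approximation of `P` by `M`, there is a minimal one. -/
lemma exists_minimal_approx [HasFiniteBiproducts C] {P M : C}
    (h : ∃ (n : ℕ) (g : Fin n → (P ⟶ M)), ∀ x : P ⟶ M, ∃ h : Fin n → (M ⟶ M), ∑ i, g i ≫ h i = x) :
    ∃ (M' : C) (f : P ⟶ M'), 𝟙 M' ∈ through M M' M' ∧ (∀ x : P ⟶ M, ∃ h : M' ⟶ M, f ≫ h = x) ∧
      ∀ φ : M' ⟶ M', f ≫ φ = f → IsIso φ := by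
  -- Minimality comes from an approximation whose target has least length.
  let T : ℕ → Prop := fun k => ∃ (M' : C) (f : P ⟶ M'), L.len M' = k ∧ 𝟙 M' ∈ through M M' M' ∧
    (∀ x : P ⟶ M, ∃ h : M' ⟶ M, f ≫ h = x)
  have hT : ∃ k, T k := by
    obtain ⟨n, g, hg⟩ := h
    refine ⟨_, ⨁ fun _ : Fin n => M, biproduct.lift g, rfl, ?_, fun x => ?_⟩
    · rw [← biproduct.total]
      exact sum_mem_through _ _
    · obtain ⟨h, rfl⟩ := hg x
      exact ⟨biproduct.desc h, by rw [biproduct.lift_desc]⟩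
  classical
  obtain ⟨M', f, hk, hM', hf⟩ := Nat.find_spec hT
  refine ⟨M', f, hM', hf, fun φ hφ => ?_⟩
  obtain ⟨n, p, hp, hn, hi⟩ := L.fitting (X := M') φ
  refine hi (by_contra fun hp1 => ?_)
  obtain ⟨Y, i, r, hir, hri⟩ := IsIdempotentComplete.idempotents_split M' p hp
  have h1 : ∀ n : ℕ, f ≫ ((show End M' from φ) ^ n) = f := fun n => by
    induction n with
    | zero => exact Category.comp_id f
    | succ n ih =>
      rw [pow_succ']
      exact (Category.assoc _ _ _).symm.trans ((congrArg (· ≫ φ) ih).trans hφ)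
  -- Since φ fixes f, so does φⁿ, and therefore so does the Fitting idempotent p. If p ≠ 1, its
  -- image is a shorter target for an approximation.
  have h2 : f ≫ p = f := by
    have h3 : f ≫ ((show End M' from φ) ^ n) ≫ p = f ≫ ((show End M' from φ) ^ n) :=
      congrArg (f ≫ ·) hn
    rwa [← Category.assoc, h1] at h3
  refine Nat.find_min hT (m := L.len Y) (hk ▸ L.len_lt ⟨i, r, hir⟩ (by rwa [hri])) ⟨Y, f ≫ r, rfl, ?_, ?_⟩
  · have := through_precomp i (through_postcomp hM' r)
    rwa [Category.id_comp, hir] at this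
  · intro x
    obtain ⟨h, rfl⟩ := hf x
    exact ⟨i ≫ h, by rw [Category.assoc, reassoc_of% hri, ← Category.assoc, h2]⟩

end FittingLength

/-- A retract of `X` has a complement if idempotents split. -/
lemma exists_iso_biprod_of_retract [IsIdempotentComplete C] [HasBinaryBiproducts C] {X Y : C}
    (r : Retract Y X) : ∃ Z, Nonempty (X ≅ Y ⊞ Z) := by
  obtain ⟨Z, i', r', hir', hri'⟩ := IsIdempotentComplete.idempotents_split X (𝟙 X - r.r ≫ r.i) (by
    simp [Preadditive.sub_comp, Preadditive.comp_sub])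
  have h1 : r.i ≫ r' = 0 := by
    have : r.i ≫ (r' ≫ i') ≫ r' = 0 := by
      rw [hri', Preadditive.sub_comp, Preadditive.comp_sub]
      simp
    rwa [Category.assoc, hir', Category.comp_id] at this
  have h2 : i' ≫ r.r = 0 := by
    have : i' ≫ (r' ≫ i') ≫ r.r = 0 := by
      rw [hri', Preadditive.sub_comp, Preadditive.comp_sub]
      simp
    rwa [Category.assoc, reassoc_of% hir'] at this
  refine ⟨Z, ⟨⟨biprod.lift r.r r', biprod.desc r.i i', ?_, ?_⟩⟩⟩
  · rw [biprod.lift_desc, hri']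
    abel
  · ext <;> simp [h1, h2, hir']

omit [Preadditive C] in
-- The idempotent of F(X) defined by the retract lifts to `X` and splits there.
lemma exists_obj_iso_of_retract {D : Type*} [Category D] (F : C ⥤ D) [F.Full] [F.Faithful]
    [IsIdempotentComplete C] {X : C} {Y : D} (r : Retract Y (F.obj X)) :
    ∃ X₀, Nonempty (Retract X₀ X) ∧ Nonempty (F.obj X₀ ≅ Y) := by
  obtain ⟨p, hp⟩ := F.map_surjective (r.r ≫ r.i)
  obtain ⟨Z, i, s, his, hsi⟩ := IsIdempotentComplete.idempotents_split X p
    (F.map_injective (by rw [F.map_comp, hp]; simp))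
  have h1 : F.map s ≫ F.map i = r.r ≫ r.i := by rw [← F.map_comp, hsi, hp]
  have h2 : F.map i ≫ F.map s = 𝟙 _ := by rw [← F.map_comp, his, F.map_id]
  refine ⟨Z, ⟨⟨i, s, his⟩⟩, ⟨F.map i ≫ r.r, r.i ≫ F.map s, ?_, ?_⟩⟩
  · rw [Category.assoc, ← Category.assoc r.r, ← h1, Category.assoc, h2, Category.comp_id, h2]
  · rw [Category.assoc, ← Category.assoc (F.map s), h1]
    simp

end KrullSchmidt
end Silt

namespace Silt
open CategoryTheory Limits MulOpposite Opposite Pretriangulated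
universe v u

/-! ### Existence of left mutations at stalk complexes -/

section StalkKrullSchmidt

variable {C : Type*} [Category C] [Preadditive C] [HasZeroObject C] [HasBinaryBiproducts C]
  [HasFiniteBiproducts C]

lemma exists_iso_stalk_of_addOf [IsIdempotentComplete C] {A : C} {X : Kb C}
    (h : addOf ((stalkFunctor C).obj A) X) :
    ∃ X₀, Nonempty (X ≅ (stalkFunctor C).obj X₀) := by
  obtain ⟨n, ⟨r⟩⟩ := h
  obtain ⟨X₀, -, ⟨e⟩⟩ := exists_obj_iso_of_retract (stalkFunctor C) (X := ⨁ fun _ : Fin n => A)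
    (r.trans ((stalkFunctor C).mapBiproduct fun _ : Fin n => A).symm.retract)
  exact ⟨X₀, ⟨e.symm⟩⟩

omit [HasFiniteBiproducts C] in
lemma addOf_stalk_iff {M X : C} :
    addOf ((stalkFunctor C).obj M) ((stalkFunctor C).obj X) ↔ 𝟙 X ∈ through M X X := by
  rw [addOf_iff]
  constructor
  · intro h
    apply mem_through_of_map (stalkFunctor C)
    rwa [CategoryTheory.Functor.map_id]
  · intro h
    have := through_map (stalkFunctor C) h
    rwa [CategoryTheory.Functor.map_id] at this

omit [HasFiniteBiproducts C] in
lemma isMinLeftApprox_stalk {P M M' : C} {f : P ⟶ M'} (hM' : 𝟙 M' ∈ through M M' M')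
    (hf : ∀ x : P ⟶ M, ∃ h : M' ⟶ M, f ≫ h = x) (hmin : ∀ φ : M' ⟶ M', f ≫ φ = f → IsIso φ) :
    IsMinLeftApprox ((stalkFunctor C).obj M) ((stalkFunctor C).map f) where
  mem := addOf_stalk_iff.2 hM'
  factors N hN g := by
    obtain ⟨n, p, q, hpq⟩ := exists_sum_of_mem_through (addOf_iff.1 hN)
    have h1 : ∀ j, ∃ h, (stalkFunctor C).map f ≫ h = g ≫ p j := fun j => by
      obtain ⟨x, hx⟩ := (stalkFunctor C).map_surjective (g ≫ p j)
      obtain ⟨h, rfl⟩ := hf x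
      exact ⟨(stalkFunctor C).map h, by rw [← Functor.map_comp, hx]⟩
    choose h hh using h1
    refine ⟨∑ j, h j ≫ q j, ?_⟩
    rw [Preadditive.comp_sum]
    simp_rw [← Category.assoc, hh, Category.assoc]
    rw [← Preadditive.comp_sum, ← hpq, Category.comp_id]
  minimal φ hφ := by
    obtain ⟨φ, rfl⟩ := (stalkFunctor C).map_surjective φ
    rw [← Functor.map_comp] at hφ
    have := hmin φ ((stalkFunctor C).map_injective hφ)
    infer_instance

/-- Everything except the cone is built in the additive category and moved along the fully faithful
stalk functor: `P`, being local, is a summand of the basic version of `A`, and its complement `M`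
has a minimal left approximation. -/
lemma exists_isLeftMutation [IsIdempotentComplete C] (L : FittingLength C) {A P : C}
    (hP : LocalObj P) (hPA : Nonempty (Retract P A))
    (hfin : ∀ M : C, ∃ (n : ℕ) (g : Fin n → (P ⟶ M)), ∀ x : P ⟶ M, ∃ h : Fin n → (M ⟶ M),
      ∑ i, g i ≫ h i = x) :
    ∃ B U : Kb C, IsBasicVersion B ((stalkFunctor C).obj A) ∧
      IsLeftMutation B ((stalkFunctor C).obj P) U := by
  obtain ⟨n, Y, hY, hinj, hA, hB⟩ := L.exists_basic_version A
  obtain ⟨r⟩ := hPA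
  obtain ⟨s⟩ := hP.retract_of_mem_through (M := ⨁ Y) (by
    have := through_precomp r.i (through_postcomp hA r.r)
    rwa [Category.id_comp, r.retract] at this)
  obtain ⟨M, ⟨e⟩⟩ := exists_iso_biprod_of_retract s
  obtain ⟨M', f, hM', hf, hmin⟩ := L.exists_minimal_approx (hfin M)
  obtain ⟨Z, g, h, hT⟩ := distinguished_cocone_triangle ((stalkFunctor C).map f)
  have := preservesBinaryBiproduct_of_preservesBiproduct (stalkFunctor C) P M
  refine ⟨(stalkFunctor C).obj (⨁ Y), Z ⊞ (stalkFunctor C).obj M, ⟨?_, ?_⟩,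
    (stalkFunctor C).obj M, (stalkFunctor C).obj M', Z, (stalkFunctor C).map f, g, h,
    ⟨(stalkFunctor C).mapIso e ≪≫ (stalkFunctor C).mapBiprod P M⟩, isMinLeftApprox_stalk hM' hf hmin, hT,
    ⟨Iso.refl _⟩⟩
  · refine ⟨n, fun i => (stalkFunctor C).obj (Y i), fun i => ((hY i).map _).indecomposable,
      fun i j ⟨e⟩ => hinj i j ⟨(stalkFunctor C).preimageIso e⟩, ⟨(stalkFunctor C).mapBiproduct Y⟩⟩
  · exact addOf_eq_iff.2 ⟨addOf_stalk_iff.2 hB, addOf_stalk_iff.2 hA⟩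

end StalkKrullSchmidt
end Silt

namespace Silt
open CategoryTheory Limits MulOpposite Opposite Pretriangulated
universe v u

/-! ### Finitely generated projectives over artinian rings and finite-dimensional algebras -/

section Proj

variable {R : Type u} [Ring R]

instance : HasFiniteBiproducts (Proj R) := by
  have := hasFiniteProducts_of_has_binary_and_terminal (C := Proj R)
  exact .of_hasFiniteProducts

lemma Proj.comp_apply {X Y Z : Proj R} (f : X ⟶ Y) (g : Y ⟶ Z) (x : X.obj) :
    (f ≫ g).hom x = g.hom (f.hom x) := rfl

/-- A morphism of projective modules from a linear map. -/
abbrev Proj.ofHom {X Y : Proj R} (f : X.obj →ₗ[R] Y.obj) : X ⟶ Y :=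
  ObjectProperty.homMk (ModuleCat.ofHom f)

lemma Proj.hom_ext {X Y : Proj R} {f g : X ⟶ Y} (h : ∀ x : X.obj, f.hom x = g.hom x) : f = g :=
  ObjectProperty.hom_ext _ (ModuleCat.hom_ext (LinearMap.ext h))

lemma Proj.isIso_of_bijective {X Y : Proj R} (f : X ⟶ Y) (h : Function.Bijective f.hom) :
    IsIso f := by
  have : IsIso ((fgProj R).ι.map f) := (ConcreteCategory.isIso_iff_bijective f.hom).2 h
  exact isIso_of_reflects_iso f (fgProj R).ι

instance : IsIdempotentComplete (Proj R) where
  idempotents_split X p hp := by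
    have hp' : ∀ x, p.hom (p.hom x) = p.hom x := fun x => by
      rw [← Proj.comp_apply, hp]
    obtain ⟨_, _⟩ := X.property
    let N := LinearMap.range p.hom.hom
    let s : X.obj →ₗ[R] N := p.hom.hom.rangeRestrict
    have h : s ∘ₗ N.subtype = LinearMap.id := by
      refine LinearMap.ext fun ⟨x, y, hy⟩ => Subtype.ext ?_
      change p.hom x = x
      rw [← hy]
      exact hp' y
    let Y : Proj R := ⟨ModuleCat.of R N,
      Module.Finite.of_surjective s fun x => ⟨N.subtype x, LinearMap.congr_fun h x⟩,
      Module.Projective.of_split N.subtype s h⟩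
    exact ⟨Y, Proj.ofHom (X := Y) N.subtype, Proj.ofHom (Y := Y) s,
      Proj.hom_ext fun x => LinearMap.congr_fun h x, Proj.hom_ext fun x => rfl⟩

lemma Proj.pow_hom {X : Proj R} (φ : End X) (n : ℕ) : (φ ^ n).hom.hom = φ.hom.hom ^ n := by
  induction n with
  | zero => rfl
  | succ n ih => rw [pow_succ, pow_succ, ← ih]; rfl

lemma isArtinian_of_proj [IsArtinianRing R] (X : Proj R) : IsArtinian R X.obj ∧ IsNoetherian R X.obj := by
  obtain ⟨_, _⟩ := X.property
  exact ⟨inferInstance, inferInstance⟩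

/-- The length of modules over an artinian ring. -/
noncomputable def Proj.fittingLength [IsArtinianRing R] : FittingLength (Proj R) where
  len X := (Module.length R X.obj).toNat
  len_lt {X Y} r hr := by
    obtain ⟨_, _⟩ := isArtinian_of_proj X
    obtain ⟨_, _⟩ := isArtinian_of_proj Y
    have hne : Module.length R Y.obj ≠ ⊤ := Module.length_ne_top
    have hle : Module.length R X.obj < Module.length R Y.obj := by
      have hi : Function.Injective r.i.hom.hom :=
        Function.LeftInverse.injective (g := r.r.hom) fun x => by
          rw [← Proj.comp_apply, r.retract]; rfl
      rw [(LinearEquiv.ofInjective r.i.hom.hom hi).length_eq]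
      refine Submodule.length_lt fun h => hr (Proj.hom_ext fun y => ?_)
      obtain ⟨x, rfl⟩ := LinearMap.range_eq_top.1 h y
      change (r.i ≫ r.r ≫ r.i).hom x = _
      rw [r.retract_assoc]
      rfl
    rw [← ENat.natCast_lt_natCast, ENat.natCast_toNat hne, ENat.natCast_toNat (ne_top_of_lt hle)]
    exact hle
  fitting {X} φ := by
    obtain ⟨_, _⟩ := isArtinian_of_proj X
    -- The exponent must be at least 1: for n = 0 the projection is the identity whatever φ is, and
    -- says nothing about surjectivity of φ.
    obtain ⟨n, hn⟩ := (φ.hom.hom.eventually_isCompl_ker_pow_range_pow.and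
      (Filter.eventually_ge_atTop 1)).exists
    obtain ⟨hn, h1⟩ := hn
    let q : X.obj →ₗ[R] X.obj := Submodule.projection _ _ hn.symm
    have hq : ∀ x, q (q x) = q x := fun x =>
      Submodule.projection_apply_of_mem_left _ (Submodule.projection_apply_mem _ x)
    have hq' : ∀ x, q ((φ.hom.hom ^ n) x) = (φ.hom.hom ^ n) x := fun x =>
      Submodule.projection_apply_of_mem_left _ ⟨x, rfl⟩
    refine ⟨n, Proj.ofHom q, Proj.hom_ext hq, Proj.hom_ext fun x => ?_, fun h => ?_⟩
    · have := hq' x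
      rw [← Proj.pow_hom] at this
      exact this
    · have hs : Function.Surjective φ.hom.hom := fun x => by
        have h2 : q x = x := congrArg (fun f : End X => f.hom x) h
        obtain ⟨y, hy⟩ := (Submodule.projection_eq_self_iff _ _).1 h2
        obtain ⟨m, rfl⟩ := Nat.exists_eq_add_of_le' h1
        exact ⟨(φ.hom.hom ^ m) y, by rw [← hy, pow_succ']; rfl⟩
      exact Proj.isIso_of_bijective φ (IsNoetherian.bijective_of_surjective_endomorphism _ hs)

/-- Hom(P, M) is finite-dimensional over K, and scalars act through endomorphisms of `M`, so a
spanning family over K is enough. -/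
lemma Proj.exists_finite_generation {K : Type*} [Field K] [Algebra K R] [FiniteDimensional K R]
    (P M : Proj R) : ∃ (n : ℕ) (g : Fin n → (P ⟶ M)), ∀ x : P ⟶ M, ∃ h : Fin n → (M ⟶ M),
      ∑ i, g i ≫ h i = x := by
  obtain ⟨_, _⟩ := P.property
  obtain ⟨_, _⟩ := M.property
  let _ : Module K P.obj := Module.compHom P.obj (algebraMap K R)
  let _ : Module K M.obj := Module.compHom M.obj (algebraMap K R)
  have : IsScalarTower K R P.obj := ⟨fun c r x => by
    rw [Algebra.smul_def, mul_smul]; rfl⟩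
  have : IsScalarTower K R M.obj := ⟨fun c r x => by
    rw [Algebra.smul_def, mul_smul]; rfl⟩
  have : Module.Finite K P.obj := Module.Finite.trans R _
  have : Module.Finite K M.obj := Module.Finite.trans R _
  have : SMulCommClass R K M.obj := IsScalarTower.to_smulCommClass'
  have : Module.Finite K (P.obj →ₗ[R] M.obj) :=
    Module.Finite.of_injective (LinearMap.restrictScalarsₗ K R P.obj M.obj K)
      (LinearMap.restrictScalars_injective K)
  obtain ⟨n, s, hs⟩ := Module.Finite.exists_fin (R := K) (M := P.obj →ₗ[R] M.obj)
  refine ⟨n, fun i => Proj.ofHom (s i), fun x => ?_⟩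
  obtain ⟨c, hc⟩ := Submodule.mem_span_range_iff_exists_fun K |>.1
    (hs ▸ Submodule.mem_top : x.hom.hom ∈ Submodule.span K (Set.range s))
  refine ⟨fun i => Proj.ofHom (c i • LinearMap.id), Proj.hom_ext fun y => ?_⟩
  have h1 : ∀ (t : Finset (Fin n)), (∑ i ∈ t, (Proj.ofHom (s i) : P ⟶ M) ≫
      (Proj.ofHom (c i • LinearMap.id) : M ⟶ M)).hom y = (∑ i ∈ t, c i • s i) y := fun t => by
    classical
    induction t using Finset.induction_on with
    | empty => rfl
    | insert a t ha ih =>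
      rw [Finset.sum_insert ha, Finset.sum_insert ha, LinearMap.add_apply, ← ih]
      rfl
  rw [h1, hc]

end Proj

end Silt

namespace Silt
open CategoryTheory Limits MulOpposite Pretriangulated
universe v u

/-! ### The modules Λ and eΛ -/

section Regular

variable (Λ : Type u) [Ring Λ]

/-- The regular right module. -/
def regularProj : Proj Λᵐᵒᵖ := ⟨ModuleCat.of Λᵐᵒᵖ Λ, fgProj_regular Λ⟩

variable {Λ}

/-- The morphism from the regular module determined by an element. -/
def Proj.ofElem {X : Proj Λᵐᵒᵖ} (x : X.obj) : regularProj Λ ⟶ X :=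
  Proj.ofHom
    { toFun := fun a : Λ => op a • x
      map_add' := fun (a b : Λ) => add_smul (op a) (op b) x
      map_smul' := fun r (a : Λ) => by
        change op (a * unop r) • x = r • op a • x
        rw [op_mul, mul_smul, op_unop] }

lemma Proj.hom_ext_regular {X : Proj Λᵐᵒᵖ} {f g : regularProj Λ ⟶ X}
    (h : f.hom (1 : Λ) = g.hom (1 : Λ)) : f = g := Proj.hom_ext fun (a : Λ) => by
  have h1 : ∀ f : regularProj Λ ⟶ X, f.hom a = op a • f.hom (1 : Λ) := fun f => by
    refine Eq.trans ?_ (f.hom.hom.map_smul (op a) (1 : Λ))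
    exact congrArg f.hom (one_mul a).symm
  rw [h1, h1, h]

lemma Proj.sum_hom {R : Type u} [Ring R] {X Y : Proj R} {ι : Type*} (s : Finset ι)
    (f : ι → (X ⟶ Y)) (x : X.obj) : (∑ i ∈ s, f i).hom x = ∑ i ∈ s, (f i).hom x := by
  classical
  induction s using Finset.induction_on with
  | empty => rfl
  | insert a t ha ih => rw [Finset.sum_insert ha, Finset.sum_insert ha, ← ih]; rfl

lemma Proj.id_mem_through_regular (X : Proj Λᵐᵒᵖ) : 𝟙 X ∈ through (regularProj Λ) X X := by
  obtain ⟨_, _⟩ := X.property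
  obtain ⟨n, f, g, -, -, hfg⟩ := Module.Finite.exists_comp_eq_id_of_projective Λᵐᵒᵖ X.obj
  let p : Fin n → (X ⟶ regularProj Λ) := fun k => Proj.ofHom
    { toFun := fun x => (unop (g x k) : Λ)
      map_add' := fun x y => by rw [map_add]; rfl
      map_smul' := fun r x => by rw [map_smul]; rfl }
  have h : 𝟙 X = ∑ k, p k ≫ Proj.ofElem (f (Pi.single k 1)) := Proj.hom_ext fun x => by
    rw [Proj.sum_hom]
    have h1 : x = f (g x) := (LinearMap.congr_fun hfg x).symm
    have h2 : g x = ∑ k, g x k • Pi.single k (1 : Λᵐᵒᵖ) := by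
      simpa using pi_eq_sum_univ' (g x)
    change x = _
    conv_lhs => rw [h1, h2, map_sum]
    refine Finset.sum_congr rfl fun k _ => ?_
    exact f.map_smul _ _
  rw [h]
  exact sum_mem_through _ _

/-- The right module `eΛ`. -/
def spanProj {e : Λ} (he : IsIdempotentElem e) : Proj Λᵐᵒᵖ :=
  ⟨ModuleCat.of Λᵐᵒᵖ (Submodule.span Λᵐᵒᵖ {e}), fgProj_span he⟩

/-- The generator `e` of `eΛ`. -/
def spanGen {e : Λ} (he : IsIdempotentElem e) : (spanProj he).obj :=
  (⟨e, Submodule.mem_span_singleton_self e⟩ : Submodule.span Λᵐᵒᵖ {e})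

lemma exists_smul_spanGen {e : Λ} (he : IsIdempotentElem e) (x : (spanProj he).obj) :
    ∃ a : Λ, x = op a • spanGen he := by
  obtain ⟨a, ha⟩ := Submodule.mem_span_singleton.1
    (show Submodule.span Λᵐᵒᵖ {e} from x).2
  exact ⟨unop a, Subtype.ext ha.symm⟩

lemma hom_ext_spanProj {e : Λ} (he : IsIdempotentElem e) {X : Proj Λᵐᵒᵖ} {f g : spanProj he ⟶ X}
    (h : f.hom (spanGen he) = g.hom (spanGen he)) : f = g := Proj.hom_ext fun x => by
  obtain ⟨a, rfl⟩ := exists_smul_spanGen he x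
  exact (f.hom.hom.map_smul _ _).trans ((congrArg (op a • ·) h).trans (g.hom.hom.map_smul _ _).symm)

/-- The inclusion of `eΛ` in `Λ`. -/
def spanIncl {e : Λ} (he : IsIdempotentElem e) : spanProj he ⟶ regularProj Λ :=
  Proj.ofHom (X := spanProj he) (Y := regularProj Λ) (Submodule.span Λᵐᵒᵖ {e}).subtype

lemma smul_spanGen {e : Λ} (he : IsIdempotentElem e) : op e • spanGen he = spanGen he :=
  Subtype.ext he.eq

/-- `eΛ` is a summand of `Λ`. -/
def spanRetract {e : Λ} (he : IsIdempotentElem e) : Retract (spanProj he) (regularProj Λ) where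
  i := spanIncl he
  r := Proj.ofElem (spanGen he)
  retract := hom_ext_spanProj he (smul_spanGen he)

/-- An idempotent endomorphism of eΛ is left multiplication by the image f of e. Then f and e - f
are orthogonal idempotents with sum e, so primitivity leaves only 0 and the identity, and Fitting
gives locality. -/
lemma localObj_spanProj {K : Type v} [Field K] [Algebra K Λ] [FiniteDimensional K Λ] {e : Λ}
    (he : IsPrimitiveIdempotent e) : LocalObj (spanProj he.idem) := by
  have : FiniteDimensional K Λᵐᵒᵖ := .of_injective (opLinearEquiv K).symm.toLinearMap
    (opLinearEquiv K).symm.injective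
  have : IsArtinianRing Λᵐᵒᵖ := IsArtinianRing.of_finite K Λᵐᵒᵖ
  refine Proj.fittingLength.localObj ?_ fun φ hφ => ?_
  · intro h
    have h1 : (𝟙 (spanProj he.idem) : spanProj he.idem ⟶ spanProj he.idem) = 0 := h.eq_of_src _ _
    have h2 : spanGen he.idem = 0 :=
      congrArg (fun f : spanProj he.idem ⟶ spanProj he.idem => f.hom (spanGen he.idem)) h1
    exact he.ne_zero (congrArg Subtype.val h2)
  · let f : Λ := (show Submodule.span Λᵐᵒᵖ {e} from φ.hom (spanGen he.idem)).1
    have hmul : ∀ a : Λ, (φ ≫ spanIncl he.idem).hom (op a • spanGen he.idem) = f * a := fun a =>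
      (φ ≫ spanIncl he.idem).hom.hom.map_smul _ _
    have hef : e * f = f := by
      obtain ⟨a, ha⟩ := exists_smul_spanGen he.idem (φ.hom (spanGen he.idem))
      have : f = e * a := congrArg Subtype.val ha
      rw [this, ← mul_assoc, he.idem.eq]
    have hfe : f * e = f := by
      rw [← hmul e, smul_spanGen]
      rfl
    have hff : f * f = f := by
      have h1 : φ.hom (φ.hom (spanGen he.idem)) = φ.hom (spanGen he.idem) :=
        congrArg (fun f : spanProj he.idem ⟶ spanProj he.idem => f.hom (spanGen he.idem)) hφ
      have h2 : φ.hom (spanGen he.idem) = op f • spanGen he.idem := Subtype.ext hef.symm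
      rw [← hmul f, ← h2]
      exact congrArg Subtype.val h1
    rcases he.primitive f (e - f) hff
      (by simp [IsIdempotentElem, mul_sub, sub_mul, hff, hef, hfe, he.idem.eq])
      (by simp [mul_sub, hff, hfe]) (by simp [sub_mul, hff, hef]) (by simp) with h | h
    · left
      exact hom_ext_spanProj he.idem (Subtype.ext h)
    · right
      exact hom_ext_spanProj he.idem (Subtype.ext (sub_eq_zero.1 h).symm)

end Regular
end Silt

namespace Silt
open CategoryTheory Limits MulOpposite Pretriangulated
universe v u

/-! ### Right approximations by the regular module -/

section Approx

variable {C : Type*} [Category C] [Preadditive C] [HasZeroObject C] [HasBinaryBiproducts C]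

omit [HasBinaryBiproducts C] in
lemma sum_single_map_comp {Q : C} {K : CochainComplex C ℤ} {n : ℕ} (y : Fin n → (Q ⟶ Q))
    (m : Fin n → (Q ⟶ K.X 0)) (hm : ∀ k j, (ComplexShape.up ℤ).Rel 0 j → m k ≫ K.d 0 j = 0)
    (f : (HomologicalComplex.single C (ComplexShape.up ℤ) 0).obj Q ⟶ K)
    (hy : ∑ k, y k ≫ m k =
      (HomologicalComplex.singleObjXSelf (ComplexShape.up ℤ) 0 Q).inv ≫ f.f 0) :
    ∑ k, (HomologicalComplex.single C (ComplexShape.up ℤ) 0).map (y k) ≫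
      HomologicalComplex.mkHomFromSingle (m k) (hm k) = f := by
  apply HomologicalComplex.from_single_hom_ext
  have h (φ : Fin n → ((HomologicalComplex.single C (ComplexShape.up ℤ) 0).obj Q ⟶ K)) :
      (∑ k, φ k).f 0 = ∑ k, (φ k).f 0 :=
    Functor.map_sum (HomologicalComplex.eval C (ComplexShape.up ℤ) 0) _ _
  rw [← cancel_epi (HomologicalComplex.singleObjXSelf (ComplexShape.up ℤ) 0 Q).inv, ← hy, h,
    Preadditive.comp_sum]
  refine Finset.sum_congr rfl fun k _ => ?_
  simp [HomologicalComplex.single_map_f_self]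

/-- Finitely many generators of the morphisms from `Q` to the cycles in degree zero
give an approximation of a complex by a complex concentrated in degree zero. -/
lemma exists_approx_of_cycles {Q : C} (K : Kb C)
    (h : ∃ (n : ℕ) (m : Fin n → (Q ⟶ K.obj.as.X 0)), (∀ k j, m k ≫ K.obj.as.d 0 j = 0) ∧
      ∀ x : Q ⟶ K.obj.as.X 0, x ≫ K.obj.as.d 0 1 = 0 → ∃ y : Fin n → (Q ⟶ Q),
        ∑ k, y k ≫ m k = x) :
    ∃ (A₀ : Kb C) (π : A₀ ⟶ K), addOf ((stalkFunctor C).obj Q) A₀ ∧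
      ∀ x : (stalkFunctor C).obj Q ⟶ K, ∃ y : (stalkFunctor C).obj Q ⟶ A₀, y ≫ π = x := by
  obtain ⟨n, m, hm, hgen⟩ := h
  let μ : ∀ (x : Q ⟶ K.obj.as.X 0) (_ : ∀ j, x ≫ K.obj.as.d 0 j = 0),
      (HomologicalComplex.single C (ComplexShape.up ℤ) 0).obj Q ⟶ K.obj.as :=
    fun x hx => HomologicalComplex.mkHomFromSingle x fun j _ => hx j
  let p : Fin n → ((stalkFunctor C).obj Q ⟶ K) := fun k =>
    ObjectProperty.homMk ((HomotopyCategory.quotient C (ComplexShape.up ℤ)).map (μ (m k) (hm k)))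
  refine ⟨⨁ fun _ : Fin n => (stalkFunctor C).obj Q, biproduct.desc p, ⟨n, ⟨Retract.refl _⟩⟩,
    fun x => ?_⟩
  obtain ⟨f, hf⟩ := (HomotopyCategory.quotient C (ComplexShape.up ℤ)).map_surjective
    (X := (HomologicalComplex.single C (ComplexShape.up ℤ) 0).obj Q) (Y := K.obj.as) x.hom
  -- A chain map from a stalk is its degree-zero component, which must be a cycle. Lifting chain
  -- maps suffices, so homotopies play no role.
  let z : Q ⟶ K.obj.as.X 0 := (HomologicalComplex.singleObjXSelf (ComplexShape.up ℤ) 0 Q).inv ≫ f.f 0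
  obtain ⟨y, hy⟩ := hgen z (by
    rw [Category.assoc, f.comm]
    simp)
  refine ⟨biproduct.lift fun k => (stalkFunctor C).map (y k), ?_⟩
  rw [biproduct.lift_desc]
  have key := sum_single_map_comp y m (fun k j _ => hm k j) f hy
  apply (bounded C).ι.map_injective
  refine Eq.trans ?_ hf
  rw [← key, Functor.map_sum, Functor.map_sum]
  refine Finset.sum_congr rfl fun k _ => ?_
  rw [Functor.map_comp, Functor.map_comp]
  rfl

end Approx

section Regular

variable {Λ : Type u} [Ring Λ]

/-- Maps from Λ killed by d are elements of ker d, a finitely generated module because Λ is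
noetherian. -/
lemma exists_cycle_generators [IsNoetherianRing Λᵐᵒᵖ] {X Y : Proj Λᵐᵒᵖ} (d : X ⟶ Y) :
    ∃ (n : ℕ) (m : Fin n → (regularProj Λ ⟶ X)), (∀ k, m k ≫ d = 0) ∧
      ∀ x : regularProj Λ ⟶ X, x ≫ d = 0 → ∃ y : Fin n → (regularProj Λ ⟶ regularProj Λ),
        ∑ k, y k ≫ m k = x := by
  obtain ⟨_, _⟩ := X.property
  obtain ⟨n, s, hs⟩ := Module.Finite.exists_fin (R := Λᵐᵒᵖ) (M := LinearMap.ker d.hom.hom)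
  refine ⟨n, fun k => Proj.ofElem (s k).1, fun k => Proj.hom_ext_regular ?_, fun x hx => ?_⟩
  · change d.hom (op (1 : Λ) • (s k).1) = 0
    rw [op_one, one_smul]
    exact (s k).2
  · have hz : x.hom (1 : Λ) ∈ LinearMap.ker d.hom.hom :=
      congrArg (fun f : regularProj Λ ⟶ Y => f.hom (1 : Λ)) hx
    obtain ⟨c, hc⟩ := (Submodule.mem_span_range_iff_exists_fun Λᵐᵒᵖ).1
      (hs ▸ Submodule.mem_top : (⟨_, hz⟩ : LinearMap.ker d.hom.hom) ∈
        Submodule.span Λᵐᵒᵖ (Set.range s))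
    refine ⟨fun k => Proj.ofElem (X := regularProj Λ) (unop (c k) : Λ), Proj.hom_ext_regular ?_⟩
    refine (Proj.sum_hom _ _ _).trans ?_
    have h1 := congrArg (LinearMap.ker d.hom.hom).subtype hc
    rw [map_sum] at h1
    refine Eq.trans (Finset.sum_congr rfl fun k _ => ?_) h1
    change op (unop (c k) * 1) • (s k).1 = c k • (s k).1
    rw [mul_one, op_unop]

lemma exists_approx_regular [IsNoetherianRing Λᵐᵒᵖ] (K : Perf Λ) :
    ∃ (A₀ : Perf Λ) (π : A₀ ⟶ K), addOf (regular Λ) A₀ ∧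
      ∀ x : regular Λ ⟶ K, ∃ y : regular Λ ⟶ A₀, y ≫ π = x := by
  obtain ⟨n, m, hm, h⟩ := exists_cycle_generators (K.obj.as.d 0 1)
  refine exists_approx_of_cycles (Q := regularProj Λ) K ⟨n, m, fun k j => ?_, h⟩
  by_cases hj : (0 : ℤ) + 1 = j
  · rw [zero_add] at hj
    subst hj
    exact hm k
  · rw [K.obj.as.shape 0 j hj, comp_zero]

lemma regular_generator : (ObjectProperty.singleton (regular Λ)).IsClassicalTriangulatedGenerator :=
  isClassicalTriangulatedGenerator_of_addOf fun X =>
    addOf_stalk_iff.2 (Proj.id_mem_through_regular X)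

end Regular
end Silt

namespace Silt
open CategoryTheory Limits MulOpposite Pretriangulated
universe v u

/-! ### The Λ-dual is an equivalence -/

section Dual

variable {Λ : Type u} [Ring Λ]

lemma Proj.exists_dual_basis {R : Type u} [Ring R] (X : Proj R) :
    ∃ (n : ℕ) (x : Fin n → X.obj) (c : Fin n → (X.obj →ₗ[R] R)), ∀ y, ∑ k, c k y • x k = y := by
  obtain ⟨_, _⟩ := X.property
  obtain ⟨n, f, g, -, -, hfg⟩ := Module.Finite.exists_comp_eq_id_of_projective R X.obj
  refine ⟨n, fun k => f (Pi.single k 1), fun k => LinearMap.proj k ∘ₗ g, fun y => ?_⟩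
  have h1 : f (g y) = y := LinearMap.congr_fun hfg y
  have h2 : g y = ∑ k, g y k • Pi.single k (1 : R) := by
    simpa using pi_eq_sum_univ' (g y)
  rw [h2, map_sum] at h1
  refine Eq.trans (Finset.sum_congr rfl fun k _ => ?_) h1
  rw [map_smul]
  rfl

/-- The dual basis lemma with coordinates in `Λ`. -/
lemma Proj.exists_dual_basis_op (X : Proj Λᵐᵒᵖ) :
    ∃ (n : ℕ) (x : Fin n → X.obj) (c : Fin n → (X.obj →ₗ[Λᵐᵒᵖ] Λ)),
      ∀ y, ∑ k, op (c k y) • x k = y := by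
  obtain ⟨n, x, c, h⟩ := X.exists_dual_basis
  exact ⟨n, x, fun k =>
    { toFun := fun y => unop (c k y)
      map_add' := fun y z => by rw [map_add]; rfl
      map_smul' := fun r y => by rw [map_smul]; rfl }, h⟩

instance : (dual Λ).Faithful where
  map_injective {P Q} f g h := by
    apply Quiver.Hom.unop_inj
    refine Proj.hom_ext fun y => ?_
    obtain ⟨n, x, c, hc⟩ := P.unop.exists_dual_basis_op
    rw [← hc (f.unop.hom y), ← hc (g.unop.hom y)]
    refine Finset.sum_congr rfl fun k _ => ?_
    have h1 : c k (f.unop.hom y) = c k (g.unop.hom y) := LinearMap.congr_fun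
      (show (c k ∘ₗ f.unop.hom.hom) = (c k ∘ₗ g.unop.hom.hom) from
        congrArg (fun h : (dual Λ).obj P ⟶ (dual Λ).obj Q => h.hom (c k)) h) y
    rw [h1]

instance : (dual Λ).Full where
  map_surjective {P Q} h := by
    obtain ⟨n, x, c, hc⟩ := P.unop.exists_dual_basis_op
    let h' : (P.unop.obj →ₗ[Λᵐᵒᵖ] Λ) →ₗ[Λ] (Q.unop.obj →ₗ[Λᵐᵒᵖ] Λ) := h.hom.hom
    -- The preimage is forced by the dual basis: its k-th coordinate has to be the image under h' of
    -- the k-th coordinate functional.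
    let f : Q.unop ⟶ P.unop := Proj.ofHom
      { toFun := fun y => ∑ k, op (h' (c k) y) • x k
        map_add' := fun y z => by
          simp only [map_add, MulOpposite.op_add, add_smul, Finset.sum_add_distrib]
        map_smul' := fun r y => by
          rw [RingHom.id_apply, Finset.smul_sum]
          refine Finset.sum_congr rfl fun k _ => ?_
          rw [map_smul, smul_smul]
          rfl }
    refine ⟨f.op, Proj.hom_ext fun (ψ : P.unop.obj →ₗ[Λᵐᵒᵖ] Λ) => ?_⟩
    change ψ ∘ₗ f.hom.hom = h' ψ
    have hψ : ψ = ∑ k, ψ (x k) • c k := LinearMap.ext fun y => by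
      conv_lhs => rw [← hc y]
      rw [map_sum, LinearMap.sum_apply]
      refine Finset.sum_congr rfl fun k _ => ?_
      rw [map_smul]
      rfl
    refine LinearMap.ext fun y => ?_
    conv_rhs => rw [hψ, map_sum, LinearMap.sum_apply]
    change ψ (∑ k, op (h' (c k) y) • x k) = _
    rw [map_sum]
    refine Finset.sum_congr rfl fun k _ => ?_
    rw [map_smul, map_smul]
    rfl

lemma id_mem_through_dual_regular (N : Proj Λ) :
    𝟙 N ∈ through ((dual Λ).obj (Opposite.op (regularProj Λ))) N N := by
  obtain ⟨n, x, c, hc⟩ := N.exists_dual_basis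
  let p : Fin n → (N ⟶ (dual Λ).obj (Opposite.op (regularProj Λ))) := fun k => Proj.ofHom
    { toFun := fun y => (show Λ →ₗ[Λᵐᵒᵖ] Λ from
        { toFun := fun a => c k y * a
          map_add' := fun a b => mul_add _ _ _
          map_smul' := fun r a => (mul_assoc _ _ _).symm })
      map_add' := fun y z => LinearMap.ext fun a => by
        change c k (y + z) * a = c k y * a + c k z * a
        rw [map_add, add_mul]
      map_smul' := fun r y => LinearMap.ext fun a => by
        change c k (r • y) * a = r * (c k y * a)
        rw [map_smul, smul_eq_mul, mul_assoc] }
  let q : Fin n → ((dual Λ).obj (Opposite.op (regularProj Λ)) ⟶ N) := fun k => Proj.ofHom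
    { toFun := fun ψ => (show Λ →ₗ[Λᵐᵒᵖ] Λ from ψ) 1 • x k
      map_add' := fun ψ χ => add_smul _ _ _
      map_smul' := fun r ψ => mul_smul _ _ _ }
  have h : 𝟙 N = ∑ k, p k ≫ q k := Proj.hom_ext fun y => by
    rw [Proj.sum_hom]
    refine (hc y).symm.trans (Finset.sum_congr rfl fun k _ => ?_)
    change c k y • x k = (c k y * 1) • x k
    rw [mul_one]
  rw [h]
  exact sum_mem_through _ _

/-- Every projective left module is a summand of copies of the dual of Λ, and a fully faithful
functor from an idempotent complete category reaches such summands. -/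
instance : (dual Λ).EssSurj where
  mem_essImage N := by
    obtain ⟨n, p, q, hpq⟩ := exists_sum_of_mem_through (id_mem_through_dual_regular N)
    have r : Retract N (⨁ fun _ : Fin n => (dual Λ).obj (Opposite.op (regularProj Λ))) :=
      ⟨biproduct.lift p, biproduct.desc q, by rw [biproduct.lift_desc, hpq]⟩
    have : HasFiniteBiproducts (Proj Λᵐᵒᵖ)ᵒᵖ := .of_hasFiniteProducts
    obtain ⟨X₀, -, e⟩ := exists_obj_iso_of_retract (dual Λ)
      (X := ⨁ fun _ : Fin n => Opposite.op (regularProj Λ))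
      (r.trans ((dual Λ).mapBiproduct fun _ : Fin n => Opposite.op (regularProj Λ)).symm.retract)
    exact ⟨X₀, e⟩

end Dual

/-! ### Transport along a ring isomorphism -/

section Twist

variable {R S : Type u} [Ring R] [Ring S] (τ : S ≃+* R)

instance : (twist τ).Faithful where
  map_injective {P Q} _ _ h := Proj.hom_ext fun x =>
    congrArg (fun k : (twist τ).obj P ⟶ (twist τ).obj Q => k.hom x) h

instance : (twist τ).Full where
  map_surjective {P Q} f := by
    let g : P ⟶ Q := Proj.ofHom
      { toFun := fun x => f.hom x
        map_add' := fun x y => f.hom.hom.map_add x y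
        map_smul' := fun r x => by
          obtain ⟨s, rfl⟩ := τ.surjective r
          exact f.hom.hom.map_smul s x }
    exact ⟨g, rfl⟩

instance : (twist τ).EssSurj where
  mem_essImage N := by
    let f : (twist τ).obj ((twist τ.symm).obj N) ⟶ N := Proj.ofHom
      { toFun := fun x => x
        map_add' := fun x y => rfl
        map_smul' := fun s x => by
          change τ.symm (τ s) • (show N.obj from x) = s • (show N.obj from x)
          rw [RingEquiv.symm_apply_apply] }
    have : IsIso f := Proj.isIso_of_bijective f Function.bijective_id
    exact ⟨_, ⟨asIso f⟩⟩

end Twist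

/-- Three rotations shift a triangle and negate all three maps; the automorphism -1 of the middle
term removes the signs of the first two. -/
lemma exists_distinguished_shift {C : Type*} [Category C] [HasZeroObject C] [Preadditive C]
    [HasShift C ℤ] [∀ n : ℤ, (shiftFunctor C n).Additive] [Pretriangulated C]
    {X Y Z : C} {f : X ⟶ Y} {g : Y ⟶ Z} {h : Z ⟶ X⟦(1 : ℤ)⟧}
    (hT : Triangle.mk f g h ∈ distTriang C) :
    ∃ h', Triangle.mk (f⟦(1 : ℤ)⟧') (g⟦(1 : ℤ)⟧') h' ∈ distTriang C := by
  have h₁ : Triangle.mk (-f⟦(1 : ℤ)⟧') (-g⟦(1 : ℤ)⟧') (-h⟦(1 : ℤ)⟧') ∈ distTriang C :=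
    rot_of_distTriang _ (rot_of_distTriang _ (rot_of_distTriang _ hT))
  exact exists_distinguished_of_iso h₁ (Iso.refl _) ⟨-𝟙 _, -𝟙 _, by simp, by simp⟩ (Iso.refl _)
    (by simp) (by simp)

/-! ### The functor S_σ and its values on Λ and eΛ -/

section SFunctor

variable {K : Type v} {Λ : Type u} [Ring Λ] [Field K] [Algebra K Λ] (σ : Λᵐᵒᵖ ≃ₐ[K] Λ)

instance : (transport σ).Additive := inferInstanceAs (mapKb _).Additive
instance : (transport σ).Full := inferInstanceAs (mapKb _).Full
instance : (transport σ).Faithful := inferInstanceAs (mapKb _).Faithful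
instance : (transport σ).EssSurj := inferInstanceAs (mapKb _).EssSurj

/-- Displays S_σ as a composite of functors already known to be equivalences, so that its instances
can be inferred. -/
lemma sFunctor_eq :
    sFunctor σ = opKb (Proj Λᵐᵒᵖ) ⋙ mapKb (dual Λ) ⋙ transport σ ⋙
      shiftFunctor (Perf Λ) (1 : ℤ) := rfl

instance : (sFunctor σ).Additive := by rw [sFunctor_eq]; infer_instance
instance : (sFunctor σ).Full := by rw [sFunctor_eq]; infer_instance
instance : (sFunctor σ).Faithful := by rw [sFunctor_eq]; infer_instance
instance : (sFunctor σ).EssSurj := by rw [sFunctor_eq]; infer_instance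

lemma exists_distinguished_sFunctor {X Y Z : Perf Λ} (f : X ⟶ Y) (g : Y ⟶ Z)
    (h : Z ⟶ X⟦(1 : ℤ)⟧) (hT : Triangle.mk f g h ∈ distTriang (Perf Λ)) :
    ∃ h', Triangle.mk ((sFunctor σ).map g.op) ((sFunctor σ).map f.op) h' ∈
      distTriang (Perf Λ) := by
  obtain ⟨h₁, hT₁⟩ := exists_distinguished_opKb f g h hT
  obtain ⟨h₂, hT₂⟩ := exists_distinguished_mapKb (dual Λ) _ _ _ hT₁
  obtain ⟨h₃, hT₃⟩ := exists_distinguished_mapKb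
    (twist (AlgEquiv.opComm σ.symm).toRingEquiv) _ _ _ hT₂
  exact exists_distinguished_shift hT₃

/-- `S_σ` sends `eΛ` to a shift of `eΛ` when `σ e = e`. -/
lemma nonempty_twist_dual_spanProj_iso {e : Λ} (he : IsIdempotentElem e) (hσ : σ (op e) = e) :
    Nonempty ((twist (AlgEquiv.opComm σ.symm).toRingEquiv).obj
      ((dual Λ).obj (Opposite.op (spanProj he))) ≅ spanProj he) := by
  let D := (twist (AlgEquiv.opComm σ.symm).toRingEquiv).obj
      ((dual Λ).obj (Opposite.op (spanProj he)))
  -- From φ(e) = φ(e)e and σ(e) = e one gets σ(φ(e)) = eσ(φ(e)), as σ reverses products. So φ ↦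
  -- σ(φ(e)) takes values in eΛ.
  have mem : ∀ φ : (spanProj he).obj →ₗ[Λᵐᵒᵖ] Λ, ∃ b, e * b = σ (op (φ (spanGen he))) := fun φ => by
    refine ⟨σ (op (φ (spanGen he))), ?_⟩
    refine (congrArg (· * _) hσ.symm).trans ((map_mul σ _ _).symm.trans ?_)
    have := φ.map_smul (op e) (spanGen he)
    rw [smul_spanGen] at this
    exact congrArg (fun x => σ (op x)) this.symm
  let f : D ⟶ spanProj he := Proj.ofHom
    { toFun := fun (φ : (spanProj he).obj →ₗ[Λᵐᵒᵖ] Λ) =>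
        (⟨σ (op (φ (spanGen he))), Submodule.mem_span_singleton.2 (by
          obtain ⟨b, hb⟩ := mem φ
          exact ⟨op b, hb⟩)⟩ : Submodule.span Λᵐᵒᵖ {e})
      map_add' := fun φ ψ => Subtype.ext (by
        change σ (op (_ + _)) = σ _ + σ _
        rw [MulOpposite.op_add, map_add])
      map_smul' := fun r φ => Subtype.ext (by
        change σ (op (unop (σ.symm (unop r)) * _)) = σ _ * unop r
        rw [op_mul, map_mul, op_unop, AlgEquiv.apply_symm_apply]) }
  have hf : Function.Bijective f.hom := by
    constructor
    · intro (φ : (spanProj he).obj →ₗ[Λᵐᵒᵖ] Λ) (ψ : (spanProj he).obj →ₗ[Λᵐᵒᵖ] Λ) h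
      have h1 : σ (op (φ (spanGen he))) = σ (op (ψ (spanGen he))) := congrArg Subtype.val h
      have h2 := op_injective (σ.injective h1)
      refine LinearMap.ext fun x => ?_
      obtain ⟨a, rfl⟩ := exists_smul_spanGen he x
      rw [map_smul, map_smul, h2]
    · intro x
      obtain ⟨b, rfl⟩ := exists_smul_spanGen he x
      -- The functional hitting eb is left multiplication by σ⁻¹(b)e: applied to e it gives σ⁻¹(b)e,
      -- which σ sends to eb.
      let c : Λ := unop (σ.symm b) * e
      let φ : (spanProj he).obj →ₗ[Λᵐᵒᵖ] Λ :=
        { toFun := fun y => c * (show Submodule.span Λᵐᵒᵖ {e} from y).1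
          map_add' := fun y z => mul_add _ _ _
          map_smul' := fun r y => (mul_assoc _ _ _).symm }
      refine ⟨φ, Subtype.ext ?_⟩
      change σ (op (unop (σ.symm b) * e * e)) = e * b
      rw [mul_assoc, he.eq, op_mul, map_mul, op_unop, AlgEquiv.apply_symm_apply, hσ]
  have := Proj.isIso_of_bijective f hf
  exact ⟨asIso f⟩

lemma nonempty_sFunctor_stalk_iso {X Y : Proj Λᵐᵒᵖ}
    (e : (twist (AlgEquiv.opComm σ.symm).toRingEquiv).obj
      ((dual Λ).obj (Opposite.op X)) ≅ Y) :
    Nonempty ((sFunctor σ).obj (Opposite.op (stalk X)) ≅ (stalk Y)⟦(1 : ℤ)⟧) := by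
  obtain ⟨e₁⟩ := nonempty_opKb_stalk_iso X
  obtain ⟨e₂⟩ := nonempty_mapKb_stalk_iso (dual Λ) (Opposite.op X)
  obtain ⟨e₃⟩ := nonempty_mapKb_stalk_iso (twist (AlgEquiv.opComm σ.symm).toRingEquiv)
    ((dual Λ).obj (Opposite.op X))
  exact ⟨(shiftFunctor (Perf Λ) (1 : ℤ)).mapIso
    ((transport σ).mapIso ((mapKb (dual Λ)).mapIso e₁ ≪≫ e₂) ≪≫ e₃ ≪≫
      (stalkFunctor (Proj Λᵐᵒᵖ)).mapIso e)⟩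

/-- Viewing Λ as eΛ with e = 1 lets a single computation give both S(A) ≅ A[1] and S(P) ≅ P[1]. -/
lemma nonempty_regularProj_iso :
    Nonempty (regularProj Λ ≅ spanProj (e := (1 : Λ)) IsIdempotentElem.one) :=
  ⟨⟨Proj.ofElem (spanGen IsIdempotentElem.one), spanIncl IsIdempotentElem.one,
    Proj.hom_ext_regular (one_mul (1 : Λ)), (spanRetract IsIdempotentElem.one).retract⟩⟩

end SFunctor
end Silt

/-! ### The theorem for the perfect derived category -/

theorem theorem1p4 {K Λ : Type*} [Field K] [IsAlgClosed K] [Ring Λ] [Algebra K Λ]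
    [FiniteDimensional K Λ] (σ : Λᵐᵒᵖ ≃ₐ[K] Λ) {e : Λ} (he : Silt.IsPrimitiveIdempotent e)
    (hσ : σ (MulOpposite.op e) = e) :
    let A : Silt.Perf Λ := Silt.regular Λ
    let P : Silt.Perf Λ := Silt.idemProj he.idem
    let S : Silt.IsoClass (Silt.Perf Λ) → Silt.IsoClass (Silt.Perf Λ) :=
      Silt.isoClassMap (Silt.sFunctor σ)
    -- the two parts form a partition
    Silt.minusPart A P ∪ Silt.plusPart A P = Silt.twoSilt A ∧
    Disjoint (Silt.minusPart A P) (Silt.plusPart A P) ∧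
    -- `S_σ` is an order-reversing bijection between them
    Set.BijOn S (Silt.minusPart A P) (Silt.plusPart A P) ∧
    (∀ t ∈ Silt.minusPart A P, ∀ u ∈ Silt.minusPart A P,
      Silt.clsGeq t u ↔ Silt.clsGeq (S u) (S t)) ∧
    -- cardinalities
    Cardinal.mk (Silt.twoSilt A) = 2 * Cardinal.mk (Silt.minusPart A P) ∧
    Cardinal.mk (Silt.twoSilt A) = 2 * Cardinal.mk (Silt.plusPart A P) ∧
    ((Silt.twoSilt A).Finite → Even (Silt.twoSilt A).ncard) := by
  intro A P S
  have : FiniteDimensional K Λᵐᵒᵖ :=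
    .of_injective (MulOpposite.opLinearEquiv K).symm.toLinearMap
      (MulOpposite.opLinearEquiv K).symm.injective
  have : IsArtinianRing Λᵐᵒᵖ := IsArtinianRing.of_finite K Λᵐᵒᵖ
  have : IsNoetherianRing Λᵐᵒᵖ := IsNoetherianRing.of_finite K Λᵐᵒᵖ
  have hP₀ : Silt.LocalObj (Silt.spanProj he.idem) := Silt.localObj_spanProj (K := K) he
  have hP : Silt.LocalObj P := hP₀.map (Silt.stalkFunctor _)
  obtain ⟨i⟩ := Silt.nonempty_regularProj_iso (Λ := Λ)
  obtain ⟨j⟩ := Silt.nonempty_twist_dual_spanProj_iso σ IsIdempotentElem.one (map_one σ)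
  obtain ⟨eA⟩ := Silt.nonempty_sFunctor_stalk_iso σ
    ((((Silt.twist _).mapIso ((Silt.dual Λ).mapIso i.op)).symm.trans j).trans i.symm)
  obtain ⟨k⟩ := Silt.nonempty_twist_dual_spanProj_iso σ he.idem hσ
  obtain ⟨eP⟩ := Silt.nonempty_sFunctor_stalk_iso σ k
  exact Silt.partition_of_duality (Silt.sFunctor σ) (Silt.exists_distinguished_sFunctor σ)
    (A := A) (P := P) eA eP (Silt.geq_stalk _ _) Silt.regular_generator
    Silt.exists_approx_regular hP
    (Silt.exists_isLeftMutation Silt.Proj.fittingLength hP₀ ⟨Silt.spanRetract he.idem⟩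
      fun M => Silt.Proj.exists_finite_generation (K := K) _ M)
    fun d π δ hT h₁ h₀ hS => Silt.not_radSurj_of_radInj hP₀ hP
      (fun X hX => Silt.exists_iso_stalk_of_addOf hX) d π δ hT h₁ h₀ hS
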